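/- Let $N\ge 0$, $r\ge 1$, $k\ge 2$, $m\ge 0$ be integers with $mk\le N$, and let $c\in\mathbb C\setminus\{0\}$, where $c=\frac1k$ if $m\ge 1$ (deformed model; for $m=0$, the non-deformed model, $c\neq0$ is arbitrary). Let $S_N$ act on $\mathbb C[e^{\pm x_1},\dots,e^{\pm x_N}]$ by permuting the variables, $s_{ij}$ being the transpositions, and put $$\nabla_i^{\rm tr}=\partial_{x_i}+\sum_{j<i}\frac{c}{1-e^{x_i-x_j}}(1-s_{ij})-\sum_{j>i}\frac{c}{1-e^{x_j-x_i}}(1-s_{ij})-c(i-1),\qquad D_i=\partial_{x_i}-\sum_{j\ne i}\frac{c}{1-e^{x_j-x_i}}(1-s_{ij}).$$ Let $\mathcal I$ be the space of those elements of $\mathbb C[e^{\pm x_1},\dots,e^{\pm x_N}]$ that vanish on $\bigcup_{w\in S_N}w(\pi_{m,k})$, where $\pi_{m,k}=\{x\in\mathbb C^N: x_1=\dots=x_k,\ \dots,\ x_{(m-1)k+1}=\dots=x_{mk}\}$, let $M=\mathbb C[e^{\pm x_1},\dots,e^{\pm x_N}]/\mathcal I$, $U=(\mathbb C^r)^{\otimes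 N}$, $\widetilde M=U\otimes M$, and let $\widetilde M^{S_N}$ be the space of invariants of the diagonal action of $S_N$ (permuting tensor factors and variables). Let $Y(gl_r)$ be the Yangian: the unital associative $\mathbb C$-algebra generated by the coefficients of $t^{ab}(u)=\delta_{ab}+\sum_{n\ge1}t^{ab}_nu^{-n}$ $(1\le a,b\le r)$ subject to $R_{12}(u-v)t_1(u)t_2(v)=t_2(v)t_1(u)R_{12}(u-v)$ with $R_{12}(u-v)=1-\frac{c}{u-v}\sum_{a,b}E^{ab}\otimes E^{ba}$. Let $$\det{}_q(u)=\sum_{\sigma\in S_r}(-1)^\sigma\, t^{1,\sigma(1)}(u-c(r-1))\,t^{2,\sigma(2)}(u-c(r-2))\cdots t^{r,\sigma(r)}(u).$$ Theorem. The operators $\nabla^{\rm tr}_i$ and $D_i$ preserve $\mathcal I$, hence act on $M$; the $\nabla_i^{\rm tr}$ commute pairwise; for every symmetric polynomial $p\in\mathbb C[x_1,\dots,x_N]^{S_N}$ the operator $\mathrm{id}\otimes p(\nabla^{\rm tr}_1,\dots,\nabla^{\rm tr}_N)$ preserves $\widetilde M^{S_N}$ (its restriction is the integral $H_p$ of the generalised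 trigonometric spin Calogero–Moser system); and $$t^{ab}(u)\mapsto\delta_{ab}+\sum_{i=1}^N\frac{c\,E^{ab}_i}{u-D_i}$$ (expanded in powers of $u^{-1}$, with $E_i^{ab}$ the matrix unit acting on the $i$-th factor of $U$) defines a representation of $Y(gl_r)$ on $\widetilde M^{S_N}$. In this representation: 1. The image of the centre of $Y(gl_r)$ is the algebra generated by the integrals $H_p$, $p\in\mathbb C[x_1,\dots,x_N]^{S_N}$, and so is the algebra generated by the images of the coefficients of $\det_q(u)$. 2. The image of the Gelfand–Tsetlin subalgebra (generated by the images in $Y(gl_r)$ of the centres of $Y(gl_1),\dots,Y(gl_r)$ under $t^{ab}(u)\mapsto t^{ab}(u)$), and the image of any maximal commutative subalgebra of $Y(gl_r)$, is a commutative algebra containing all the $H_p$. 3. The image of $Y(gl_r)$ commutes with all the $H_p$. -/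

import Mathlib

open scoped TensorProduct

noncomputable section

namespace SpinCM

/-! ## The polynomial representation of the trigonometric Cherednik algebra of type `GL_N` -/

/-- The group algebra of the weight lattice `ℤ^N`: Laurent polynomials in `e^{x_1}, …, e^{x_N}`. -/
abbrev Laurent (N : ℕ) : Type := AddMonoidAlgebra ℂ (Fin N → ℤ)

/-- The exponential `e^{(α, x)}`. -/
def expo {N : ℕ} (α : Fin N → ℤ) : Laurent N := AddMonoidAlgebra.single α 1

/-- The linear map on Laurent polynomials with prescribed values on the exponentials. -/
def linExt {N : ℕ} {E : Type*} [AddCommGroup E] [Module ℂ E] (g : (Fin N → ℤ) → E) :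
    Laurent N →ₗ[ℂ] E :=
  (Finsupp.linearCombination ℂ g).comp (AddMonoidAlgebra.coeffLinearEquiv ℂ).toLinearMap

lemma linExt_expo {N : ℕ} {E : Type*} [AddCommGroup E] [Module ℂ E] (g : (Fin N → ℤ) → E)
    (α : Fin N → ℤ) : linExt g (expo α) = g α := by
  simp [linExt, expo]

/-- The value at the point `x ∈ ℂ^N` of a Laurent polynomial in the `e^{x_i}`. -/
def evalAt {N : ℕ} (x : Fin N → ℂ) : Laurent N →ₗ[ℂ] ℂ :=
  linExt fun α => Complex.exp (∑ i, (α i : ℂ) * x i)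

/-- The action of `S_N` on functions, `(w f)(x) = f(w⁻¹ x)`, that is `w e^α = e^{w α}`. -/
def permAct {N : ℕ} (w : Equiv.Perm (Fin N)) : Laurent N →ₗ[ℂ] Laurent N :=
  linExt fun α => expo fun i => α (w.symm i)

/-- The partial derivative `∂_{x_i}`. -/
def pderiv {N : ℕ} (i : Fin N) : Laurent N →ₗ[ℂ] Laurent N :=
  linExt fun α => (α i : ℂ) • expo α

/-- The root `e_i - e_j`. -/
def root {N : ℕ} (i j : Fin N) : Fin N → ℤ := Pi.single i 1 - Pi.single j 1

/-- The operator `(1 - e^{x_j - x_i})⁻¹ (1 - s_{ij})` on Laurent polynomials, written out on the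
exponentials as a finite geometric sum; see `divDiff_spec`. -/
def divDiff {N : ℕ} (i j : Fin N) : Laurent N →ₗ[ℂ] Laurent N :=
  linExt fun α =>
    if α j ≤ α i then ∑ l ∈ Finset.range (α i - α j).toNat, expo (α - (l : ℤ) • root i j)
    else -∑ l ∈ Finset.range (α j - α i).toNat,
      expo ((fun p => α (Equiv.swap i j p)) - (l : ℤ) • root i j)

lemma expo_mul {N : ℕ} (α β : Fin N → ℤ) : expo α * expo β = expo (α + β) := by
  simp [expo, AddMonoidAlgebra.single_mul_single]

lemma linExt_induction {N : ℕ} {E : Type*} [AddCommGroup E] [Module ℂ E]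
    (F G : Laurent N →ₗ[ℂ] E) (h : ∀ α, F (expo α) = G (expo α)) : F = G := by
  apply AddMonoidAlgebra.lhom_ext'
  intro α
  ext
  simpa [expo] using h α

/-- Telescoping of the geometric sum. -/
lemma geom_telescope {N : ℕ} (α β : Fin N → ℤ) (n : ℕ) :
    (1 - expo (-β)) * ∑ l ∈ Finset.range n, expo (α - (l : ℤ) • β)
      = expo α - expo (α - (n : ℤ) • β) := by
  rw [sub_mul, one_mul, Finset.mul_sum, ← Finset.sum_sub_distrib]
  have : ∀ l ∈ Finset.range n, expo (α - (l : ℤ) • β) - expo (-β) * expo (α - (l : ℤ) • β)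
      = expo (α - (l : ℤ) • β) - expo (α - ((l + 1 : ℕ) : ℤ) • β) := by
    intro l _
    rw [expo_mul]
    congr 2
    push_cast
    rw [add_smul, one_smul]
    abel
  rw [Finset.sum_congr rfl this, Finset.sum_range_sub']
  simp

lemma swap_eq {N : ℕ} (i j : Fin N) (hij : i ≠ j) (α : Fin N → ℤ) :
    (fun p => α (Equiv.swap i j p)) = α - (α i - α j) • root i j := by
  funext p
  by_cases h1 : p = i
  · subst h1
    simp [root, hij]
  · by_cases h2 : p = j
    · subst h2
      simp [root, h1]
    · simp [root, h1, h2, Equiv.swap_apply_of_ne_of_ne]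

/-- `divDiff i j f` is the quotient of `f - s_{ij} f` by `1 - e^{x_j - x_i}`. -/
lemma divDiff_spec {N : ℕ} (i j : Fin N) (hij : i ≠ j) (f : Laurent N) :
    (1 - expo (root j i)) * divDiff i j f = f - permAct (Equiv.swap i j) f := by
  have hroot : (root j i : Fin N → ℤ) = -root i j := by simp [root]
  have key : (LinearMap.mulLeft ℂ (1 - expo (root j i))).comp (divDiff i j)
      = LinearMap.id - permAct (Equiv.swap i j) := by
    apply linExt_induction
    intro α
    simp only [LinearMap.comp_apply, LinearMap.mulLeft_apply, LinearMap.sub_apply,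
      LinearMap.id_apply, divDiff, permAct, linExt_expo, Equiv.symm_swap, hroot]
    split_ifs with h
    · rw [geom_telescope, swap_eq i j hij, Int.toNat_of_nonneg (by lia)]
    · rw [mul_neg, geom_telescope, swap_eq i j hij, Int.toNat_of_nonneg (by lia), sub_sub,
        ← add_smul]
      simp
  exact LinearMap.congr_fun key f

/-- The trigonometric Dunkl operator
`∇_i = ∂_i + ∑_{j<i} c (1 - e^{x_i - x_j})⁻¹ (1 - s_{ij}) - ∑_{j>i} c (1 - e^{x_j - x_i})⁻¹
(1 - s_{ij}) - c i`, the indices running from `0` to `N - 1`. -/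
def trigDunkl {N : ℕ} (c : ℂ) (i : Fin N) : Laurent N →ₗ[ℂ] Laurent N :=
  pderiv i + (∑ j ∈ Finset.univ.filter (· < i), c • divDiff j i)
    - (∑ j ∈ Finset.univ.filter (i < ·), c • divDiff i j) - (c * (i : ℕ)) • LinearMap.id

/-- The non-commuting version `D_i = ∂_i - ∑_{j ≠ i} c (1 - e^{x_j - x_i})⁻¹ (1 - s_{ij})`. -/
def polyDunkl {N : ℕ} (c : ℂ) (i : Fin N) : Laurent N →ₗ[ℂ] Laurent N :=
  pderiv i - ∑ j ∈ Finset.univ.filter (· ≠ i), c • divDiff i j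

/-! ## The parabolic stratum and the module `M` -/

/-- The plane `x_1 = ⋯ = x_k, …, x_{(m-1)k+1} = ⋯ = x_{mk}` in `ℂ^N`. -/
def plane (N m k : ℕ) : Set (Fin N → ℂ) :=
  {x | ∀ i j : Fin N, (i : ℕ) < m * k → (j : ℕ) < m * k → (i : ℕ) / k = (j : ℕ) / k → x i = x j}

/-- The union of the images of the plane under `S_N`. -/
def stratum (N m k : ℕ) : Set (Fin N → ℂ) :=
  {x | ∃ w : Equiv.Perm (Fin N), (fun i => x (w i)) ∈ plane N m k}

/-- The Laurent polynomials that vanish on the stratum. -/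
def vanishing (N m k : ℕ) : Submodule ℂ (Laurent N) where
  carrier := {f | ∀ x ∈ stratum N m k, evalAt x f = 0}
  zero_mem' := fun x _ => map_zero _
  add_mem' := fun {f g} hf hg x hx => by rw [map_add, hf x hx, hg x hx, add_zero]
  smul_mem' := fun a f hf x hx => by rw [map_smul, hf x hx, smul_zero]

/-- The quotient `M` of the polynomial representation by the parabolic submodule. -/
abbrev QuotM (N m k : ℕ) : Type := Laurent N ⧸ vanishing N m k

lemma evalAt_permAct {N : ℕ} (w : Equiv.Perm (Fin N)) (x : Fin N → ℂ) (f : Laurent N) :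
    evalAt x (permAct w f) = evalAt (fun i => x (w i)) f := by
  have : (evalAt x).comp (permAct w) = evalAt (fun i => x (w i)) := by
    apply linExt_induction
    intro α
    simp only [LinearMap.comp_apply, permAct, evalAt, linExt_expo]
    congr 1
    rw [← Equiv.sum_comp w]
    simp
  exact LinearMap.congr_fun this f

lemma permAct_mem {N : ℕ} (m k : ℕ) (w : Equiv.Perm (Fin N)) :
    vanishing N m k ≤ (vanishing N m k).comap (permAct w) := by
  intro f hf x hx
  rw [evalAt_permAct]
  obtain ⟨v, hv⟩ := hx
  refine hf _ ⟨w⁻¹ * v, ?_⟩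
  simpa using hv

/-- The action of `S_N` on `M`. -/
def permM {N : ℕ} (m k : ℕ) (w : Equiv.Perm (Fin N)) : Module.End ℂ (QuotM N m k) :=
  (vanishing N m k).mapQ (vanishing N m k) (permAct w) (permAct_mem m k w)

/-- `Tbar` is the operator on `M` induced by the operator `T` on Laurent polynomials. -/
def IsInduced {N m k : ℕ} (T : Laurent N →ₗ[ℂ] Laurent N) (Tbar : Module.End ℂ (QuotM N m k)) :
    Prop :=
  ∀ f : Laurent N, Tbar (Submodule.Quotient.mk f) = Submodule.Quotient.mk (T f)

/-! ## The spin space and the diagonal invariants -/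

/-- `U = (ℂ^r)^{⊗ N}`. -/
abbrev Spin (N r : ℕ) : Type := ⨂[ℂ] _ : Fin N, (Fin r → ℂ)

/-- The matrix unit `E^{ab}` acting on the `i`-th tensor factor. -/
def matUnit {N r : ℕ} (i : Fin N) (a b : Fin r) : Module.End ℂ (Spin N r) :=
  PiTensorProduct.map (Function.update (fun _ => LinearMap.id) i
    (Matrix.toLin' (Matrix.single a b (1 : ℂ))))

/-- The permutation of tensor factors: `v_1 ⊗ ⋯ ⊗ v_N` goes to the tensor with `v_i` at place
`w i`. -/
def permU {N : ℕ} (r : ℕ) (w : Equiv.Perm (Fin N)) : Module.End ℂ (Spin N r) :=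
  (PiTensorProduct.reindex ℂ (fun _ : Fin N => (Fin r → ℂ)) w).toLinearMap

/-- `U ⊗ M`. -/
abbrev SpinM (N r m k : ℕ) : Type := Spin N r ⊗[ℂ] QuotM N m k

/-- The space `(U ⊗ M)^{S_N}` of invariants of the diagonal action. -/
def invariants (N r m k : ℕ) : Submodule ℂ (SpinM N r m k) :=
  ⨅ w : Equiv.Perm (Fin N),
    LinearMap.eqLocus (TensorProduct.map (permU r w) (permM m k w)) LinearMap.id

/-- The operator `p(T_1, …, T_N)` for a polynomial `p` and operators `T_i`, the factors of each
monomial being multiplied in the order of the indices (which is immaterial if the `T_i` commute). -/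
def polyAt {N : ℕ} {E : Type*} [AddCommGroup E] [Module ℂ E] (p : MvPolynomial (Fin N) ℂ)
    (T : Fin N → Module.End ℂ E) : Module.End ℂ E :=
  ∑ e ∈ p.support, p.coeff e • (List.ofFn fun i => T i ^ e i).prod

/-! ## The Yangian of `gl_r` -/

/-- The free generators: `(a, b, n)` stands for the coefficient `t^{ab}_{n+1}` of `u^{-(n+1)}`
in `t^{ab}(u)`, and the coefficient of `u^0` is `δ_{ab}`. -/
def freeT {r : ℕ} (a b : Fin r) : ℕ → FreeAlgebra ℂ (Fin r × Fin r × ℕ)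
  | 0 => if a = b then 1 else 0
  | n + 1 => FreeAlgebra.ι ℂ (a, b, n)

/-- The coefficients of `u^{-p} v^{-q}` in the matrix entries of the RTT relation
`R(u-v) t_1(u) t_2(v) = t_2(v) t_1(u) R(u-v)`, `R(u-v) = 1 - c (u-v)⁻¹ ∑ E^{ab} ⊗ E^{ba}`,
multiplied by `u - v`; that is, of
`(u - v) [t^{ab}(u), t^{de}(v)] = c (t^{db}(u) t^{ae}(v) - t^{db}(v) t^{ae}(u))`. -/
inductive RTT (r : ℕ) (c : ℂ) :
    FreeAlgebra ℂ (Fin r × Fin r × ℕ) → FreeAlgebra ℂ (Fin r × Fin r × ℕ) → Prop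
  | rel (a b d e : Fin r) (p q : ℕ) : RTT r c
      ((freeT a b (p + 1) * freeT d e q - freeT d e q * freeT a b (p + 1))
        - (freeT a b p * freeT d e (q + 1) - freeT d e (q + 1) * freeT a b p))
      (c • (freeT d b p * freeT a e q - freeT d b q * freeT a e p))

/-- The Yangian `Y(gl_r)` with parameter `c`. -/
abbrev Yangian (r : ℕ) (c : ℂ) : Type := RingQuot (RTT r c)

/-- The coefficient of `u^{-n}` in `t^{ab}(u)`. -/
def tcoef {r : ℕ} (c : ℂ) (a b : Fin r) (n : ℕ) : Yangian r c :=
  RingQuot.mkAlgHom ℂ (RTT r c) (freeT a b n)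

lemma tcoef_rel {r : ℕ} (c : ℂ) (a b d e : Fin r) (p q : ℕ) :
    (tcoef c a b (p + 1) * tcoef c d e q - tcoef c d e q * tcoef c a b (p + 1))
        - (tcoef c a b p * tcoef c d e (q + 1) - tcoef c d e (q + 1) * tcoef c a b p)
      = c • (tcoef c d b p * tcoef c a e q - tcoef c d b q * tcoef c a e p) := by
  have h := RingQuot.mkAlgHom_rel ℂ (RTT.rel (r := r) (c := c) a b d e p q)
  simpa only [tcoef, map_sub, map_mul, map_smul] using h

/-- The images of the free generators of `Y(gl_l)` in `Y(gl_r)`, `l ≤ r`. -/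
def preIncl {l r : ℕ} (c : ℂ) (h : l ≤ r) :
    FreeAlgebra ℂ (Fin l × Fin l × ℕ) →ₐ[ℂ] Yangian r c :=
  FreeAlgebra.lift ℂ fun x => tcoef c (Fin.castLE h x.1) (Fin.castLE h x.2.1) (x.2.2 + 1)

lemma preIncl_freeT {l r : ℕ} (c : ℂ) (h : l ≤ r) (a b : Fin l) (n : ℕ) :
    preIncl c h (freeT a b n) = tcoef c (Fin.castLE h a) (Fin.castLE h b) n := by
  cases n with
  | zero =>
    by_cases hab : a = b
    · simp [freeT, tcoef, hab]
    · simp [freeT, tcoef, hab]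
  | succ n => simp [freeT, preIncl]

/-- The homomorphism `Y(gl_l) → Y(gl_r)`, `t^{ab}(u) ↦ t^{ab}(u)`, for `l ≤ r`. -/
def incl {l r : ℕ} (c : ℂ) (h : l ≤ r) : Yangian l c →ₐ[ℂ] Yangian r c :=
  RingQuot.liftAlgHom ℂ ⟨preIncl c h, by
    rintro _ _ ⟨a, b, d, e, p, q⟩
    simpa only [map_sub, map_mul, map_smul, preIncl_freeT] using tcoef_rel c _ _ _ _ p q⟩

/-- `t^{ab}(u)` as a power series in `u⁻¹`. -/
def tSeries {r : ℕ} (c : ℂ) (a b : Fin r) : PowerSeries (Yangian r c) :=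
  PowerSeries.mk (tcoef c a b)

/-- For `f(u) = ∑ f_n u^{-n}`, the expansion of `f(u - s) = ∑ f_n (u - s)^{-n}` in powers of
`X = u⁻¹`; here `(u - s)⁻¹ = X (1 - s X)⁻¹`. -/
def shift {A : Type*} [Ring A] [Algebra ℂ A] (s : ℂ) (f : PowerSeries A) : PowerSeries A :=
  PowerSeries.mk fun l => ∑ n ∈ Finset.range (l + 1),
    PowerSeries.coeff l
      (((PowerSeries.X : PowerSeries ℂ) * (1 - PowerSeries.C s * PowerSeries.X)⁻¹) ^ n)
        • PowerSeries.coeff n f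

/-- The quantum determinant
`∑_σ sgn(σ) t^{1,σ(1)}(u - c(r-1)) t^{2,σ(2)}(u - c(r-2)) ⋯ t^{r,σ(r)}(u)` (indices from `1`). -/
def qdet (r : ℕ) (c : ℂ) : PowerSeries (Yangian r c) :=
  ∑ σ : Equiv.Perm (Fin r), (Equiv.Perm.sign σ : ℤ) •
    (List.ofFn fun a : Fin r =>
      shift (c * ((r : ℂ) - 1 - (a : ℕ))) (tSeries c a (σ a))).prod

/-- The Gelfand–Tsetlin subalgebra, generated by the centres of `Y(gl_1), …, Y(gl_r)`. -/
def gelfandTsetlin (r : ℕ) (c : ℂ) : Subalgebra ℂ (Yangian r c) :=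
  ⨆ l : Fin r, (Subalgebra.center ℂ (Yangian (l + 1) c)).map (incl c (Nat.succ_le_of_lt l.2))

/-- Commutative subalgebras. -/
def IsCommSub {A : Type*} [Semiring A] [Algebra ℂ A] (B : Subalgebra ℂ A) : Prop :=
  ∀ x ∈ B, ∀ y ∈ B, x * y = y * x

end SpinCM

end

noncomputable section
namespace SpinCM

/-! ## Dunkl operators on Laurent polynomials -/

section Laurent

variable {N : ℕ}

/-! The non-commuting operators D_i are replaced by commuting parameters. In End(U) ⊗ ℂ[y_1, …,
y_N], with the y_i central, the ordered product of the L-operators 1 + c E_i (u - y_i)⁻¹ satisfies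
the RTT relation, because each factor does and different sites commute (`exchangeRel_mono`).
Substituting the commuting operators ∇_i for the y_i gives an action of Y(gl_r) on all of U ⊗ M, in
which a symmetric polynomial in the y_i acts as p(∇). Now ∇_i = D_i - c Σ_{j<i} s_ij
(`trigDunkl_eq`), and on a diagonal invariant a permutation of variables can be traded for a
permutation of tensor factors. This turns the entries of the ordered product into δ_ab + Σ c
E_i^{ab} (u - D_i)⁻¹ (`coeff_mono_apply`, `map_quotTrig_pow`), which preserve the invariants since
the D_i are equivariant.

The quantum determinant is central by a fusion argument (`ncDet_commutator`, `qdetSeries_commute`),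
so its value in the spin chain can be read off on a highest vector: it is ∏ (1 + c (u - y_i)⁻¹). As
c ≠ 0, the coefficients of this product generate all symmetric polynomials (`esymm_mem_adjoin`).
Conversely, a central element of the Yangian commutes with the monodromy matrix, whose commutant is
ℂ[y] (`exists_eq_tmul_one_of_commute`), and the R-matrices exchanging neighbouring sites force the
resulting polynomial to be symmetric (`rename_swap_eq`). Hence the centre and the coefficients of
the quantum determinant have the same image, without any description of the centre itself. The H_p
preserve the invariants because they come from elements of the Yangian. The remaining claims are
formal: the Gelfand–Tsetlin subalgebra and every maximal commutative subalgebra are commutative and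
contain the centre.

The ∇_i commute because the rational Dunkl operators e^{-x_i} D_i do, the Jucys–Murphy corrections
cancelling what is left (`ratDunkl_comm`, `trigDunkl_comm_of_lt`). The ideal is preserved because on
a plane of the stratum D_i f reduces to (1 - c n) ∂_i f, n being the size of the block of i
(`evalAt_polyDunkl_eq_zero_of_generic`). -/

lemma one_eq_expo : (1 : Laurent N) = expo 0 := rfl

lemma laurent_induction {p : Laurent N → Prop} (f : Laurent N) (h0 : p 0)
    (hadd : ∀ f g, p f → p g → p (f + g)) (hsmul : ∀ (a : ℂ) α, p (a • expo α)) : p f := by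
  induction f using AddMonoidAlgebra.induction_linear with
  | zero => exact h0
  | add f g hf hg => exact hadd f g hf hg
  | single α a =>
    have := hsmul a α
    rwa [expo, AddMonoidAlgebra.smul_single', mul_one] at this

lemma permAct_expo (w : Equiv.Perm (Fin N)) (α : Fin N → ℤ) :
    permAct w (expo α) = expo fun i => α (w.symm i) := linExt_expo _ _

lemma pderiv_expo (i : Fin N) (α : Fin N → ℤ) :
    pderiv i (expo α) = (α i : ℂ) • expo α := linExt_expo _ _

lemma permAct_mul_apply (w : Equiv.Perm (Fin N)) (f g : Laurent N) :
    permAct w (f * g) = permAct w f * permAct w g := by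
  induction f using laurent_induction with
  | h0 => simp
  | hadd f₁ f₂ h₁ h₂ => simp only [add_mul, map_add, h₁, h₂]
  | hsmul a α =>
    induction g using laurent_induction with
    | h0 => simp
    | hadd f₁ f₂ h₁ h₂ => simp only [mul_add, map_add, h₁, h₂]
    | hsmul b β =>
      simp only [smul_mul_assoc, mul_smul_comm, map_smul, expo_mul, permAct_expo]
      rfl

lemma pderiv_mul (i : Fin N) (f g : Laurent N) :
    pderiv i (f * g) = pderiv i f * g + f * pderiv i g := by
  induction f using laurent_induction with
  | h0 => simp
  | hadd f₁ f₂ h₁ h₂ => simp only [add_mul, map_add, h₁, h₂]; abel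
  | hsmul a α =>
    induction g using laurent_induction with
    | h0 => simp
    | hadd f₁ f₂ h₁ h₂ => simp only [mul_add, map_add, h₁, h₂]; abel
    | hsmul b β =>
      simp only [smul_mul_assoc, mul_smul_comm, map_smul, expo_mul, pderiv_expo,
        Pi.add_apply, Int.cast_add]
      module

lemma permAct_one : permAct (1 : Equiv.Perm (Fin N)) = 1 := by
  apply linExt_induction
  intro α
  rw [permAct_expo]
  rfl

lemma permAct_mul (v w : Equiv.Perm (Fin N)) : permAct (v * w) = permAct v * permAct w := by
  apply linExt_induction
  intro α
  simp only [permAct_expo, Module.End.mul_apply]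
  rfl

lemma permAct_map_one (w : Equiv.Perm (Fin N)) : permAct w (1 : Laurent N) = 1 := by
  rw [one_eq_expo, permAct_expo]; rfl

lemma permAct_expo_root (w : Equiv.Perm (Fin N)) (i j : Fin N) :
    permAct w (expo (root i j)) = expo (root (w i) (w j)) := by
  rw [permAct_expo]
  congr 1
  funext p
  simp only [root, Pi.sub_apply, Pi.single_apply, Equiv.symm_apply_eq]

lemma permAct_expo_single (w : Equiv.Perm (Fin N)) (i : Fin N) (n : ℤ) :
    permAct w (expo (Pi.single i n)) = expo (Pi.single (w i) n) := by
  rw [permAct_expo]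
  congr 1
  funext p
  simp only [Pi.single_apply, Equiv.symm_apply_eq]

lemma expo_injective : Function.Injective (expo : (Fin N → ℤ) → Laurent N) := by
  intro α β h
  exact Finsupp.single_left_injective (one_ne_zero (α := ℂ))
    (congrArg (AddMonoidAlgebra.coeffLinearEquiv ℂ) h)

lemma one_sub_expo_root_ne_zero {i j : Fin N} (h : i ≠ j) :
    (1 : Laurent N) - expo (root i j) ≠ 0 := by
  rw [sub_ne_zero, one_eq_expo]
  intro h'
  have := congrFun (expo_injective h') i
  simp [root, h] at this

/-- Laurent polynomials form a domain, so the quotient is unique: algebraic identities for `divDiff`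
can be checked after multiplication by 1 - e^{x_j - x_i}. -/
lemma eq_divDiff {i j : Fin N} (hij : i ≠ j) {f g : Laurent N}
    (h : (1 - expo (root j i)) * g = f - permAct (Equiv.swap i j) f) : g = divDiff i j f :=
  mul_left_cancel₀ (one_sub_expo_root_ne_zero hij.symm) (h.trans (divDiff_spec i j hij f).symm)

lemma permAct_pderiv (w : Equiv.Perm (Fin N)) (i : Fin N) :
    permAct w * pderiv i = pderiv (w i) * permAct w := by
  apply linExt_induction
  intro α
  simp [Module.End.mul_apply, pderiv_expo, permAct_expo]

lemma permAct_divDiff (w : Equiv.Perm (Fin N)) {i j : Fin N} (hij : i ≠ j) :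
    permAct w * divDiff i j = divDiff (w i) (w j) * permAct w := by
  refine LinearMap.ext fun f => ?_
  simp only [Module.End.mul_apply]
  apply eq_divDiff (w.injective.ne hij)
  rw [← permAct_expo_root, ← permAct_map_one w, ← map_sub, ← permAct_mul_apply,
    divDiff_spec i j hij, map_sub, Equiv.swap_apply_apply]
  congr 1
  simp only [← Module.End.mul_apply, ← permAct_mul]
  congr 2
  group

/-- With z = e^{x_j - x_i} this is 1/(1 - z) + 1/(1 - z⁻¹) = 1. It measures the difference between
the triangular Dunkl operator and the equivariant one. -/
lemma divDiff_add_divDiff {i j : Fin N} (hij : i ≠ j) :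
    divDiff i j + divDiff j i = 1 - permAct (Equiv.swap i j) := by
  refine LinearMap.ext fun f => ?_
  apply mul_left_cancel₀ (one_sub_expo_root_ne_zero hij.symm)
  have h1 := divDiff_spec i j hij f
  have h2 := divDiff_spec j i hij.symm f
  have h3 : (1 - expo (root j i) : Laurent N) = -expo (root j i) * (1 - expo (root i j)) := by
    rw [neg_mul, mul_sub, expo_mul, mul_one, one_eq_expo]
    simp [root]
  rw [LinearMap.add_apply, mul_add, h1, h3, mul_assoc, h2, Equiv.swap_comm j i,
    LinearMap.sub_apply, Module.End.one_apply]
  have h4 : (expo (root j i) * expo (root i j) : Laurent N) = 1 := by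
    rw [expo_mul, one_eq_expo]
    simp [root]
  linear_combination (-f + permAct (Equiv.swap i j) f) * h4

lemma divDiff_mul {i j : Fin N} (hij : i ≠ j) (f g : Laurent N) :
    divDiff i j (f * g) = f * divDiff i j g + divDiff i j f * permAct (Equiv.swap i j) g := by
  symm
  apply eq_divDiff hij
  rw [permAct_mul_apply]
  linear_combination f * divDiff_spec i j hij g +
    permAct (Equiv.swap i j) g * divDiff_spec i j hij f

/-- The exponential `e^{x_k}`. -/
def coord (k : Fin N) : Laurent N := expo (Pi.single k 1)

lemma permAct_coord (w : Equiv.Perm (Fin N)) (k : Fin N) :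
    permAct w (coord k) = coord (w k) := permAct_expo_single w k 1

lemma pderiv_coord (i k : Fin N) :
    pderiv i (coord k) = if i = k then coord k else 0 := by
  rw [coord, pderiv_expo]
  split_ifs with h
  · simp [h]
  · simp [h]

lemma divDiff_coord {i j : Fin N} (hij : i ≠ j) (k : Fin N) :
    divDiff i j (coord k) = if k = i then coord i else if k = j then -coord i else 0 := by
  symm
  apply eq_divDiff hij
  have h : (expo (root j i) * coord i : Laurent N) = coord j := by
    rw [coord, coord, expo_mul]
    simp [root]
  rw [permAct_coord]
  split_ifs with h1 h2
  · subst h1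
    rw [Equiv.swap_apply_left]
    linear_combination -h
  · subst h2
    rw [Equiv.swap_apply_right]
    linear_combination h
  · rw [Equiv.swap_apply_of_ne_of_ne h1 h2]
    simp

/-- The sum in D_i runs over all j ≠ i without reference to the order of the indices, whence the
equivariance. -/
lemma permAct_polyDunkl (c : ℂ) (w : Equiv.Perm (Fin N)) (i : Fin N) :
    permAct w * polyDunkl c i = polyDunkl c (w i) * permAct w := by
  rw [polyDunkl, polyDunkl, mul_sub, sub_mul, permAct_pderiv, Finset.mul_sum, Finset.sum_mul]
  congr 1
  refine Finset.sum_equiv w (by simp) ?_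
  intro j hj
  have hj : j ≠ i := by simpa using hj
  rw [mul_smul_comm, permAct_divDiff w hj.symm, smul_mul_assoc]

/-- For each j < i the two operators differ by c (`divDiff i j` + `divDiff j i`) = c (1 - s_ij).
Indices start at 0, so there are i such j, and the units cancel the constant -c i. -/
lemma trigDunkl_eq (c : ℂ) (i : Fin N) :
    trigDunkl c i = polyDunkl c i -
      c • ∑ j ∈ Finset.univ.filter (· < i), permAct (Equiv.swap i j) := by
  have h1 : Finset.univ.filter (fun j : Fin N => j ≠ i) =
      Finset.univ.filter (· < i) ∪ Finset.univ.filter (i < ·) := by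
    ext j; simp [lt_or_lt_iff_ne]
  have h2 : Disjoint (Finset.univ.filter (· < i)) (Finset.univ.filter (fun j : Fin N => i < j)) := by
    rw [Finset.disjoint_filter]
    intro j _ h h'
    exact lt_asymm h h'
  have h3 : ∀ j ∈ Finset.univ.filter (· < i), permAct (Equiv.swap i j) =
      1 - (divDiff i j + divDiff j i) := by
    intro j hj
    have : i ≠ j := by rintro rfl; simp at hj
    rw [divDiff_add_divDiff this]; abel
  have h4 : (Finset.univ.filter (· < i)).card = (i : ℕ) := by
    rw [Finset.filter_gt_eq_Iio]; simp
  rw [Finset.sum_congr rfl h3, trigDunkl, polyDunkl, h1, Finset.sum_union h2,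
    Finset.sum_sub_distrib, Finset.sum_add_distrib, Finset.sum_const, h4]
  simp only [smul_sub, smul_add, Finset.smul_sum, mul_smul, Nat.cast_smul_eq_nsmul]
  change _ - c • (i : ℕ) • (1 : Module.End ℂ (Laurent N)) = _
  abel

/-- In the twisted Leibniz rule only the term j = k contributes. This and `polyDunkl_coord_mul_self`
are the cross relations from which the commutators of the Dunkl operators are deduced. -/
lemma polyDunkl_coord_mul (c : ℂ) {i k : Fin N} (hik : i ≠ k) (f : Laurent N) :
    polyDunkl c i (coord k * f) =
      coord k * polyDunkl c i f + c • (coord i * permAct (Equiv.swap i k) f) := by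
  simp only [polyDunkl, LinearMap.sub_apply, LinearMap.sum_apply, LinearMap.smul_apply,
    pderiv_mul, pderiv_coord, hik, if_false, zero_mul, zero_add, mul_sub, Finset.mul_sum]
  have : ∀ j ∈ Finset.univ.filter (· ≠ i), c • divDiff i j (coord k * f) =
      coord k * c • divDiff i j f -
        if j = k then c • (coord i * permAct (Equiv.swap i k) f) else 0 := by
    intro j hj
    have hj : j ≠ i := by simpa using hj
    rw [divDiff_mul hj.symm, divDiff_coord hj.symm, if_neg hik.symm]
    rcases eq_or_ne k j with rfl | h
    · simp [smul_add, sub_eq_add_neg]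
    · simp [h, h.symm]
  rw [Finset.sum_congr rfl this, Finset.sum_sub_distrib, Finset.sum_ite_eq', if_pos (by simpa using hik.symm)]
  abel

lemma polyDunkl_coord_mul_self (c : ℂ) (i : Fin N) (f : Laurent N) :
    polyDunkl c i (coord i * f) =
      coord i * polyDunkl c i f + coord i * f -
        c • ∑ j ∈ Finset.univ.filter (· ≠ i), coord i * permAct (Equiv.swap i j) f := by
  simp only [polyDunkl, LinearMap.sub_apply, LinearMap.sum_apply, LinearMap.smul_apply,
    pderiv_mul, pderiv_coord, if_true, mul_sub, Finset.mul_sum, Finset.smul_sum]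
  have : ∀ j ∈ Finset.univ.filter (· ≠ i), c • divDiff i j (coord i * f) =
      coord i * c • divDiff i j f + c • (coord i * permAct (Equiv.swap i j) f) := by
    intro j hj
    have hj : j ≠ i := by simpa using hj
    rw [divDiff_mul hj.symm, divDiff_coord hj.symm, if_pos rfl, smul_add, mul_smul_comm]
  rw [Finset.sum_congr rfl this, Finset.sum_add_distrib]
  abel

end Laurent


/-! ### Commutation relations of the Dunkl operators. -/

section Commutators

variable {N : ℕ}

/-- Multiplication by `e^{x_k}`. -/
def coordMul (k : Fin N) : Module.End ℂ (Laurent N) := LinearMap.mulLeft ℂ (coord k)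

/-- The rational Dunkl operator in the variables `e^{x_k}`. -/
def ratDunkl (c : ℂ) (i : Fin N) : Module.End ℂ (Laurent N) :=
  LinearMap.mulLeft ℂ (expo (Pi.single i (-1))) * polyDunkl c i

lemma expo_neg_mul_coord (i : Fin N) : expo (Pi.single i (-1)) * coord i = 1 := by
  rw [coord, expo_mul, one_eq_expo, ← Pi.single_add]
  simp

lemma coordMul_mul_ratDunkl (c : ℂ) (i : Fin N) :
    coordMul i * ratDunkl c i = polyDunkl c i := by
  refine LinearMap.ext fun f => ?_
  simp only [coordMul, ratDunkl, Module.End.mul_apply, LinearMap.mulLeft_apply]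
  rw [← mul_assoc, mul_comm (coord i), expo_neg_mul_coord, one_mul]

lemma permAct_mul_ratDunkl (c : ℂ) (w : Equiv.Perm (Fin N)) (i : Fin N) :
    permAct w * ratDunkl c i = ratDunkl c (w i) * permAct w := by
  refine LinearMap.ext fun f => ?_
  have h := LinearMap.congr_fun (permAct_polyDunkl c w i) f
  simp only [Module.End.mul_apply] at h
  simp only [ratDunkl, Module.End.mul_apply, LinearMap.mulLeft_apply, permAct_mul_apply,
    permAct_expo_single, h]

lemma swap_mul_ratDunkl (c : ℂ) {i j k : Fin N} (h1 : k ≠ i) (h2 : k ≠ j) :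
    permAct (Equiv.swap i j) * ratDunkl c k = ratDunkl c k * permAct (Equiv.swap i j) := by
  rw [permAct_mul_ratDunkl, Equiv.swap_apply_of_ne_of_ne h1 h2]

lemma ratDunkl_mul_coordMul (c : ℂ) {i k : Fin N} (hik : i ≠ k) :
    ratDunkl c i * coordMul k =
      coordMul k * ratDunkl c i + c • permAct (Equiv.swap i k) := by
  refine LinearMap.ext fun f => ?_
  simp only [coordMul, ratDunkl, Module.End.mul_apply, LinearMap.mulLeft_apply,
    LinearMap.add_apply, LinearMap.smul_apply, polyDunkl_coord_mul c hik, mul_add, mul_smul_comm]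
  rw [← mul_assoc _ (coord i), expo_neg_mul_coord, one_mul, mul_left_comm]

lemma ratDunkl_mul_coordMul_self (c : ℂ) (i : Fin N) :
    ratDunkl c i * coordMul i = coordMul i * ratDunkl c i + 1 -
      c • ∑ j ∈ Finset.univ.filter (· ≠ i), permAct (Equiv.swap i j) := by
  refine LinearMap.ext fun f => ?_
  simp only [coordMul, ratDunkl, Module.End.mul_apply, LinearMap.mulLeft_apply,
    LinearMap.add_apply, LinearMap.sub_apply, LinearMap.smul_apply, LinearMap.sum_apply,
    polyDunkl_coord_mul_self, ← Finset.mul_sum]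
  rw [mul_sub, mul_add, mul_smul_comm, ← mul_assoc _ (coord i) f, ← mul_assoc _ (coord i) (∑ _ ∈ _, _),
    expo_neg_mul_coord, one_mul, one_mul, mul_left_comm, Module.End.one_apply]

lemma polyDunkl_one (c : ℂ) (i : Fin N) : polyDunkl c i 1 = 0 := by
  have h : ∀ j ∈ Finset.univ.filter (· ≠ i), c • divDiff i j (1 : Laurent N) = 0 := by
    intro j hj
    have hj : j ≠ i := by simpa using hj
    rw [← eq_divDiff hj.symm (f := 1) (g := 0) (by simp [permAct_map_one]), smul_zero]
  simp only [polyDunkl, LinearMap.sub_apply, LinearMap.sum_apply, LinearMap.smul_apply]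
  rw [Finset.sum_eq_zero h, one_eq_expo, pderiv_expo]
  simp

/-- The exponents α such that C commutes with multiplication by e^α form a subgroup, hence all of
ℤ^N; so C is determined by its value at 1. -/
lemma eq_zero_of_commute_coordMul {C : Module.End ℂ (Laurent N)}
    (h : ∀ k, C * coordMul k = coordMul k * C) (h1 : C 1 = 0) : C = 0 := by
  let S : AddSubgroup (Fin N → ℤ) :=
    { carrier := {α | ∀ f, C (expo α * f) = expo α * C f}
      zero_mem' := fun f => by rw [← one_eq_expo, one_mul, one_mul]
      add_mem' := fun {α β} hα hβ f => by
        rw [← expo_mul, mul_assoc, hα, hβ, mul_assoc]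
      neg_mem' := fun {α} hα f => by
        have e : expo (-α) * expo α = 1 := by rw [expo_mul, neg_add_cancel, one_eq_expo]
        have := hα (expo (-α) * f)
        rw [← mul_assoc, mul_comm (expo α), e, one_mul] at this
        rw [this, ← mul_assoc, e, one_mul] }
  have hS : ∀ α, α ∈ S := by
    intro α
    rw [← Finset.univ_sum_single α]
    refine sum_mem fun k _ => ?_
    have : Pi.single k (α k) = α k • (Pi.single k 1 : Fin N → ℤ) := by
      rw [← Pi.single_smul, smul_eq_mul, mul_one]
    rw [this]
    have hk : Pi.single k 1 ∈ S := fun f => LinearMap.congr_fun (h k) f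
    exact zsmul_mem hk _
  apply linExt_induction
  intro α
  have := hS α 1
  rwa [mul_one, h1, mul_zero] at this

lemma ratDunkl_comm_aux (c : ℂ) {i j : Fin N} (hij : i ≠ j) :
    (ratDunkl c i * ratDunkl c j - ratDunkl c j * ratDunkl c i) * coordMul i =
      coordMul i * (ratDunkl c i * ratDunkl c j - ratDunkl c j * ratDunkl c i) := by
  -- Only l = j survives: the other transpositions fix j and commute with the operator of index j.
  have hsum : (∑ l ∈ Finset.univ.filter (· ≠ i), permAct (Equiv.swap i l)) * ratDunkl c j -
      ratDunkl c j * (∑ l ∈ Finset.univ.filter (· ≠ i), permAct (Equiv.swap i l)) =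
      ratDunkl c i * permAct (Equiv.swap i j) - ratDunkl c j * permAct (Equiv.swap i j) := by
    rw [Finset.sum_mul, Finset.mul_sum, ← Finset.sum_sub_distrib,
      Finset.sum_eq_single_of_mem j (by simpa using hij.symm)]
    · rw [permAct_mul_ratDunkl, Equiv.swap_apply_right]
    · intro l _ hl
      rw [swap_mul_ratDunkl c hij.symm hl.symm, sub_self]
  have hs : permAct (Equiv.swap i j) * ratDunkl c i = ratDunkl c j * permAct (Equiv.swap i j) := by
    rw [permAct_mul_ratDunkl, Equiv.swap_apply_left]
  have hj := ratDunkl_mul_coordMul c hij.symm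
  have hi := ratDunkl_mul_coordMul_self c i
  rw [Equiv.swap_comm] at hj
  have e1 : ratDunkl c i * ratDunkl c j * coordMul i =
      coordMul i * ratDunkl c i * ratDunkl c j + ratDunkl c j -
        c • ((∑ l ∈ Finset.univ.filter (· ≠ i), permAct (Equiv.swap i l)) * ratDunkl c j) +
        c • (ratDunkl c i * permAct (Equiv.swap i j)) := by
    rw [mul_assoc, hj, mul_add, ← mul_assoc, hi, sub_mul, add_mul, one_mul, smul_mul_assoc,
      mul_smul_comm]
  have e2 : ratDunkl c j * ratDunkl c i * coordMul i =
      coordMul i * ratDunkl c j * ratDunkl c i + ratDunkl c j -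
        c • (ratDunkl c j * ∑ l ∈ Finset.univ.filter (· ≠ i), permAct (Equiv.swap i l)) +
        c • (ratDunkl c j * permAct (Equiv.swap i j)) := by
    rw [mul_assoc, hi, mul_sub, mul_add, ← mul_assoc, hj, add_mul, mul_one, smul_mul_assoc,
      mul_smul_comm, hs]
    abel
  rw [sub_mul, e1, e2, mul_sub, ← mul_assoc, ← mul_assoc]
  have := congrArg (c • ·) hsum
  simp only [smul_sub] at this
  rw [sub_eq_sub_iff_add_eq_add] at this ⊢
  rw [← sub_eq_zero] at this ⊢
  rw [← neg_eq_zero] at this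
  rw [← this]
  abel

/-- Dunkl's argument: by the cross relations the commutator commutes with every multiplication by
e^{x_k}, and it annihilates 1. -/
lemma ratDunkl_comm (c : ℂ) (i j : Fin N) :
    ratDunkl c i * ratDunkl c j = ratDunkl c j * ratDunkl c i := by
  rcases eq_or_ne i j with rfl | hij
  · rfl
  rw [← sub_eq_zero]
  apply eq_zero_of_commute_coordMul
  · intro k
    rcases eq_or_ne k i with rfl | hki
    · exact ratDunkl_comm_aux c hij
    rcases eq_or_ne k j with rfl | hkj
    · have := ratDunkl_comm_aux c hij.symm
      rw [sub_mul, mul_sub] at this ⊢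
      rw [← neg_sub, this, neg_sub]
    have e : ∀ {i j : Fin N}, k ≠ i → k ≠ j → i ≠ j → ratDunkl c i * ratDunkl c j * coordMul k =
        coordMul k * (ratDunkl c i * ratDunkl c j) +
          c • (ratDunkl c j * permAct (Equiv.swap i k)) +
          c • (ratDunkl c i * permAct (Equiv.swap j k)) := by
      intro i j hki hkj hij
      rw [mul_assoc, ratDunkl_mul_coordMul c hkj.symm, mul_add, ← mul_assoc,
        ratDunkl_mul_coordMul c hki.symm, add_mul, smul_mul_assoc,
        swap_mul_ratDunkl c hij.symm hkj.symm, mul_smul_comm, mul_assoc]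
    rw [sub_mul, e hki hkj hij, e hkj hki hij.symm, mul_sub]
    abel
  · simp [ratDunkl, polyDunkl_one]

/-- Write D_i = z_i y_i with z_i = e^{x_i} and y_i the commuting rational operators. Moving y_i past
z_j gives D_i D_j = z_i z_j y_i y_j + c D_i s_ij, whose first term is symmetric in i and j. -/
lemma polyDunkl_commutator (c : ℂ) {i j : Fin N} (hij : i ≠ j) :
    polyDunkl c i * polyDunkl c j - polyDunkl c j * polyDunkl c i =
      c • ((polyDunkl c i - polyDunkl c j) * permAct (Equiv.swap i j)) := by
  have e : ∀ {i j : Fin N}, i ≠ j → polyDunkl c i * polyDunkl c j =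
      coordMul i * coordMul j * (ratDunkl c i * ratDunkl c j) +
        c • (polyDunkl c i * permAct (Equiv.swap i j)) := by
    intro i j hij
    rw [← coordMul_mul_ratDunkl c i, ← coordMul_mul_ratDunkl c j, mul_assoc (coordMul i),
      ← mul_assoc (ratDunkl c i), ratDunkl_mul_coordMul c hij, add_mul, smul_mul_assoc,
      permAct_mul_ratDunkl, Equiv.swap_apply_right, mul_add, mul_smul_comm]
    simp only [mul_assoc]
  have hz : coordMul i * coordMul j = coordMul j * coordMul i :=
    LinearMap.ext fun f => mul_left_comm (coord i) (coord j) f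
  rw [e hij, e hij.symm, ratDunkl_comm c i j, hz, Equiv.swap_comm j i, sub_mul, smul_sub]
  abel

/-- The Jucys–Murphy elements. -/
def jucysMurphy (i : Fin N) : Module.End ℂ (Laurent N) :=
  ∑ j ∈ Finset.univ.filter (· < i), permAct (Equiv.swap i j)

lemma permAct_jucysMurphy {i : Fin N} (w : Equiv.Perm (Fin N)) (hw : ∀ k, w k < i ↔ k < i)
    (hi : w i = i) : permAct w * jucysMurphy i = jucysMurphy i * permAct w := by
  rw [jucysMurphy, Finset.mul_sum, Finset.sum_mul]
  refine Finset.sum_equiv w (by simp [hw]) fun j _ => ?_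
  rw [← permAct_mul, ← permAct_mul]
  congr 1
  conv_rhs => rw [← hi, Equiv.swap_apply_apply, inv_mul_cancel_right]

lemma swap_jucysMurphy {i j k : Fin N} (hi : i < k) (hj : j < k) :
    permAct (Equiv.swap i j) * jucysMurphy k = jucysMurphy k * permAct (Equiv.swap i j) := by
  apply permAct_jucysMurphy
  · intro l
    rw [Equiv.swap_apply_def]
    split_ifs with h1 h2
    · subst h1; exact iff_of_true hj hi
    · subst h2; exact iff_of_true hi hj
    · rfl
  · exact Equiv.swap_apply_of_ne_of_ne hi.ne' hj.ne'

lemma trigDunkl_eq_sub (c : ℂ) (i : Fin N) :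
    trigDunkl c i = polyDunkl c i - c • jucysMurphy i := trigDunkl_eq c i

/-- As i < j, the Jucys–Murphy element of i commutes with that of j and with D_j, while its partner
satisfies [D_i, J_j] = (D_i - D_j) s_ij. By `polyDunkl_commutator` the latter times c is [D_i, D_j],
so the correction cancels the defect exactly. -/
lemma trigDunkl_comm_of_lt (c : ℂ) {i j : Fin N} (hij : i < j) :
    trigDunkl c i * trigDunkl c j = trigDunkl c j * trigDunkl c i := by
  have h1 : jucysMurphy i * jucysMurphy j = jucysMurphy j * jucysMurphy i := by
    conv_lhs => rw [jucysMurphy, Finset.sum_mul]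
    conv_rhs => enter [2]; rw [jucysMurphy]
    rw [Finset.mul_sum]
    refine Finset.sum_congr rfl fun k hk => ?_
    have hk : k < i := by simpa using hk
    exact swap_jucysMurphy hij (hk.trans hij)
  have h2 : jucysMurphy i * polyDunkl c j = polyDunkl c j * jucysMurphy i := by
    rw [jucysMurphy, Finset.mul_sum, Finset.sum_mul]
    refine Finset.sum_congr rfl fun k hk => ?_
    have hk : k < i := by simpa using hk
    rw [permAct_polyDunkl, Equiv.swap_apply_of_ne_of_ne hij.ne' (hk.trans hij).ne']
  have h3 : polyDunkl c i * jucysMurphy j - jucysMurphy j * polyDunkl c i =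
      (polyDunkl c i - polyDunkl c j) * permAct (Equiv.swap i j) := by
    rw [jucysMurphy, Finset.mul_sum, Finset.sum_mul, ← Finset.sum_sub_distrib,
      Finset.sum_eq_single_of_mem i (by simpa using hij)]
    · rw [permAct_polyDunkl, Equiv.swap_apply_right, Equiv.swap_comm, sub_mul]
    · intro l _ hl
      rw [permAct_polyDunkl, Equiv.swap_apply_of_ne_of_ne hij.ne hl.symm, sub_self]
  have h4 := polyDunkl_commutator c hij.ne
  rw [← h3] at h4
  rw [← sub_eq_zero, trigDunkl_eq_sub, trigDunkl_eq_sub]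
  simp only [sub_mul, mul_sub, smul_mul_assoc, mul_smul_comm, h1, h2, smul_sub] at h4 ⊢
  rw [← sub_eq_zero.mpr h4]
  abel

lemma trigDunkl_commute (c : ℂ) (i j : Fin N) : Commute (trigDunkl c i) (trigDunkl c j) := by
  rcases lt_trichotomy i j with h | rfl | h
  · exact trigDunkl_comm_of_lt c h
  · exact Commute.refl _
  · exact (trigDunkl_comm_of_lt c h).symm

end Commutators


/-! ### Invariance of the ideal of the stratum. -/

section Vanishing

variable {N : ℕ}

lemma evalAt_expo (x : Fin N → ℂ) (α : Fin N → ℤ) :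
    evalAt x (expo α) = Complex.exp (∑ i, (α i : ℂ) * x i) := linExt_expo _ _

lemma evalAt_mul (x : Fin N → ℂ) (f g : Laurent N) :
    evalAt x (f * g) = evalAt x f * evalAt x g := by
  induction f using laurent_induction with
  | h0 => simp
  | hadd f₁ f₂ h₁ h₂ => simp only [add_mul, map_add, h₁, h₂]
  | hsmul a α =>
    induction g using laurent_induction with
    | h0 => simp
    | hadd f₁ f₂ h₁ h₂ => simp only [mul_add, map_add, h₁, h₂]
    | hsmul b β =>
      simp only [smul_mul_assoc, mul_smul_comm, map_smul, expo_mul, evalAt_expo, ← Complex.exp_add,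
        ← Finset.sum_add_distrib, Pi.add_apply, Int.cast_add, add_mul]

lemma evalAt_one_sub_expo_root (x : Fin N → ℂ) (i j : Fin N) :
    evalAt x (1 - expo (root i j)) = 1 - Complex.exp (x i - x j) := by
  rw [map_sub, one_eq_expo, evalAt_expo, evalAt_expo]
  simp [root, sub_mul, Pi.single_apply]

/-- Where x_i = x_j, shifting an exponent by a multiple of the root does not change its value. All
terms of the geometric sum are then equal, and their signed number α_i - α_j is the difference of
the two derivatives. -/
lemma evalAt_divDiff_of_eq {x : Fin N → ℂ} {i j : Fin N} (h : x i = x j) (f : Laurent N) :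
    evalAt x (divDiff i j f) = evalAt x (pderiv i f) - evalAt x (pderiv j f) := by
  have hr : ∀ (α : Fin N → ℤ) (l : ℤ), evalAt x (expo (α - l • root i j)) = evalAt x (expo α) := by
    intro α l
    rw [evalAt_expo, evalAt_expo]
    congr 1
    have : ∑ p, ((root i j p : ℤ) : ℂ) * x p = 0 := by
      simp [root, sub_mul, Pi.single_apply, h]
    simp only [Pi.sub_apply, Pi.smul_apply, smul_eq_mul, Int.cast_sub, Int.cast_mul, sub_mul,
      Finset.sum_sub_distrib, mul_assoc, ← Finset.mul_sum, this, mul_zero, sub_zero]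
  have hs : ∀ α : Fin N → ℤ, evalAt x (expo fun p => α (Equiv.swap i j p)) = evalAt x (expo α) := by
    intro α
    rcases eq_or_ne i j with rfl | hij
    · simp
    · rw [swap_eq i j hij, hr]
  have : (evalAt x).comp (divDiff i j) = (evalAt x).comp (pderiv i) - (evalAt x).comp (pderiv j) := by
    apply linExt_induction
    intro α
    simp only [LinearMap.comp_apply, LinearMap.sub_apply, pderiv_expo, divDiff, linExt_expo,
      map_smul, smul_eq_mul, ← sub_mul]
    split_ifs with hα
    · rw [map_sum, Finset.sum_congr rfl fun l _ => hr α (l : ℕ), Finset.sum_const, Finset.card_range,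
        nsmul_eq_mul, ← Int.cast_natCast, Int.toNat_of_nonneg (by lia), Int.cast_sub]
    · rw [map_neg, map_sum, Finset.sum_congr rfl fun l _ => (hr _ (l : ℕ)).trans (hs α), Finset.sum_const,
        Finset.card_range, nsmul_eq_mul, ← Int.cast_natCast, Int.toNat_of_nonneg (by lia),
        Int.cast_sub]
      ring
  exact LinearMap.congr_fun this f

lemma evalAt_divDiff_eq_zero {x : Fin N → ℂ} {i j : Fin N}
    (h : Complex.exp (x j - x i) ≠ 1) {f : Laurent N} (hf : evalAt x f = 0)
    (hf' : evalAt x (permAct (Equiv.swap i j) f) = 0) : evalAt x (divDiff i j f) = 0 := by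
  have hij : i ≠ j := by rintro rfl; simp at h
  have := congrArg (evalAt x) (divDiff_spec i j hij f)
  rw [evalAt_mul, evalAt_one_sub_expo_root, map_sub, hf, hf', sub_zero] at this
  exact (mul_eq_zero.mp this).resolve_left (sub_ne_zero.mpr h.symm)

lemma hasDerivAt_evalAt (x v : Fin N → ℂ) (f : Laurent N) :
    HasDerivAt (fun t : ℂ => evalAt (x + t • v) f) (∑ j, v j * evalAt x (pderiv j f)) 0 := by
  induction f using laurent_induction with
  | h0 => simpa using hasDerivAt_const (0 : ℂ) (0 : ℂ)
  | hadd f g hf hg =>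
    simp only [map_add, mul_add, Finset.sum_add_distrib]
    exact hf.add hg
  | hsmul a α =>
    have h1 : HasDerivAt (fun t : ℂ => ∑ i, (α i : ℂ) * (x + t • v) i)
        (∑ i, (α i : ℂ) * v i) 0 := by
      refine HasDerivAt.fun_sum fun i _ => ?_
      simpa using (((hasDerivAt_id (0 : ℂ)).mul_const (v i)).const_add (x i)).const_mul (α i : ℂ)
    have h2 := (h1.cexp).const_mul a
    simp only [zero_smul, add_zero] at h2
    simp only [map_smul, smul_eq_mul, evalAt_expo, pderiv_expo]
    refine h2.congr_deriv ?_
    rw [Finset.mul_sum, Finset.mul_sum]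
    refine Finset.sum_congr rfl fun i _ => ?_
    ring

lemma continuous_evalAt (x v : Fin N → ℂ) (f : Laurent N) :
    Continuous fun t : ℝ => evalAt (x + (t : ℂ) • v) f := by
  induction f using laurent_induction with
  | h0 => simpa using continuous_const
  | hadd f g hf hg =>
    simp only [map_add]
    exact hf.add hg
  | hsmul a α =>
    simp only [map_smul, evalAt_expo, Pi.add_apply, Pi.smul_apply]
    fun_prop

/-- The linear subspace of points whose coordinates with equal labels agree. -/
def labelled (ℓ : Fin N → ℕ) : Set (Fin N → ℂ) := {x | ∀ p q, ℓ p = ℓ q → x p = x q}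

/-- Let n be the size of the block of i. Divided differences across blocks vanish at generic points,
and those inside the block add up to n ∂_i f - Σ ∂_j f over the block. The last sum is the
derivative along a direction in the plane, hence 0, so D_i f = (1 - c n) ∂_i f. This vanishes if c n
= 1, and also if n = 1, because then ∂_i f is itself a tangential derivative. -/
lemma evalAt_polyDunkl_eq_zero_of_generic {c : ℂ} {ℓ : Fin N → ℕ} {i : Fin N}
    (hc : (Finset.univ.filter (ℓ · = ℓ i)).card = 1 ∨
      c * (Finset.univ.filter (ℓ · = ℓ i)).card = 1) {f : Laurent N}
    (hf : ∀ w, ∀ x ∈ labelled ℓ, evalAt x (permAct w f) = 0) {x : Fin N → ℂ} (hx : x ∈ labelled ℓ)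
    (hgen : ∀ j, ℓ j ≠ ℓ i → Complex.exp (x j - x i) ≠ 1) :
    evalAt x (polyDunkl c i f) = 0 := by
  have hf1 : ∀ x ∈ labelled ℓ, evalAt x f = 0 := by
    intro x hx
    simpa [permAct_one] using hf 1 x hx
  have hsum : ∑ j ∈ Finset.univ.filter (ℓ · = ℓ i), evalAt x (pderiv j f) = 0 := by
    have h1 := hasDerivAt_evalAt x (fun p => if ℓ p = ℓ i then 1 else 0) f
    have h2 : (fun t : ℂ => evalAt (x + t • fun p => if ℓ p = ℓ i then (1 : ℂ) else 0) f) =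
        fun _ => 0 := by
      funext t
      apply hf1
      intro p q hpq
      simp [hpq, hx p q hpq]
    rw [h2] at h1
    have h3 := h1.unique (hasDerivAt_const _ _)
    rw [Finset.sum_filter]
    simpa using h3
  have hj : ∀ j ∈ Finset.univ.filter (· ≠ i), evalAt x (divDiff i j f) =
      if ℓ j = ℓ i then evalAt x (pderiv i f) - evalAt x (pderiv j f) else 0 := by
    intro j _
    split_ifs with h
    · exact evalAt_divDiff_of_eq (hx i j h.symm) f
    · exact evalAt_divDiff_eq_zero (hgen j h) (hf1 x hx) (hf _ x hx)
  have hj' : ∑ j ∈ Finset.univ.filter (· ≠ i), evalAt x (divDiff i j f) =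
      ((Finset.univ.filter (ℓ · = ℓ i)).card : ℂ) * evalAt x (pderiv i f) := by
    -- The index j = i may be included, its term ∂_i f - ∂_i f being zero; this is why the full
    -- block size appears.
    rw [Finset.sum_congr rfl hj, Finset.sum_filter_of_ne, ← Finset.sum_filter,
      Finset.sum_sub_distrib, hsum, Finset.sum_const, nsmul_eq_mul, sub_zero]
    rintro j _ h rfl
    simp at h
  simp only [polyDunkl, LinearMap.sub_apply, LinearMap.sum_apply, LinearMap.smul_apply, map_sub,
    map_sum, map_smul, smul_eq_mul]
  rw [← Finset.mul_sum, hj', ← mul_assoc]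
  rcases hc with h | h
  · obtain ⟨a, ha⟩ := Finset.card_eq_one.mp h
    have hi : i ∈ Finset.univ.filter (ℓ · = ℓ i) := by simp
    rw [ha, Finset.mem_singleton] at hi
    rw [ha, Finset.sum_singleton, ← hi] at hsum
    rw [hsum]
    ring
  · rw [h]
    ring

/-- Genericity is removed by continuity. The labels themselves give a direction v inside the plane
that separates the blocks; along x + t v with t real, a coincidence of exponentials forces the real
part of a coordinate difference to vanish, which happens for finitely many t only. -/
lemma evalAt_polyDunkl_eq_zero {c : ℂ} {ℓ : Fin N → ℕ} {i : Fin N}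
    (hc : (Finset.univ.filter (ℓ · = ℓ i)).card = 1 ∨
      c * (Finset.univ.filter (ℓ · = ℓ i)).card = 1) {f : Laurent N}
    (hf : ∀ w, ∀ x ∈ labelled ℓ, evalAt x (permAct w f) = 0) {x : Fin N → ℂ}
    (hx : x ∈ labelled ℓ) : evalAt x (polyDunkl c i f) = 0 := by
  let v : Fin N → ℂ := fun p => (ℓ p : ℂ)
  have hv : ∀ t : ℂ, x + t • v ∈ labelled ℓ := by
    intro t p q hpq
    simp [v, hpq, hx p q hpq]
  let bad : Set ℝ := Set.range fun j => -(x j - x i).re / ((ℓ j : ℝ) - ℓ i)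
  have hbad : bad.Finite := Set.finite_range _
  have key : (fun t : ℝ => evalAt (x + (t : ℂ) • v) (polyDunkl c i f)) = fun _ => 0 := by
    refine Continuous.ext_on (hbad.countable.dense_compl ℝ) (continuous_evalAt _ _ _) continuous_const ?_
    intro t ht
    refine evalAt_polyDunkl_eq_zero_of_generic hc hf (hv t) fun j hj he => ht ⟨j, ?_⟩
    have hne : (ℓ j : ℝ) - ℓ i ≠ 0 := sub_ne_zero.mpr (by exact_mod_cast hj)
    have h1 := congrArg norm he
    rw [Complex.norm_exp, norm_one, Real.exp_eq_one_iff] at h1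
    simp only [v, Pi.add_apply, Pi.smul_apply, smul_eq_mul, Complex.sub_re, Complex.add_re,
      Complex.re_ofReal_mul, Complex.natCast_re] at h1
    simp only [Complex.sub_re]
    rw [div_eq_iff hne]
    linear_combination -h1
  have := congrFun key 0
  simpa using this

lemma card_block {m k q : ℕ} (hmk : m * k ≤ N) (hq : q < m) (hk : 0 < k) :
    (Finset.univ.filter fun a : Fin N => (a : ℕ) / k = q).card = k := by
  have hlt : ∀ t < k, q * k + t < N := by
    intro t ht
    have : (q + 1) * k ≤ m * k := Nat.mul_le_mul_right k hq
    lia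
  conv_rhs => rw [← Finset.card_range k]
  symm
  refine Finset.card_bij (fun t ht => ⟨q * k + t, hlt t (Finset.mem_range.mp ht)⟩) ?_ ?_ ?_
  · intro t ht
    rw [Finset.mem_filter]
    refine ⟨Finset.mem_univ _, ?_⟩
    simp [Nat.div_eq_of_lt (Finset.mem_range.mp ht), mul_comm q k,
      Nat.mul_add_div hk]
  · intro t _ t' _ h
    simpa using h
  · intro a ha
    have ha : (a : ℕ) / k = q := by simpa using ha
    refine ⟨a % k, Finset.mem_range.mpr (Nat.mod_lt _ hk), ?_⟩
    ext
    simp [← ha, Nat.div_add_mod']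

/-- The label of an index: the number of its block, or a number of its own outside the blocks. -/
def blockLabel (N m k : ℕ) (a : Fin N) : ℕ := if (a : ℕ) < m * k then (a : ℕ) / k else m * k + a

lemma blockLabel_eq_iff {m k : ℕ} (hk : 0 < k) (a b : Fin N) :
    blockLabel N m k a = blockLabel N m k b ↔
      a = b ∨ (a : ℕ) < m * k ∧ (b : ℕ) < m * k ∧ (a : ℕ) / k = (b : ℕ) / k := by
  have hm : m ≤ m * k := Nat.le_mul_of_pos_right m hk
  have hdiv : ∀ a : ℕ, a < m * k → a / k < m := fun a ha => (Nat.div_lt_iff_lt_mul hk).mpr ha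
  have hab : (a : ℕ) = b → (a : ℕ) / k = (b : ℕ) / k := fun h => by rw [h]
  have h1 := hdiv a
  have h2 := hdiv b
  rw [Fin.ext_iff, blockLabel, blockLabel]
  split_ifs <;> lia

lemma card_blockLabel {m k : ℕ} (hk : 0 < k) (hmk : m * k ≤ N) (i : Fin N) :
    (Finset.univ.filter (blockLabel N m k · = blockLabel N m k i)).card =
      if (i : ℕ) < m * k then k else 1 := by
  simp only [blockLabel_eq_iff hk]
  split_ifs with h
  · have hi : (i : ℕ) / k < m := (Nat.div_lt_iff_lt_mul hk).mpr h
    refine Eq.trans (congrArg Finset.card ?_) (card_block hmk hi hk)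
    refine Finset.filter_congr fun a _ => ⟨?_, fun ha => Or.inr ⟨?_, h, ha⟩⟩
    · rintro (rfl | ha)
      · rfl
      · exact ha.2.2
    · rwa [← Nat.div_lt_iff_lt_mul hk, ha]
  · simp [h, Finset.filter_eq']

/-- A point of the stratum lies on `labelled ℓ` for the block label transported by some w. Its
blocks have k elements, where c k = 1, or a single element. -/
lemma polyDunkl_mem {m k : ℕ} (hk : 0 < k) (hmk : m * k ≤ N) {c : ℂ}
    (hcm : m ≠ 0 → c = 1 / (k : ℂ)) (i : Fin N) :
    vanishing N m k ≤ (vanishing N m k).comap (polyDunkl c i) := by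
  intro f hf x hxs
  obtain ⟨w, hw⟩ := hxs
  let ℓ : Fin N → ℕ := fun p => blockLabel N m k (w.symm p)
  have hlab : labelled ℓ ⊆ stratum N m k := by
    intro y hy
    refine ⟨w, fun a b ha hb hab => hy _ _ ?_⟩
    simp only [ℓ, Equiv.symm_apply_apply]
    exact (blockLabel_eq_iff hk a b).mpr (Or.inr ⟨ha, hb, hab⟩)
  have hx : x ∈ labelled ℓ := by
    intro p q hpq
    rcases (blockLabel_eq_iff hk _ _).mp hpq with h | ⟨h1, h2, h3⟩
    · rw [w.symm.injective h]
    · simpa using hw (w.symm p) (w.symm q) h1 h2 h3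
  refine evalAt_polyDunkl_eq_zero (ℓ := ℓ) ?_ (fun v y hy => permAct_mem m k v hf y (hlab hy)) hx
  have hcard : (Finset.univ.filter (ℓ · = ℓ i)).card = if (w.symm i : ℕ) < m * k then k else 1 := by
    rw [← card_blockLabel hk hmk]
    exact Finset.card_equiv w.symm (by simp [ℓ])
  rw [hcard]
  split_ifs with h
  · right
    have hm0 : m ≠ 0 := by rintro rfl; simp at h
    have : (k : ℂ) ≠ 0 := by exact_mod_cast hk.ne'
    rw [hcm hm0, one_div_mul_cancel this]
  · exact Or.inl rfl

lemma trigDunkl_apply (c : ℂ) (i : Fin N) (f : Laurent N) :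
    trigDunkl c i f = polyDunkl c i f -
      c • ∑ j ∈ Finset.univ.filter (· < i), permAct (Equiv.swap i j) f := by
  rw [trigDunkl_eq, LinearMap.sub_apply, LinearMap.smul_apply, LinearMap.sum_apply]

lemma trigDunkl_mem {m k : ℕ} (hk : 0 < k) (hmk : m * k ≤ N) {c : ℂ}
    (hcm : m ≠ 0 → c = 1 / (k : ℂ)) (i : Fin N) :
    vanishing N m k ≤ (vanishing N m k).comap (trigDunkl c i) := by
  intro f hf
  have h1 : polyDunkl c i f ∈ vanishing N m k := polyDunkl_mem hk hmk hcm i hf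
  have h2 : ∀ w, permAct w f ∈ vanishing N m k := fun w => permAct_mem m k w hf
  rw [Submodule.mem_comap, trigDunkl_apply]
  exact (vanishing N m k).sub_mem h1
    ((vanishing N m k).smul_mem c ((vanishing N m k).sum_mem fun j _ => h2 _))

end Vanishing


/-! ## Shifts of power series -/

section Shift

open PowerSeries

variable {A B : Type*} [Ring A] [Algebra ℂ A] [Ring B] [Algebra ℂ B]

/-- The expansion of `(u - s)⁻¹` in powers of `X = u⁻¹`. -/
def shiftVar (s : ℂ) : PowerSeries ℂ := X * (1 - C s * X)⁻¹

lemma one_sub_mul_shiftVar (s : ℂ) : (1 - C s * X) * shiftVar s = X := by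
  rw [shiftVar, mul_left_comm, PowerSeries.mul_inv_cancel _ (by simp), mul_one]

lemma coeff_shiftVar_pow (s : ℂ) {l n : ℕ} (h : l < n) : coeff l (shiftVar s ^ n) = 0 := by
  rw [shiftVar, mul_pow, coeff_X_pow_mul', if_neg (by lia)]

lemma coeff_shift (s : ℂ) (f : PowerSeries A) (l : ℕ) :
    coeff l (shift s f) = ∑ n ∈ Finset.range (l + 1), coeff l (shiftVar s ^ n) • coeff n f := by
  rw [shift, coeff_mk]; rfl

/-- The n-th power of `shiftVar s` starts in degree n, so the cut-off may be enlarged; a common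
cut-off is needed to compare several coefficients. -/
lemma coeff_shift_of_lt (s : ℂ) (f : PowerSeries A) {l L : ℕ} (h : l < L) :
    coeff l (shift s f) = ∑ n ∈ Finset.range L, coeff l (shiftVar s ^ n) • coeff n f := by
  rw [coeff_shift]
  refine Finset.sum_subset (Finset.range_subset_range.mpr h) fun n _ hn => ?_
  rw [coeff_shiftVar_pow s (by simpa using hn), zero_smul]

lemma shift_add (s : ℂ) (f g : PowerSeries A) : shift s (f + g) = shift s f + shift s g := by
  ext l
  simp only [coeff_shift, map_add, smul_add, Finset.sum_add_distrib]

lemma shift_sub (s : ℂ) (f g : PowerSeries A) : shift s (f - g) = shift s f - shift s g := by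
  ext l
  simp only [coeff_shift, map_sub, smul_sub, Finset.sum_sub_distrib]

lemma shift_smul (s a : ℂ) (f : PowerSeries A) : shift s (a • f) = a • shift s f := by
  ext l
  simp only [coeff_shift, coeff_smul, Finset.smul_sum, smul_comm a]

lemma shift_C (s : ℂ) (a : A) : shift s (C a) = C a := by
  ext l
  rw [coeff_shift, Finset.sum_eq_single_of_mem 0 (by simp)]
  · rw [pow_zero, coeff_zero_C, coeff_one, coeff_C]
    split_ifs <;> simp
  · intro n _ hn
    rw [coeff_C, if_neg hn, smul_zero]

/-- The substituted series has scalar coefficients, so the substitution is multiplicative even over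
noncommutative A. A square of pairs (m, n) is compared with a union of antidiagonals; the surplus
pairs have m + n > l and do not reach degree l. -/
lemma shift_mul (s : ℂ) (f g : PowerSeries A) : shift s (f * g) = shift s f * shift s g := by
  ext l
  have hr : ∀ p ∈ Finset.HasAntidiagonal.antidiagonal l, coeff p.1 (shift s f) * coeff p.2 (shift s g) =
      ∑ m ∈ Finset.range (l + 1), ∑ n ∈ Finset.range (l + 1),
        (coeff p.1 (shiftVar s ^ m) * coeff p.2 (shiftVar s ^ n)) • (coeff m f * coeff n g) := by
    intro p hp
    rw [Finset.HasAntidiagonal.mem_antidiagonal] at hp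
    rw [coeff_shift_of_lt s f (L := l + 1) (by lia), coeff_shift_of_lt s g (L := l + 1) (by lia),
      Finset.sum_mul_sum]
    simp only [smul_mul_smul_comm]
  rw [coeff_mul, Finset.sum_congr rfl hr, Finset.sum_comm]
  have hr2 : ∀ m ∈ Finset.range (l + 1), (∑ p ∈ Finset.HasAntidiagonal.antidiagonal l, ∑ n ∈ Finset.range (l + 1),
        (coeff p.1 (shiftVar s ^ m) * coeff p.2 (shiftVar s ^ n)) • (coeff m f * coeff n g)) =
      ∑ n ∈ Finset.range (l + 1), coeff l (shiftVar s ^ (m + n)) • (coeff m f * coeff n g) := by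
    intro m _
    rw [Finset.sum_comm]
    refine Finset.sum_congr rfl fun n _ => ?_
    rw [← Finset.sum_smul, pow_add, coeff_mul]
  rw [Finset.sum_congr rfl hr2, coeff_shift]
  simp only [coeff_mul, Finset.smul_sum]
  rw [Finset.sum_sigma', ← Finset.sum_product']
  refine Finset.sum_of_injOn (fun x => x.2) ?_ ?_ ?_ ?_
  · rintro ⟨n, p⟩ hp ⟨n', p'⟩ hp' h
    simp only [Finset.coe_sigma, Set.mem_sigma_iff, Finset.mem_coe, Finset.HasAntidiagonal.mem_antidiagonal] at hp hp'
    simp only at h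
    subst h
    have : n = n' := hp.2.symm.trans hp'.2
    subst this
    rfl
  · rintro ⟨n, p⟩ hp
    simp only [Finset.coe_sigma, Set.mem_sigma_iff, Finset.mem_coe, Finset.HasAntidiagonal.mem_antidiagonal,
      Finset.mem_range] at hp
    simp only [Finset.coe_product, Set.mem_prod, Finset.mem_coe, Finset.mem_range]
    lia
  · rintro ⟨m, n⟩ _ hmn
    have : l < m + n := by
      by_contra h
      refine hmn ⟨⟨m + n, (m, n)⟩, ?_, rfl⟩
      simp only [Finset.coe_sigma, Set.mem_sigma_iff, Finset.mem_coe, Finset.HasAntidiagonal.mem_antidiagonal,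
        Finset.mem_range]
      lia
    rw [coeff_shiftVar_pow s this, zero_smul]
  · rintro ⟨n, p⟩ hp
    simp only [Finset.mem_sigma, Finset.HasAntidiagonal.mem_antidiagonal] at hp
    rw [hp.2]

lemma shift_pow (s : ℂ) (f : PowerSeries A) (n : ℕ) : shift s (f ^ n) = shift s f ^ n := by
  induction n with
  | zero => rw [pow_zero, pow_zero, ← map_one C, shift_C]
  | succ n ih => rw [pow_succ, shift_mul, ih, pow_succ]

lemma shift_X (s : ℂ) : shift s (X : PowerSeries A) = map (algebraMap ℂ A) (shiftVar s) := by
  ext l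
  rw [coeff_map, Algebra.algebraMap_eq_smul_one, coeff_shift_of_lt s _ (L := l + 2) (by lia),
    Finset.sum_eq_single_of_mem 1 (by simp)]
  · rw [coeff_one_X, pow_one]
  · intro n _ hn
    rw [coeff_X, if_neg hn, smul_zero]

/-- This is (u - s) - t = u - (s + t), verified after clearing the denominator 1 - (s + t) X. -/
lemma shift_shiftVar (s t : ℂ) : shift s (shiftVar t) = shiftVar (s + t) := by
  have h1 := congrArg (shift s) (one_sub_mul_shiftVar t)
  have hX : shift s (X : PowerSeries ℂ) = shiftVar s := by
    rw [shift_X]; ext; simp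
  rw [shift_mul, shift_sub, shift_mul, shift_C, hX, ← map_one C, shift_C, map_one] at h1
  have h2 := one_sub_mul_shiftVar s
  have h3 := one_sub_mul_shiftVar (s + t)
  have hne : (1 - C (s + t) * X : PowerSeries ℂ) ≠ 0 := by
    intro h
    simpa using congrArg (coeff 0) h
  have e : (1 - C (s + t) * X : PowerSeries ℂ) = (1 - C s * X) * (1 - C t * shiftVar s) := by
    rw [map_add]
    linear_combination (C t) * h2
  apply mul_left_cancel₀ hne
  rw [h3, e, mul_assoc, h1, h2]

lemma shift_shift (s t : ℂ) (f : PowerSeries A) : shift s (shift t f) = shift (s + t) f := by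
  ext l
  have h : ∀ n ∈ Finset.range (l + 1), coeff l (shiftVar s ^ n) • coeff n (shift t f) =
      ∑ m ∈ Finset.range (l + 1),
        (coeff l (shiftVar s ^ n) * coeff n (shiftVar t ^ m)) • coeff m f := by
    intro n hn
    rw [coeff_shift_of_lt t f (Finset.mem_range.mp hn), Finset.smul_sum]
    simp only [smul_smul]
  rw [coeff_shift, Finset.sum_congr rfl h, Finset.sum_comm, coeff_shift]
  refine Finset.sum_congr rfl fun m _ => ?_
  rw [← Finset.sum_smul, ← shift_shiftVar, ← shift_pow, coeff_shift]
  rfl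

lemma map_shift (φ : A →ₐ[ℂ] B) (s : ℂ) (f : PowerSeries A) :
    map (φ : A →+* B) (shift s f) = shift s (map (φ : A →+* B) f) := by
  ext l
  simp [coeff_shift, map_sum]

end Shift


/-! ## Fusion of exchange relations and the centrality of the quantum determinant -/

section Fusion

variable {r : ℕ} {K : Type*} [CommRing K]

section Ops

variable {E E' : Type*} [AddCommGroup E] [Module K E] [AddCommGroup E'] [Module K E']

/-- The operator `f_j - κ (0 j+1)` on functions of sequences of indices. -/
def exchOp (f : ℕ → K) (κ : K) (j : ℕ) (Φ : (ℕ → Fin r) → E) : (ℕ → Fin r) → E :=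
  fun α => f j • Φ α - κ • Φ (α ∘ Equiv.swap 0 (j + 1))

/-- `exchOp j ∘ ⋯ ∘ exchOp (j + n - 1)`. -/
def exchDesc (f : ℕ → K) (κ : K) : ℕ → ℕ → ((ℕ → Fin r) → E) → (ℕ → Fin r) → E
  | 0, _, Φ => Φ
  | n + 1, j, Φ => exchOp f κ j (exchDesc f κ n (j + 1) Φ)

/-- `exchOp (j + n - 1) ∘ ⋯ ∘ exchOp j`. -/
def exchAsc (f : ℕ → K) (κ : K) : ℕ → ℕ → ((ℕ → Fin r) → E) → (ℕ → Fin r) → E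
  | 0, _, Φ => Φ
  | n + 1, j, Φ => exchAsc f κ n (j + 1) (exchOp f κ j Φ)

lemma exchDesc_comp (f : ℕ → K) (κ : K) (L : E →ₗ[K] E') (n j : ℕ) (Φ : (ℕ → Fin r) → E) :
    exchDesc f κ n j (fun α => L (Φ α)) = fun α => L (exchDesc f κ n j Φ α) := by
  induction n generalizing j with
  | zero => rfl
  | succ n ih =>
    funext α
    simp only [exchDesc, exchOp, ih, map_sub, map_smul]

lemma swap_comp_swap {i j : ℕ} (h : i ≠ j) (α : ℕ → Fin r) :
    (α ∘ Equiv.swap 0 (j + 1)) ∘ Equiv.swap 0 (i + 1) =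
      (α ∘ Equiv.swap 0 (i + 1)) ∘ Equiv.swap (i + 1) (j + 1) := by
  funext p
  simp only [Function.comp_apply, Equiv.swap_apply_def]
  congr 1
  grind

lemma swap_comp_swap' {i j : ℕ} (h : i ≠ j) (α : ℕ → Fin r) :
    (α ∘ Equiv.swap 0 (i + 1)) ∘ Equiv.swap 0 (j + 1) =
      (α ∘ Equiv.swap (i + 1) (j + 1)) ∘ Equiv.swap 0 (i + 1) := by
  funext p
  simp only [Function.comp_apply, Equiv.swap_apply_def]
  congr 1
  grind

/-- Fusion: on a function antisymmetric in the slots 1, …, r a product of two transpositions through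
slot 0 equals minus a single one. Since f_{j+1} = f_j + κ, the quadratic term then merges with the
linear ones, and every step only splits off a scalar factor. -/
lemma exchDesc_of_antisymm {f : ℕ → K} {κ : K} (hf : ∀ i, f (i + 1) = f i + κ)
    {F : (ℕ → Fin r) → E}
    (hF : ∀ i j α, i < r → j < r → i ≠ j → F (α ∘ Equiv.swap (i + 1) (j + 1)) = -F α)
    (n j : ℕ) (hn : j + n < r) (α : ℕ → Fin r) :
    exchDesc f κ (n + 1) j F α = (∏ i ∈ Finset.range n, f (j + 1 + i)) •
      (f j • F α - κ • ∑ i ∈ Finset.range (n + 1), F (α ∘ Equiv.swap 0 (j + i + 1))) := by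
  induction n generalizing j α with
  | zero => simp [exchDesc, exchOp]
  | succ n ih =>
    have h : ∀ i ∈ Finset.range (n + 1),
        F ((α ∘ Equiv.swap 0 (j + 1)) ∘ Equiv.swap 0 (j + 1 + i + 1)) =
          -F (α ∘ Equiv.swap 0 (j + 1 + i + 1)) := by
      intro i hi
      rw [Finset.mem_range] at hi
      rw [swap_comp_swap (by lia), hF _ _ _ (by lia) (by lia) (by lia)]
    rw [exchDesc, exchOp, ih (j + 1) (by lia), ih (j + 1) (by lia), Finset.sum_congr rfl h,
      Finset.prod_range_succ', Finset.sum_range_succ' _ (n + 1), Finset.sum_neg_distrib]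
    have e1 : ∀ i, j + 1 + 1 + i = j + 1 + (i + 1) := by intro i; lia
    have e2 : ∀ i, j + 1 + i + 1 = j + (i + 1) + 1 := by intro i; lia
    simp only [e1, e2, add_zero, hf]
    module

/-- The dual form of `exchDesc_of_antisymm`: the antisymmetry is carried by the functional L, so the
operators are applied in the opposite order. -/
lemma exchAsc_of_antisymm {f : ℕ → K} {κ : K} (hf : ∀ i, f (i + 1) = f i + κ)
    (L : ((ℕ → Fin r) → E) →ₗ[K] E')
    (hL : ∀ (i j : ℕ) (Φ : (ℕ → Fin r) → E), i < r → j < r → i ≠ j →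
      L (fun β => Φ ((β ∘ Equiv.swap 0 (i + 1)) ∘ Equiv.swap 0 (j + 1))) =
        -L (fun β => Φ (β ∘ Equiv.swap 0 (i + 1))))
    (n j : ℕ) (hn : j + n < r) (Φ : (ℕ → Fin r) → E) :
    L (exchAsc f κ (n + 1) j Φ) = (∏ i ∈ Finset.range n, f (j + 1 + i)) •
      (f j • L Φ - κ • ∑ i ∈ Finset.range (n + 1),
        L (fun β => Φ (β ∘ Equiv.swap 0 (j + i + 1)))) := by
  have hop : ∀ i, L (exchOp f κ i Φ) = f i • L Φ - κ • L (fun β => Φ (β ∘ Equiv.swap 0 (i + 1))) := by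
    intro i
    rw [← map_smul, ← map_smul, ← map_sub]
    rfl
  induction n generalizing j Φ with
  | zero => simpa [exchAsc] using hop j
  | succ n ih =>
    have h : ∀ i ∈ Finset.range (n + 1),
        L (fun β => exchOp f κ j Φ (β ∘ Equiv.swap 0 (j + 1 + i + 1))) =
          f j • L (fun β => Φ (β ∘ Equiv.swap 0 (j + 1 + i + 1))) +
            κ • L (fun β => Φ (β ∘ Equiv.swap 0 (j + 1 + i + 1))) := by
      intro i hi
      rw [Finset.mem_range] at hi
      have := hL (j + 1 + i) j Φ (by lia) (by lia) (by lia)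
      rw [← neg_neg (κ • _), ← smul_neg, ← this, ← map_smul, ← map_smul, ← sub_eq_add_neg, ← map_sub]
      rfl
    have hop' : ∀ i, L (exchOp f κ i (exchOp f κ j Φ)) = f i • L (exchOp f κ j Φ) -
        κ • L (fun β => exchOp f κ j Φ (β ∘ Equiv.swap 0 (i + 1))) := by
      intro i
      rw [← map_smul, ← map_smul, ← map_sub]
      rfl
    rw [exchAsc, ih (j + 1) (by lia) _ hop', Finset.sum_congr rfl h, hop,
      Finset.prod_range_succ', Finset.sum_range_succ' _ (n + 1), Finset.sum_add_distrib,
      ← Finset.smul_sum, ← Finset.smul_sum]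
    have e1 : ∀ i, j + 1 + 1 + i = j + 1 + (i + 1) := by intro i; lia
    have e2 : ∀ i, j + 1 + i + 1 = j + (i + 1) + 1 := by intro i; lia
    simp only [e1, e2, add_zero, hf]
    module

end Ops

section Words

variable {B : Type*} [Ring B] [Algebra K B]

/-- The product of `T i α_{i+1} β_{i+1}` over `j ≤ i < j + n`. -/
def wordProd (T : ℕ → Fin r → Fin r → B) (j n : ℕ) (α β : ℕ → Fin r) : B :=
  ((List.range' j n).map fun i => T i (α (i + 1)) (β (i + 1))).prod

lemma wordProd_succ (T : ℕ → Fin r → Fin r → B) (j n : ℕ) (α β : ℕ → Fin r) :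
    wordProd T j (n + 1) α β = T j (α (j + 1)) (β (j + 1)) * wordProd T (j + 1) n α β := by
  simp [wordProd, List.range'_succ]

lemma wordProd_add (T : ℕ → Fin r → Fin r → B) (j m n : ℕ) (α β : ℕ → Fin r) :
    wordProd T j (m + n) α β = wordProd T j m α β * wordProd T (j + m) n α β := by
  have := List.range'_append (s := j) (m := m) (n := n) (step := 1)
  rw [one_mul] at this
  rw [wordProd, ← this, List.map_append, List.prod_append]
  rfl

lemma wordProd_congr (T : ℕ → Fin r → Fin r → B) {j n : ℕ} {α β α' β' : ℕ → Fin r}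
    (h : ∀ i, j ≤ i → i < j + n → α (i + 1) = α' (i + 1) ∧ β (i + 1) = β' (i + 1)) :
    wordProd T j n α β = wordProd T j n α' β' := by
  unfold wordProd
  congr 1
  refine List.map_congr_left fun i hi => ?_
  rw [List.mem_range'_1] at hi
  rw [(h i hi.1 hi.2).1, (h i hi.1 hi.2).2]

/-- The word with `τ` between the first `j` and the following `n` letters. -/
def word (T : ℕ → Fin r → Fin r → B) (τ : Fin r → Fin r → B) (j n : ℕ) (α β : ℕ → Fin r) : B :=
  wordProd T 0 j α β * τ (α 0) (β 0) * wordProd T j n α β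

variable {T : ℕ → Fin r → Fin r → B} {τ : Fin r → Fin r → B} {f : ℕ → K} {κ : K}

/-- Slot 0 holds the indices of τ and slot j + 1 those of T_j. The exchange relation says that
moving τ from the right of T_j to its left turns the operator on row indices into the same operator
on column indices. -/
lemma exchOp_word (h : ∀ j a b d e, f j • (T j a b * τ d e - τ d e * T j a b) =
      κ • (T j d b * τ a e - τ d b * T j a e)) (j n : ℕ) (α β : ℕ → Fin r) :
    exchOp f κ j (word T τ (j + 1) n) α β = exchOp f κ j (word T τ j (n + 1) α) β := by
  have hne : ∀ i, i ≠ j → Equiv.swap 0 (j + 1) (i + 1) = i + 1 := fun i hi =>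
    Equiv.swap_apply_of_ne_of_ne (by lia) (by lia)
  have h1 : ∀ α β : ℕ → Fin r, word T τ (j + 1) n α β = wordProd T 0 j α β *
      (T j (α (j + 1)) (β (j + 1)) * τ (α 0) (β 0)) * wordProd T (j + 1) n α β := by
    intro α β
    have := wordProd_add T 0 j 1 α β
    rw [zero_add] at this
    rw [word, this]
    simp [wordProd, mul_assoc]
  have h2 : ∀ α β : ℕ → Fin r, word T τ j (n + 1) α β = wordProd T 0 j α β *
      (τ (α 0) (β 0) * T j (α (j + 1)) (β (j + 1))) * wordProd T (j + 1) n α β := by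
    intro α β
    rw [word, wordProd_succ]
    simp only [mul_assoc]
  have h3 : ∀ α β : ℕ → Fin r, wordProd T 0 j (α ∘ Equiv.swap 0 (j + 1)) β = wordProd T 0 j α β :=
    fun α β => wordProd_congr T fun i _ hi => by simp [hne i (by lia)]
  have h4 : ∀ α β : ℕ → Fin r, wordProd T (j + 1) n (α ∘ Equiv.swap 0 (j + 1)) β =
      wordProd T (j + 1) n α β :=
    fun α β => wordProd_congr T fun i hi _ => by simp [hne i (by lia)]
  have h3' : ∀ α β : ℕ → Fin r, wordProd T 0 j α (β ∘ Equiv.swap 0 (j + 1)) = wordProd T 0 j α β :=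
    fun α β => wordProd_congr T fun i _ hi => by simp [hne i (by lia)]
  have h4' : ∀ α β : ℕ → Fin r, wordProd T (j + 1) n α (β ∘ Equiv.swap 0 (j + 1)) =
      wordProd T (j + 1) n α β :=
    fun α β => wordProd_congr T fun i hi _ => by simp [hne i (by lia)]
  have hx := h j (α (j + 1)) (β (j + 1)) (α 0) (β 0)
  have hy := congrArg (fun x => wordProd T 0 j α β * x * wordProd T (j + 1) n α β) hx
  simp only [mul_smul_comm, smul_mul_assoc, mul_sub, sub_mul, smul_sub] at hy
  simp only [exchOp, Pi.sub_apply, Pi.smul_apply, h1, h2, h3, h4, h3', h4', Function.comp_apply,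
    Equiv.swap_apply_left, Equiv.swap_apply_right]
  rw [sub_eq_sub_iff_add_eq_add] at hy ⊢
  rw [← sub_eq_zero] at hy ⊢
  rw [← hy]
  abel

/-- Row operators commute with column operators, so `exchOp_word` can be iterated; carrying τ across
the word reverses the order of the operators. -/
lemma exchDesc_word (h : ∀ j a b d e, f j • (T j a b * τ d e - τ d e * T j a b) =
      κ • (T j d b * τ a e - τ d b * T j a e)) (n j : ℕ) (α β : ℕ → Fin r) :
    exchDesc f κ n j (word T τ (j + n) 0) α β = exchAsc f κ n j (word T τ j n α) β := by
  suffices H : exchDesc f κ n j (word T τ (j + n) 0) = fun α => exchAsc f κ n j (word T τ j n α) by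
    rw [H]
  have hasc : ∀ (n i j : ℕ) (Φ : (ℕ → Fin r) → (ℕ → Fin r) → B),
      exchOp f κ i (fun α => exchAsc f κ n j (Φ α)) =
        fun α => exchAsc f κ n j (exchOp f κ i Φ α) := by
    intro n
    induction n with
    | zero => intro i j Φ; rfl
    | succ n ih =>
      intro i j Φ
      simp only [exchAsc]
      rw [ih]
      funext α
      congr 1
      funext β
      simp only [exchOp, Pi.sub_apply, Pi.smul_apply]
      module
  induction n generalizing j with
  | zero => rfl
  | succ n ih =>
    have : j + (n + 1) = j + 1 + n := by lia
    simp only [exchDesc, exchAsc]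
    rw [this, ih (j + 1), hasc]
    funext α
    congr 1
    funext β
    exact exchOp_word h j n α β

/-- The sequence of indices `e, σ 0, …, σ (r-1)`, continued arbitrarily. -/
def slots (σ : Fin r → Fin r) (e : Fin r) : ℕ → Fin r
  | 0 => e
  | i + 1 => if h : i < r then σ ⟨i, h⟩ else e

lemma slots_succ (σ : Fin r → Fin r) (e : Fin r) (i : Fin r) : slots σ e (i + 1) = σ i := by
  simp [slots]

lemma slots_comp_swap (σ : Fin r → Fin r) (e : Fin r) (i j : Fin r) :
    slots σ e ∘ Equiv.swap ((i : ℕ) + 1) (j + 1) = slots (σ ∘ Equiv.swap i j) e := by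
  funext p
  rcases p with _ | p
  · rw [Function.comp_apply, Equiv.swap_apply_of_ne_of_ne (by lia) (by lia)]
    rfl
  · rw [Function.comp_apply]
    by_cases hp : p < r
    · have hs := slots_succ (σ ∘ Equiv.swap i j) e ⟨p, hp⟩
      rw [hs, Function.comp_apply, ← slots_succ σ e]
      congr 1
      simp only [Equiv.swap_apply_def, Fin.ext_iff]
      split_ifs <;> lia
    · rw [Equiv.swap_apply_of_ne_of_ne (by lia) (by lia)]
      simp [slots, hp]

section Alt

variable {E : Type*} [AddCommGroup E] [Module K E]

/-- Evaluation on the antisymmetrized sequences. -/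
def altEval (e : Fin r) : ((ℕ → Fin r) → E) →ₗ[K] E :=
  ∑ σ : Equiv.Perm (Fin r), ((Equiv.Perm.sign σ : ℤ)) • LinearMap.proj (slots σ e)

lemma altEval_apply (e : Fin r) (Φ : (ℕ → Fin r) → E) :
    altEval (K := K) e Φ = ∑ σ : Equiv.Perm (Fin r), (Equiv.Perm.sign σ : ℤ) • Φ (slots σ e) := by
  simp [altEval]

lemma altEval_swap (e : Fin r) (i j : ℕ) (hi : i < r) (hj : j < r) (hij : i ≠ j)
    (Φ : (ℕ → Fin r) → E) :
    altEval (K := K) e (fun β => Φ (β ∘ Equiv.swap (i + 1) (j + 1))) = -altEval (K := K) e Φ := by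
  lift i to Fin r using hi
  lift j to Fin r using hj
  rw [altEval_apply, altEval_apply,
    ← Equiv.sum_comp (Equiv.mulRight (Equiv.swap i j))
      (fun σ => (Equiv.Perm.sign σ : ℤ) • Φ (slots σ e)), ← Finset.sum_neg_distrib]
  refine Finset.sum_congr rfl fun σ _ => ?_
  have hij' : i ≠ j := fun h => hij (by rw [h])
  rw [slots_comp_swap]
  simp [Equiv.Perm.sign_swap hij']

lemma altEval_swap_swap (e : Fin r) (i j : ℕ) (Φ : (ℕ → Fin r) → E) (hi : i < r) (hj : j < r)
    (hij : i ≠ j) :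
    altEval (K := K) e (fun β => Φ ((β ∘ Equiv.swap 0 (i + 1)) ∘ Equiv.swap 0 (j + 1))) =
        -altEval (K := K) e (fun β => Φ (β ∘ Equiv.swap 0 (i + 1))) := by
  rw [← altEval_swap e i j hi hj hij]
  simp only [swap_comp_swap' hij]

/-- Antisymmetrizing r + 1 indices that take only r values gives zero. For a given σ the
transposition with i = σ⁻¹ e fixes the sequence; the remaining terms cancel in pairs under (σ, i) ↦
(σ ∘ (i p), p), p = σ⁻¹ e, which keeps the transposed sequence and changes the sign. -/
lemma altEval_sum_swap (e : Fin r) (Φ : (ℕ → Fin r) → E) :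
    ∑ i ∈ Finset.range r, altEval (K := K) e (fun β => Φ (β ∘ Equiv.swap 0 (i + 1))) =
      altEval (K := K) e Φ := by
  simp only [altEval_apply]
  rw [Finset.sum_comm]
  have h0 : ∀ (σ : Equiv.Perm (Fin r)) (i : Fin r), σ i = e →
      slots σ e ∘ Equiv.swap 0 ((i : ℕ) + 1) = slots σ e := by
    intro σ i hi
    funext p
    rw [Function.comp_apply, Equiv.swap_apply_def]
    split_ifs with h1 h2
    · rw [h1, slots_succ, hi]; rfl
    · rw [h2, slots_succ, hi]; rfl
    · rfl
  have h1 : ∀ σ : Equiv.Perm (Fin r), ∑ i ∈ Finset.range r,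
      (Equiv.Perm.sign σ : ℤ) • Φ (slots σ e ∘ Equiv.swap 0 (i + 1)) =
      (Equiv.Perm.sign σ : ℤ) • Φ (slots σ e) +
        ∑ i : Fin r, if σ i = e then 0 else
          (Equiv.Perm.sign σ : ℤ) • Φ (slots σ e ∘ Equiv.swap 0 ((i : ℕ) + 1)) := by
    intro σ
    rw [Finset.sum_range fun i => (Equiv.Perm.sign σ : ℤ) • Φ (slots σ e ∘ Equiv.swap 0 (i + 1))]
    have : ∀ i : Fin r, (Equiv.Perm.sign σ : ℤ) • Φ (slots σ e ∘ Equiv.swap 0 ((i : ℕ) + 1)) =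
        (if i = σ.symm e then (Equiv.Perm.sign σ : ℤ) • Φ (slots σ e) else 0) +
        if σ i = e then 0 else
          (Equiv.Perm.sign σ : ℤ) • Φ (slots σ e ∘ Equiv.swap 0 ((i : ℕ) + 1)) := by
      intro i
      simp only [Equiv.eq_symm_apply]
      split_ifs with h
      · rw [h0 σ i h, add_zero]
      · rw [zero_add]
    rw [Finset.sum_congr rfl fun i _ => this i, Finset.sum_add_distrib, Finset.sum_ite_eq']
    simp
  rw [Finset.sum_congr rfl fun σ _ => h1 σ, Finset.sum_add_distrib, add_eq_left,
    ← Finset.sum_product']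
  refine Finset.sum_involution
    (fun x _ => (x.1 * Equiv.swap x.2 (x.1.symm e), x.1.symm e)) ?_ ?_ ?_ ?_
  · rintro ⟨σ, i⟩ _
    dsimp only
    by_cases hi : σ i = e
    · have : σ.symm e = i := by rw [← hi, Equiv.symm_apply_apply]
      simp [hi, this]
    · have hp : i ≠ σ.symm e := fun h => hi (by rw [h, Equiv.apply_symm_apply])
      have hseq : slots (σ * Equiv.swap i (σ.symm e)) e ∘ Equiv.swap 0 ((σ.symm e : ℕ) + 1) =
          slots σ e ∘ Equiv.swap 0 ((i : ℕ) + 1) := by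
        have hcoe : (⇑(σ * Equiv.swap i (σ.symm e)) : Fin r → Fin r) = σ ∘ Equiv.swap i (σ.symm e) :=
          rfl
        have hne : (σ.symm e : ℕ) ≠ i := fun h => hp (Fin.ext h.symm)
        rw [hcoe, ← slots_comp_swap, Equiv.swap_comm ((i : ℕ) + 1), ← swap_comp_swap' hne,
          h0 σ _ (by simp)]
      rw [if_neg hi, if_neg (by simpa using hi), hseq]
      simp [Equiv.Perm.sign_swap hp]
  · rintro ⟨σ, i⟩ _ h
    dsimp only at h ⊢
    intro h'
    rw [Prod.mk.injEq] at h'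
    apply h
    rw [if_pos (by rw [← h'.2, Equiv.apply_symm_apply])]
  · intro _ _
    exact Finset.mem_univ _
  · rintro ⟨σ, i⟩ _
    have : (σ * Equiv.swap i (σ.symm e)).symm e = i := by
      rw [Equiv.symm_apply_eq, Equiv.Perm.mul_apply, Equiv.swap_apply_left, Equiv.apply_symm_apply]
    dsimp only
    rw [this, Equiv.swap_comm _ i, mul_assoc, Equiv.swap_mul_self, mul_one]

end Alt

end Words

end Fusion


/-! ### Ordered determinants: antisymmetry in the rows and commutation with τ. -/

section QuantumDeterminant

lemma eq_zero_of_eq_neg {B : Type*} [AddCommGroup B] [Module ℂ B] {x : B} (h : x = -x) : x = 0 := by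
  have h2 : (2 : ℂ) • x = 0 := by
    rw [two_smul]
    nth_rewrite 1 [h]
    exact neg_add_cancel x
  exact (smul_eq_zero.mp h2).resolve_left two_ne_zero

variable {r : ℕ} {K : Type*} [CommRing K] {B : Type*} [Ring B] [Algebra K B]
  {T : ℕ → Fin r → Fin r → B} {τ : Fin r → Fin r → B} {f : ℕ → K} {κ : K}

/-- By `h` the product of two neighbouring letters, symmetrized in the rows, is symmetric in the
columns, and so is killed by alternation of the columns. -/
lemma altEval_wordProd_swap_succ [Algebra ℂ B]
    (h : ∀ i a b d e, T i a b * T (i + 1) d e + T i d b * T (i + 1) a e =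
      T i a e * T (i + 1) d b + T i d e * T (i + 1) a b)
    (e : Fin r) (i : ℕ) (hi : i + 1 < r) (α : ℕ → Fin r) :
    altEval (K := K) e (wordProd T 0 r (α ∘ Equiv.swap (i + 1) (i + 1 + 1))) =
      -altEval (K := K) e (wordProd T 0 r α) := by
  obtain ⟨m, rfl⟩ : ∃ m, r = i + (2 + m) := ⟨r - i - 2, by lia⟩
  have hsplit : ∀ α β : ℕ → Fin (i + (2 + m)), wordProd T 0 (i + (2 + m)) α β =
      wordProd T 0 i α β * (T i (α (i + 1)) (β (i + 1)) * T (i + 1) (α (i + 1 + 1)) (β (i + 1 + 1))) *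
        wordProd T (i + 2) m α β := by
    intro α β
    rw [wordProd_add, wordProd_add, zero_add, wordProd_succ, wordProd_succ]
    simp [wordProd, mul_assoc]
  have hne : ∀ j, j < i ∨ i + 1 < j → Equiv.swap (i + 1) (i + 1 + 1) (j + 1) = j + 1 :=
    fun j hj => Equiv.swap_apply_of_ne_of_ne (by lia) (by lia)
  have h1 : ∀ α β : ℕ → Fin (i + (2 + m)), wordProd T 0 i (α ∘ Equiv.swap (i + 1) (i + 1 + 1)) β =
      wordProd T 0 i α β := fun α β => wordProd_congr T fun j _ hj => by simp [hne j (by lia)]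
  have h2 : ∀ α β : ℕ → Fin (i + (2 + m)), wordProd T (i + 2) m (α ∘ Equiv.swap (i + 1) (i + 1 + 1)) β =
      wordProd T (i + 2) m α β := fun α β => wordProd_congr T fun j hj _ => by simp [hne j (by lia)]
  have h3 : ∀ α β : ℕ → Fin (i + (2 + m)), wordProd T 0 i α (β ∘ Equiv.swap (i + 1) (i + 1 + 1)) =
      wordProd T 0 i α β := fun α β => wordProd_congr T fun j _ hj => by simp [hne j (by lia)]
  have h4 : ∀ α β : ℕ → Fin (i + (2 + m)), wordProd T (i + 2) m α (β ∘ Equiv.swap (i + 1) (i + 1 + 1)) =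
      wordProd T (i + 2) m α β := fun α β => wordProd_congr T fun j hj _ => by simp [hne j (by lia)]
  rw [← add_eq_zero_iff_eq_neg, ← map_add]
  apply eq_zero_of_eq_neg
  rw [← altEval_swap e i (i + 1) (by lia) hi (by lia)]
  congr 1
  funext β
  simp only [Pi.add_apply, hsplit, h1, h2, h3, h4, Function.comp_apply, Equiv.swap_apply_left,
    Equiv.swap_apply_right, ← mul_add, ← add_mul]
  congr 2
  rw [add_comm, h i, add_comm]

lemma altEval_wordProd_swap [Algebra ℂ B]
    (h : ∀ i a b d e, T i a b * T (i + 1) d e + T i d b * T (i + 1) a e =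
      T i a e * T (i + 1) d b + T i d e * T (i + 1) a b)
    (e : Fin r) (i j : ℕ) (hi : i < r) (hj : j < r) (hij : i ≠ j) (α : ℕ → Fin r) :
    altEval (K := K) e (wordProd T 0 r (α ∘ Equiv.swap (i + 1) (j + 1))) =
      -altEval (K := K) e (wordProd T 0 r α) := by
  wlog hlt : i < j generalizing i j
  · rw [Equiv.swap_comm]
    exact this j i hj hi hij.symm (by lia)
  obtain ⟨n, rfl⟩ : ∃ n, j = i + 1 + n := ⟨j - i - 1, by lia⟩
  clear hij hlt
  induction n generalizing α with
  | zero => exact altEval_wordProd_swap_succ h e i hj α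
  | succ n ih =>
    -- A longer transposition is a shorter one conjugated by an adjacent one; the three signs
    -- multiply to -1.
    have hs : Equiv.swap (i + 1) (i + 1 + (n + 1) + 1) =
        Equiv.swap (i + 1 + n + 1) (i + 1 + n + 1 + 1) * Equiv.swap (i + 1) (i + 1 + n + 1) *
          Equiv.swap (i + 1 + n + 1) (i + 1 + n + 1 + 1) := by
      rw [Equiv.swap_mul_swap_mul_swap (x := i + 1) (by lia) (by lia), Equiv.swap_comm]
      rfl
    have hc : α ∘ Equiv.swap (i + 1) (i + 1 + (n + 1) + 1) =
        ((α ∘ Equiv.swap (i + 1 + n + 1) (i + 1 + n + 1 + 1)) ∘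
          Equiv.swap (i + 1) (i + 1 + n + 1)) ∘
          Equiv.swap (i + 1 + n + 1) (i + 1 + n + 1 + 1) := by
      rw [hs]; rfl
    rw [hc, altEval_wordProd_swap_succ h e (i + 1 + n) hj, ih _ (by lia), altEval_wordProd_swap_succ h e (i + 1 + n) hj,
      neg_neg]

lemma wordProd_slots (T : ℕ → Fin r → Fin r → B) (σ : Fin r → Fin r) (d e : Fin r) :
    wordProd T 0 r (slots id d) (slots σ e) = (List.ofFn fun a : Fin r => T a a (σ a)).prod := by
  rw [wordProd, List.range'_eq_map_range, List.map_map, List.ofFn_eq_map, ← List.map_coe_finRange_eq_range,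
    List.map_map]
  congr 1
  refine List.map_congr_left fun a _ => ?_
  simp [slots_succ]

/-- The determinant `∑_σ sgn(σ) T_0^{0,σ(0)} ⋯ T_{r-1}^{r-1,σ(r-1)}`. -/
def ncDet (T : ℕ → Fin r → Fin r → B) : B :=
  ∑ σ : Equiv.Perm (Fin r), (Equiv.Perm.sign σ : ℤ) • (List.ofFn fun a : Fin r => T a a (σ a)).prod

/-- Carry τ from the right end of T_0 ⋯ T_{r-1} to the left end and alternate the columns. The row
operators on one side and the column operators on the other both collapse by fusion, with the same
factors f_1 ⋯ f_{r-1}. What is left is (f_0 - κ) times det · τ on one side and τ · det on the other.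
-/
theorem ncDet_commutator [Algebra ℂ B]
    (h1 : ∀ i a b d e, T i a b * T (i + 1) d e + T i d b * T (i + 1) a e =
      T i a e * T (i + 1) d b + T i d e * T (i + 1) a b)
    (h2 : ∀ j a b d e, f j • (T j a b * τ d e - τ d e * T j a b) =
      κ • (T j d b * τ a e - τ d b * T j a e))
    (hf : ∀ i, f (i + 1) = f i + κ) (d e : Fin r) :
    (∏ i ∈ Finset.range (r - 1), f (i + 1)) •
      ((f 0 - κ) • (ncDet T * τ d e - τ d e * ncDet T)) = 0 := by
  obtain ⟨n, rfl⟩ : ∃ n, r = n + 1 := ⟨r - 1, by have := d.2; lia⟩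
  have hdet : altEval (K := K) e (wordProd T 0 (n + 1) (slots id d)) = ncDet T := by
    rw [altEval_apply]
    simp only [wordProd_slots]
    rfl
  have hF : ∀ α, altEval (K := K) e (word T τ (n + 1) 0 α) =
      altEval (K := K) e (wordProd T 0 (n + 1) α) * τ (α 0) e := by
    intro α
    rw [altEval_apply, altEval_apply, Finset.sum_mul]
    refine Finset.sum_congr rfl fun σ _ => ?_
    simp [word, wordProd, slots, mul_assoc]
  have hFs : ∀ i j (α : ℕ → Fin (n + 1)), i < n + 1 → j < n + 1 → i ≠ j →
      altEval (K := K) e (word T τ (n + 1) 0 (α ∘ Equiv.swap (i + 1) (j + 1))) =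
        -altEval (K := K) e (word T τ (n + 1) 0 α) := by
    intro i j α hi hj hij
    rw [hF, hF, altEval_wordProd_swap h1 e i j hi hj hij, neg_mul, Function.comp_apply,
      Equiv.swap_apply_of_ne_of_ne (by lia) (by lia)]
  have hL := exchDesc_of_antisymm hf (F := fun α => altEval (K := K) e (word T τ (n + 1) 0 α))
    hFs n 0 (by lia) (slots id d)
  have hR := exchAsc_of_antisymm hf (altEval (K := K) e)
    (fun i j Φ hi hj hij => altEval_swap_swap e i j Φ hi hj hij) n 0 (by lia)
    (word T τ 0 (n + 1) (slots id d))
  have hchain : altEval (K := K) e (exchDesc f κ (n + 1) 0 (word T τ (n + 1) 0) (slots id d)) =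
      altEval (K := K) e (exchAsc f κ (n + 1) 0 (word T τ 0 (n + 1) (slots id d))) := by
    congr 1
    funext β
    have := exchDesc_word h2 (n + 1) 0 (slots id d) β
    rwa [zero_add] at this
  rw [exchDesc_comp f κ (altEval (K := K) e) (n + 1) 0 (word T τ (n + 1) 0)] at hL
  have hchain := (hL.symm.trans hchain).trans hR
  -- Exchanging slot 0 with slot i + 1 repeats the row d if i ≠ d, so the term vanishes by
  -- antisymmetry; for i = d nothing changes.
  have hsum : ∑ i ∈ Finset.range (n + 1),
      altEval (K := K) e (word T τ (n + 1) 0 (slots id d ∘ Equiv.swap 0 (0 + i + 1))) =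
      ncDet T * τ d e := by
    rw [Finset.sum_eq_single_of_mem (d : ℕ) (Finset.mem_range.mpr d.2)]
    · have : slots id d ∘ Equiv.swap 0 (0 + (d : ℕ) + 1) = slots id d := by
        funext p
        rw [Function.comp_apply, Equiv.swap_apply_def, zero_add]
        split_ifs with h1 h2
        · rw [h1, slots_succ]; rfl
        · rw [h2, slots_succ]; rfl
        · rfl
      rw [this, hF, hdet]
      rfl
    · intro i hi hid
      rw [Finset.mem_range] at hi
      apply eq_zero_of_eq_neg
      rw [← hFs i d _ hi d.2 hid]
      congr 2
      funext p
      have hd : slots id d ((d : ℕ) + 1) = d := slots_succ _ _ _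
      have h0 : slots id d 0 = d := rfl
      simp only [Function.comp_apply, Equiv.swap_apply_def, zero_add]
      split_ifs <;> lia
  have hsumR := altEval_sum_swap (K := K) e (word T τ 0 (n + 1) (slots id d))
  have hR0 : altEval (K := K) e (word T τ 0 (n + 1) (slots id d)) = τ d e * ncDet T := by
    rw [← hdet, altEval_apply, altEval_apply, Finset.mul_sum]
    refine Finset.sum_congr rfl fun σ _ => ?_
    rw [mul_smul_comm]
    congr 1
    simp [word, wordProd, slots]
  simp only [zero_add] at hsum hchain
  rw [hsum, hsumR, hR0, hF, hdet] at hchain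
  simp only [Nat.add_sub_cancel]
  rw [← sub_eq_zero, ← smul_sub] at hchain
  have hsl : slots id d 0 = d := rfl
  rw [hsl] at hchain
  simp only [add_comm 1] at hchain
  rw [← hchain]
  congr 1
  module

end QuantumDeterminant


/-! ### The RTT relation as an identity of double power series. -/

section Exchange

set_option linter.unusedSectionVars false

open PowerSeries

variable {r : ℕ} {A : Type*} [Ring A] [Algebra ℂ A]

/-- The relation `f [T^{ab}, D^{de}] = κ (T^{db} D^{ae} - D^{db} T^{ae})`. -/
def ExchangeRel {B : Type*} [Ring B] (f κ : B) (T D : Fin r → Fin r → B) : Prop :=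
  ∀ a b d e, f * (T a b * D d e - D d e * T a b) = κ * (T d b * D a e - D d b * T a e)

/-- `(u - s - v) / (u v)` as a power series in the outer variable `v⁻¹` and the inner variable
`u⁻¹`. -/
def specDiff (A : Type*) [Ring A] [Algebra ℂ A] (s : ℂ) : PowerSeries (PowerSeries A) :=
  X - s • (C X * X) - C X

/-- `c / (u v)`. -/
def specConst (A : Type*) [Ring A] [Algebra ℂ A] (c : ℂ) : PowerSeries (PowerSeries A) :=
  c • (C X * X)

lemma coeff_smul_double (s : ℂ) (Z : PowerSeries (PowerSeries A)) (q : ℕ) :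
    coeff q (s • Z) = s • coeff q Z := rfl

lemma coeff_smul_single (s : ℂ) (Z : PowerSeries A) (q : ℕ) :
    coeff q (s • Z) = s • coeff q Z := rfl

lemma coeff_zero_specDiff_mul (s : ℂ) (Z : PowerSeries (PowerSeries A)) :
    coeff 0 (specDiff A s * Z) = -(X * coeff 0 Z) := by
  rw [specDiff, sub_mul, sub_mul, smul_mul_assoc, mul_assoc, map_sub, map_sub, coeff_smul_double,
    coeff_C_mul, coeff_zero_X_mul, coeff_C_mul]
  simp

lemma coeff_succ_specDiff_mul (s : ℂ) (Z : PowerSeries (PowerSeries A)) (q : ℕ) :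
    coeff (q + 1) (specDiff A s * Z) =
      coeff q Z - s • (X * coeff q Z) - X * coeff (q + 1) Z := by
  rw [specDiff, sub_mul, sub_mul, smul_mul_assoc, mul_assoc, map_sub, map_sub, coeff_smul_double,
    coeff_C_mul, coeff_succ_X_mul, coeff_C_mul]

lemma coeff_zero_specConst_mul (c : ℂ) (Z : PowerSeries (PowerSeries A)) :
    coeff 0 (specConst A c * Z) = 0 := by
  rw [specConst, smul_mul_assoc, mul_assoc, coeff_smul_double, coeff_C_mul, coeff_zero_X_mul]
  simp

lemma coeff_succ_specConst_mul (c : ℂ) (Z : PowerSeries (PowerSeries A)) (q : ℕ) :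
    coeff (q + 1) (specConst A c * Z) = c • (X * coeff q Z) := by
  rw [specConst, smul_mul_assoc, mul_assoc, coeff_smul_double, coeff_C_mul, coeff_succ_X_mul]

lemma coeff_C_mul_map_C (F G : PowerSeries A) (q : ℕ) :
    coeff q (C F * map C G) = F * C (coeff q G) := by rw [coeff_C_mul, coeff_map]

lemma coeff_map_C_mul_C (F G : PowerSeries A) (q : ℕ) :
    coeff q (map C G * C F) = C (coeff q G) * F := by rw [coeff_mul_C, coeff_map]

/-- Dividing by u v shifts both degrees by one. The coefficients at the boundary are not covered by
`h`; they hold because the constant terms δ_ab are central. -/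
lemma exchangeRel_of_coeff {c : ℂ} {T : Fin r → Fin r → PowerSeries A}
    (h0 : ∀ a b, coeff 0 (T a b) = if a = b then 1 else 0)
    (h : ∀ a b d e p q,
      (coeff (p + 1) (T a b) * coeff q (T d e) - coeff q (T d e) * coeff (p + 1) (T a b)) -
        (coeff p (T a b) * coeff (q + 1) (T d e) - coeff (q + 1) (T d e) * coeff p (T a b)) =
      c • (coeff p (T d b) * coeff q (T a e) - coeff q (T d b) * coeff p (T a e))) :
    ExchangeRel (specDiff A 0) (specConst A c) (fun a b => C (T a b)) (fun a b => map C (T a b)) := by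
  have hcomm : ∀ a b (x : A), coeff 0 (T a b) * x = x * coeff 0 (T a b) := by
    intro a b x
    rw [h0]
    split_ifs <;> simp
  intro a b d e
  ext q p
  rcases q with _ | q
  · rw [coeff_zero_specDiff_mul, coeff_zero_specConst_mul, map_sub, coeff_C_mul_map_C,
      coeff_map_C_mul_C]
    have : T a b * C (coeff 0 (T d e)) = C (coeff 0 (T d e)) * T a b := by
      ext l
      rw [coeff_mul_C, coeff_C_mul, hcomm]
    rw [this, sub_self, mul_zero, neg_zero]
  · rw [coeff_succ_specDiff_mul, coeff_succ_specConst_mul]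
    simp only [map_sub, coeff_C_mul_map_C, coeff_map_C_mul_C, zero_smul, sub_zero]
    rcases p with _ | p
    · rw [coeff_zero_X_mul, coeff_smul_single, coeff_zero_X_mul, coeff_mul_C, coeff_C_mul, hcomm]
      simp
    · rw [coeff_smul_single, coeff_succ_X_mul, coeff_succ_X_mul]
      simp only [map_sub, coeff_mul_C, coeff_C_mul]
      exact h a b d e p q

lemma coeff_of_exchangeRel {c : ℂ} {T : Fin r → Fin r → PowerSeries A}
    (h : ExchangeRel (specDiff A 0) (specConst A c) (fun a b => C (T a b))
      (fun a b => map C (T a b))) (a b d e : Fin r) (p q : ℕ) :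
    (coeff (p + 1) (T a b) * coeff q (T d e) - coeff q (T d e) * coeff (p + 1) (T a b)) -
        (coeff p (T a b) * coeff (q + 1) (T d e) - coeff (q + 1) (T d e) * coeff p (T a b)) =
      c • (coeff p (T d b) * coeff q (T a e) - coeff q (T d b) * coeff p (T a e)) := by
  have := congrArg (fun Z => coeff (p + 1) (coeff (q + 1) Z)) (h a b d e)
  dsimp only at this
  rw [coeff_succ_specDiff_mul, coeff_succ_specConst_mul] at this
  simp only [map_sub, coeff_C_mul_map_C, coeff_map_C_mul_C, zero_smul, sub_zero] at this
  rw [coeff_smul_single, coeff_succ_X_mul, coeff_succ_X_mul] at this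
  simpa only [map_sub, coeff_mul_C, coeff_C_mul] using this

/-- The shift as a ring homomorphism. -/
def shiftHom (A : Type*) [Ring A] [Algebra ℂ A] (s : ℂ) : PowerSeries A →+* PowerSeries A where
  toFun := shift s
  map_one' := by rw [← map_one C, shift_C]
  map_mul' := shift_mul s
  map_zero' := by rw [← map_zero C, shift_C]
  map_add' := shift_add s

lemma smul_eq_mul_X (s : ℂ) (Z : PowerSeries A) : s • Z = C (algebraMap ℂ A s) * Z := by
  ext l
  rw [coeff_smul_single, coeff_C_mul, Algebra.smul_def]

lemma one_sub_mul_shift_X (s : ℂ) :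
    (1 - s • X) * shift s (X : PowerSeries A) = X := by
  have := congrArg (map (algebraMap ℂ A)) (one_sub_mul_shiftVar s)
  rw [shift_X, smul_eq_mul_X]
  simpa using this

/-- The shift is applied in the inner variable u⁻¹ only; multiplying by 1 - s u⁻¹ clears the
denominator of the shifted u⁻¹. -/
lemma exchangeRel_shift {c : ℂ} {T : Fin r → Fin r → PowerSeries A}
    (h : ExchangeRel (specDiff A 0) (specConst A c) (fun a b => C (T a b))
      (fun a b => map C (T a b))) (s : ℂ) :
    ExchangeRel (specDiff A s) (specConst A c) (fun a b => C (shift s (T a b)))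
      (fun a b => map C (T a b)) := by
  intro a b d e
  have h1 := congrArg (map (shiftHom A s)) (h a b d e)
  have hmap : ∀ G : PowerSeries A, map (shiftHom A s) (map C G) = map C G := by
    intro G
    ext l : 1
    rw [coeff_map, coeff_map]
    exact shift_C s _
  have hC : ∀ F : PowerSeries A, map (shiftHom A s) (C F) = C (shift s F) := fun F => map_C _ _
  have hd : map (shiftHom A s) (specDiff A 0) = X - C (shift s X) := by
    rw [specDiff, zero_smul, sub_zero, map_sub, map_X, hC]
  have hc : map (shiftHom A s) (specConst A c) = c • (C (shift s X) * X) := by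
    ext l : 1
    rw [specConst, coeff_map, coeff_smul_double, coeff_smul_double, coeff_C_mul, coeff_C_mul]
    change shift s _ = _
    rw [shift_smul, shift_mul, coeff_X]
    congr 2
    split_ifs
    · exact map_one (shiftHom A s)
    · exact map_zero (shiftHom A s)
  simp only [map_mul, map_sub, hd, hc, hC, hmap] at h1
  have h2 := congrArg (C (1 - s • X) * ·) h1
  have e1 : C (1 - s • X) * (X - C (shift s X)) = specDiff A s := by
    rw [mul_sub, ← map_mul, one_sub_mul_shift_X, specDiff, map_sub, sub_mul, map_one, one_mul]
    congr 2
    ext l : 1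
    rw [coeff_C_mul, coeff_smul_double, coeff_C_mul, smul_mul_assoc]
  have e2 : C (1 - s • X) * c • (C (shift s X) * X) = specConst A c := by
    rw [mul_smul_comm, ← mul_assoc, ← map_mul, one_sub_mul_shift_X, specConst]
  rwa [← mul_assoc, ← mul_assoc, e1, e2] at h2

/-- The specialisation `v = u`. -/
def specialize (Z : PowerSeries (PowerSeries A)) : PowerSeries A :=
  mk fun l => ∑ p ∈ Finset.HasAntidiagonal.antidiagonal l, coeff p.1 (coeff p.2 Z)

lemma coeff_specialize (Z : PowerSeries (PowerSeries A)) (l : ℕ) : coeff l (specialize Z) =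
    ∑ p ∈ Finset.HasAntidiagonal.antidiagonal l, coeff p.1 (coeff p.2 Z) := coeff_mk _ _

lemma specialize_sub (Z W : PowerSeries (PowerSeries A)) :
    specialize (Z - W) = specialize Z - specialize W := by
  ext l
  simp only [map_sub, coeff_specialize, Finset.sum_sub_distrib]

lemma specialize_smul (s : ℂ) (Z : PowerSeries (PowerSeries A)) :
    specialize (s • Z) = s • specialize Z := by
  ext l
  rw [coeff_smul_single]
  simp only [coeff_specialize, coeff_smul_single, Finset.smul_sum]

lemma specialize_C_mul_map_C (F G : PowerSeries A) : specialize (C F * map C G) = F * G := by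
  ext l
  rw [coeff_specialize, coeff_mul]
  refine Finset.sum_congr rfl fun p _ => ?_
  rw [coeff_C_mul_map_C, coeff_mul_C]

lemma specialize_map_C_mul_C (F G : PowerSeries A) : specialize (map C G * C F) = G * F := by
  ext l
  rw [coeff_specialize, coeff_mul, ← Finset.Nat.sum_antidiagonal_swap]
  refine Finset.sum_congr rfl fun p _ => ?_
  rw [coeff_map_C_mul_C, coeff_C_mul]
  rfl

lemma specialize_X_mul (Z : PowerSeries (PowerSeries A)) :
    specialize (X * Z) = X * specialize Z := by
  ext l
  rw [coeff_specialize]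
  rcases l with _ | l
  · simp
  · rw [Finset.Nat.sum_antidiagonal_succ', coeff_succ_X_mul, coeff_specialize]
    simp [coeff_succ_X_mul]

lemma specialize_C_X_mul (Z : PowerSeries (PowerSeries A)) :
    specialize (C X * Z) = X * specialize Z := by
  ext l
  rw [coeff_specialize]
  rcases l with _ | l
  · simp
  · rw [Finset.Nat.sum_antidiagonal_succ, coeff_succ_X_mul, coeff_specialize]
    simp [coeff_succ_X_mul, coeff_C_mul]

/-- At v = u the factor u - c - v equals -c, the value at which the R-matrix degenerates. The common
factor c u⁻² is then cancelled, which needs c ≠ 0. -/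
lemma shift_exchange {c : ℂ} (hc : c ≠ 0) {F G : Fin r → Fin r → PowerSeries A}
    (h : ExchangeRel (specDiff A c) (specConst A c) (fun a b => C (F a b))
      (fun a b => map C (G a b))) (a b d e : Fin r) :
    F a b * G d e + F d b * G a e = G d e * F a b + G d b * F a e := by
  have h1 := congrArg specialize (h a b d e)
  have e1 : ∀ Z : PowerSeries (PowerSeries A),
      specialize (specDiff A c * Z) = -(c • (X * (X * specialize Z))) := by
    intro Z
    rw [specDiff, sub_mul, sub_mul, smul_mul_assoc, mul_assoc, specialize_sub, specialize_sub,
      specialize_smul, specialize_C_X_mul, specialize_C_X_mul, specialize_X_mul]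
    abel
  have e2 : ∀ Z : PowerSeries (PowerSeries A),
      specialize (specConst A c * Z) = c • (X * (X * specialize Z)) := by
    intro Z
    rw [specConst, smul_mul_assoc, mul_assoc, specialize_smul, specialize_C_X_mul, specialize_X_mul]
  rw [e1, e2, specialize_sub, specialize_sub, specialize_C_mul_map_C, specialize_map_C_mul_C,
    specialize_C_mul_map_C, specialize_map_C_mul_C, neg_eq_iff_add_eq_zero, ← smul_add, ← mul_add,
    ← mul_add] at h1
  have h2 := (smul_eq_zero.mp h1).resolve_left hc
  rw [← mul_zero X] at h2
  have h3 := X_mul_cancel h2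
  rw [← mul_zero X] at h3
  have h4 := X_mul_cancel h3
  rw [← sub_eq_zero, ← h4]
  abel

/-- The constant term in v⁻¹ of the factor is -u⁻¹, so the coefficients of Z vanish one after
another. -/
lemma specDiff_mul_eq_zero {s : ℂ} {Z : PowerSeries (PowerSeries A)} (h : specDiff A s * Z = 0) :
    Z = 0 := by
  ext q : 1
  rw [map_zero]
  induction q with
  | zero =>
    have := congrArg (coeff 0) h
    rw [coeff_zero_specDiff_mul, map_zero, neg_eq_zero, ← mul_zero X] at this
    exact X_mul_cancel this
  | succ q ih =>
    have := congrArg (coeff (q + 1)) h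
    rw [coeff_succ_specDiff_mul, map_zero, ih, mul_zero, smul_zero, sub_zero, zero_sub, neg_eq_zero,
      ← mul_zero X] at this
    exact X_mul_cancel this

lemma C_X_mul_comm (Z : PowerSeries (PowerSeries A)) : C X * Z = Z * C X := by
  ext q : 1
  rw [coeff_C_mul, coeff_mul_C, X_mul]

lemma smul_C_X_mul_mem_center (s : ℂ) :
    s • (C X * X : PowerSeries (PowerSeries A)) ∈ Subring.center (PowerSeries (PowerSeries A)) := by
  rw [Subring.mem_center_iff]
  intro Z
  rw [mul_smul_comm, smul_mul_assoc, mul_assoc, X_mul, C_X_mul_comm, C_X_mul_comm, mul_assoc]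

lemma specDiff_mem_center (s : ℂ) :
    specDiff A s ∈ Subring.center (PowerSeries (PowerSeries A)) := by
  refine sub_mem (sub_mem ?_ (smul_C_X_mul_mem_center s)) ?_
  · rw [Subring.mem_center_iff]
    exact fun Z => X_mul.symm
  · rw [Subring.mem_center_iff]
    exact fun Z => (C_X_mul_comm Z).symm

/-- The quantum determinant of a matrix of power series. -/
def qdetSeries (c : ℂ) (T : Fin r → Fin r → PowerSeries A) : PowerSeries A :=
  ncDet fun i a b => shift (c * ((r : ℂ) - 1 - (i : ℕ))) (T a b)

/-- The shifts c (r - 1 - i) decrease by c. This produces both hypotheses of `ncDet_commutator`: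
neighbouring letters sit at the degenerate point, and f_{i+1} = f_i + κ. The scalars live in the
centre of the ring of double series, and the factors f_i are not zero divisors. -/
theorem qdetSeries_commute {c : ℂ} (hc : c ≠ 0) {T : Fin r → Fin r → PowerSeries A}
    (h : ExchangeRel (specDiff A 0) (specConst A c) (fun a b => C (T a b))
      (fun a b => map C (T a b))) (d e : Fin r) (n q : ℕ) :
    coeff n (qdetSeries c T) * coeff q (T d e) = coeff q (T d e) * coeff n (qdetSeries c T) := by
  let s : ℕ → ℂ := fun i => c * ((r : ℂ) - 1 - i)
  have hs : ∀ i, s (i + 1) + c = s i := by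
    intro i
    simp only [s]
    push_cast
    ring
  let f : ℕ → Subring.center (PowerSeries (PowerSeries A)) :=
    fun i => ⟨specDiff A (s i), specDiff_mem_center _⟩
  let κ : Subring.center (PowerSeries (PowerSeries A)) :=
    ⟨specConst A c, smul_C_X_mul_mem_center c⟩
  have hκ : ∀ t : ℂ, specDiff A t = specDiff A (t + c) + specConst A c := by
    intro t
    simp only [specDiff, specConst, add_smul]
    abel
  have hf : ∀ i, f (i + 1) = f i + κ := by
    intro i
    ext1
    change specDiff A (s (i + 1)) = specDiff A (s i) + specConst A c
    rw [hκ, hs]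
  have hexch := shift_exchange hc (exchangeRel_shift h c)
  have h1 : ∀ i a b d e, shift (s i) (T a b) * shift (s (i + 1)) (T d e) +
      shift (s i) (T d b) * shift (s (i + 1)) (T a e) =
      shift (s i) (T a e) * shift (s (i + 1)) (T d b) +
      shift (s i) (T d e) * shift (s (i + 1)) (T a b) := by
    intro i a b d e
    -- The right side of `hexch` is unchanged under b ↔ e up to the order of its summands, so the
    -- left side is symmetric in the columns.
    have := (hexch a b d e).trans ((add_comm _ _).trans (hexch a e d b).symm)
    have := congrArg (shift (s (i + 1))) this
    simpa only [shift_add, shift_mul, shift_shift, hs] using this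
  have key := ncDet_commutator (K := Subring.center (PowerSeries (PowerSeries A)))
    (T := fun i a b => C (shift (s i) (T a b))) (τ := fun a b => map C (T a b)) (f := f) (κ := κ)
    (fun i a b d e => by simpa only [map_add, map_mul] using congrArg C (h1 i a b d e))
    (fun j => exchangeRel_shift h (s j)) hf d e
  have hnz : ∀ (t : ℂ) (Z : PowerSeries (PowerSeries A)) (g : Subring.center (PowerSeries (PowerSeries A))),
      (g : PowerSeries (PowerSeries A)) = specDiff A t → g • Z = 0 → Z = 0 := by
    intro t Z g hg hZ
    rw [Subring.smul_def, hg, smul_eq_mul] at hZ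
    exact specDiff_mul_eq_zero hZ
  have hprod : ∀ (n : ℕ) (Z : PowerSeries (PowerSeries A)),
      (∏ i ∈ Finset.range n, f (i + 1)) • Z = 0 → Z = 0 := by
    intro n
    induction n with
    | zero => intro Z hZ; simpa using hZ
    | succ n ih =>
      intro Z hZ
      rw [Finset.prod_range_succ, mul_smul] at hZ
      exact hnz _ _ _ rfl (ih _ hZ)
  -- The factor f_0 - κ is again of the form `specDiff`, with shift s_0 + c, and can be cancelled
  -- too.
  have key1 := hnz (s 0 + c) _ _ (by
    change specDiff A (s 0) - specConst A c = _
    rw [hκ (s 0), add_sub_cancel_right]) (hprod _ _ key)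
  have hdet : ncDet (fun i a b => C (shift (s i) (T a b))) = C (qdetSeries c T) := by
    simp only [ncDet, qdetSeries, map_sum, map_zsmul, map_list_prod, List.map_ofFn]
    rfl
  rw [hdet, sub_eq_zero] at key1
  have key2 := congrArg (fun Z => coeff n (coeff q Z)) key1
  rwa [coeff_C_mul_map_C, coeff_map_C_mul_C, coeff_mul_C, coeff_C_mul] at key2

end Exchange


/-! ## The monodromy matrix of a spin chain -/

section Monodromy

open PowerSeries

set_option linter.unusedSectionVars false

/-- Products of matrices of mutually commuting entries satisfy the exchange relation if the factors
do. -/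
lemma ExchangeRel.mul {r : ℕ} {B : Type*} [Ring B] {f κ : B} {T₁ D₁ T₂ D₂ : Fin r → Fin r → B}
    (hf : ∀ x, f * x = x * f) (hκ : ∀ x, κ * x = x * κ)
    (h₁ : ExchangeRel f κ T₁ D₁) (h₂ : ExchangeRel f κ T₂ D₂)
    (hTD : ∀ a b d e, T₂ a b * D₁ d e = D₁ d e * T₂ a b)
    (hDT : ∀ a b d e, D₂ a b * T₁ d e = T₁ d e * D₂ a b) :
    ExchangeRel f κ (fun a b => ∑ x, T₁ a x * T₂ x b) (fun a b => ∑ x, D₁ a x * D₂ x b) := by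
  intro a b d e
  have hs : ∀ (P Q R S : Fin r → B),
      (∑ x, P x * Q x) * (∑ y, R y * S y) = ∑ x, ∑ y, P x * Q x * (R y * S y) := by
    intro P Q R S
    rw [Finset.sum_mul_sum]
  -- The left factors are exchanged first, then the right ones. After x and y are interchanged in
  -- the second term, the two mixed products D₁ T₁ T₂ D₂ cancel.
  have hl : ∀ x y, f * (T₁ a x * T₂ x b * (D₁ d y * D₂ y e) - D₁ d y * D₂ y e * (T₁ a x * T₂ x b)) =
      κ * ((T₁ d x * D₁ a y - D₁ d x * T₁ a y) * (T₂ x b * D₂ y e)) +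
        κ * (D₁ d y * T₁ a x * (T₂ y b * D₂ x e - D₂ y b * T₂ x e)) := by
    intro x y
    have e1 : T₁ a x * T₂ x b * (D₁ d y * D₂ y e) = T₁ a x * D₁ d y * (T₂ x b * D₂ y e) := by
      rw [mul_assoc, ← mul_assoc (T₂ x b), hTD]
      simp only [mul_assoc]
    have e2 : D₁ d y * D₂ y e * (T₁ a x * T₂ x b) = D₁ d y * T₁ a x * (D₂ y e * T₂ x b) := by
      rw [mul_assoc, ← mul_assoc (D₂ y e), hDT]
      simp only [mul_assoc]
    have e3 := h₁ a x d y
    have e4 := h₂ x b y e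
    rw [e1, e2]
    have : T₁ a x * D₁ d y * (T₂ x b * D₂ y e) - D₁ d y * T₁ a x * (D₂ y e * T₂ x b) =
        (T₁ a x * D₁ d y - D₁ d y * T₁ a x) * (T₂ x b * D₂ y e) +
          D₁ d y * T₁ a x * (T₂ x b * D₂ y e - D₂ y e * T₂ x b) := by noncomm_ring
    rw [this, mul_add, ← mul_assoc f, e3, ← mul_assoc f (D₁ d y * T₁ a x), hf, mul_assoc _ f, e4,
      ← mul_assoc _ κ, ← hκ, mul_assoc, mul_assoc]
  simp only [hs]
  rw [Finset.sum_comm (f := fun x y => D₁ d x * D₂ x e * (T₁ a y * T₂ y b)),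
    ← Finset.sum_sub_distrib, ← Finset.sum_sub_distrib, Finset.mul_sum, Finset.mul_sum]
  simp only [← Finset.sum_sub_distrib, Finset.mul_sum, hl]
  simp only [Finset.sum_add_distrib]
  rw [Finset.sum_comm (f := fun x y => κ * (D₁ d y * T₁ a x * _)), ← Finset.sum_add_distrib]
  refine Finset.sum_congr rfl fun x _ => ?_
  rw [← Finset.sum_add_distrib]
  refine Finset.sum_congr rfl fun y _ => ?_
  have e1 : T₁ d x * T₂ x b * (D₁ a y * D₂ y e) = T₁ d x * D₁ a y * (T₂ x b * D₂ y e) := by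
    rw [mul_assoc, ← mul_assoc (T₂ x b), hTD]
    simp only [mul_assoc]
  have e2 : D₁ d x * D₂ x b * (T₁ a y * T₂ y e) = D₁ d x * T₁ a y * (D₂ x b * T₂ y e) := by
    rw [mul_assoc, ← mul_assoc (D₂ x b), hDT]
    simp only [mul_assoc]
  rw [e1, e2, ← mul_add]
  congr 1
  noncomm_ring

variable {N r : ℕ} {A : Type*} [Ring A] [Algebra ℂ A]

/-- Families of matrix units at commuting sites, with commuting parameters. -/
structure IsSpinChain (E : Fin N → Fin r → Fin r → A) (y : Fin N → A) : Prop where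
  unit_mul : ∀ i a b d e, E i a b * E i d e = if b = d then E i a e else 0
  unit_comm : ∀ i j a b d e, i ≠ j → Commute (E i a b) (E j d e)
  par_unit : ∀ i j a b, Commute (y i) (E j a b)
  par_comm : ∀ i j, Commute (y i) (y j)

/-- The expansion of `(u - y)⁻¹`. -/
def resolvent (y : A) : PowerSeries A := mk fun n => if n = 0 then 0 else y ^ (n - 1)

lemma resolvent_eq (y : A) : resolvent y = X + C y * (X * resolvent y) := by
  ext n
  rcases n with _ | _ | n
  · simp [resolvent]
  · simp [resolvent, coeff_C_mul, coeff_succ_X_mul]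
  · simp [resolvent, coeff_C_mul, coeff_succ_X_mul, pow_succ', coeff_X]

lemma commute_C_resolvent {x y : A} (h : Commute x y) : Commute (C x) (resolvent y) := by
  ext n
  rw [coeff_C_mul, coeff_mul_C, resolvent, coeff_mk]
  split_ifs
  · simp
  · exact h.pow_right _

lemma commute_C_iff {x : A} {F : PowerSeries A} :
    Commute (C x) F ↔ ∀ n, Commute x (coeff n F) := by
  constructor
  · intro h n
    have := congrArg (coeff n) h.eq
    rwa [coeff_C_mul, coeff_mul_C] at this
  · intro h
    ext n
    rw [coeff_C_mul, coeff_mul_C, (h n).eq]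

/-- The `L`-operator at the site `i`. -/
def lax (c : ℂ) (E : Fin N → Fin r → Fin r → A) (y : Fin N → A) (i : Fin N) (a b : Fin r) :
    PowerSeries A :=
  (if a = b then 1 else 0) + c • (C (E i a b) * resolvent (y i))

/-- The monodromy matrix of the first `n` sites. -/
def mono (c : ℂ) (E : Fin N → Fin r → Fin r → A) (y : Fin N → A) :
    ℕ → Fin r → Fin r → PowerSeries A
  | 0 => fun a b => if a = b then 1 else 0
  | n + 1 => fun a b => if h : n < N then ∑ x, lax c E y ⟨n, h⟩ a x * mono c E y n x b
      else mono c E y n a b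

variable {c : ℂ} {E : Fin N → Fin r → Fin r → A} {y : Fin N → A}

lemma mono_succ (h : IsSpinChain E y) {n : ℕ} (hn : n < N) (a b : Fin r) :
    mono c E y (n + 1) a b = mono c E y n a b +
      resolvent (y ⟨n, hn⟩) * (c • ∑ x, C (E ⟨n, hn⟩ a x) * mono c E y n x b) := by
  have hc : ∀ x, C (E ⟨n, hn⟩ a x) * resolvent (y ⟨n, hn⟩) =
      resolvent (y ⟨n, hn⟩) * C (E ⟨n, hn⟩ a x) :=
    fun x => commute_C_resolvent (h.par_unit _ _ _ _).symm
  rw [mono]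
  simp only [dif_pos hn, lax, add_mul, Finset.sum_add_distrib, hc, ite_mul, one_mul, zero_mul,
    Finset.sum_ite_eq, Finset.mem_univ, if_true, smul_mul_assoc, mul_assoc]
  rw [← Finset.smul_sum, ← Finset.mul_sum, mul_smul_comm]

lemma commute_C_mono {x : A} {n : ℕ} (hE : ∀ i : Fin N, (i : ℕ) < n → ∀ a b, Commute x (E i a b))
    (hy : ∀ i : Fin N, (i : ℕ) < n → Commute x (y i)) (a b : Fin r) :
    Commute (C x) (mono c E y n a b) := by
  induction n generalizing a b with
  | zero =>
    simp only [mono]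
    split_ifs
    · exact Commute.one_right _
    · exact Commute.zero_right _
  | succ n ih =>
    have ih := ih (fun i hi => hE i (by lia)) (fun i hi => hy i (by lia))
    rw [mono]
    split_ifs with hn
    · refine Commute.sum_right _ _ _ fun z _ => Commute.mul_right ?_ (ih z b)
      rw [lax]
      refine Commute.add_right ?_ (Commute.smul_right (Commute.mul_right ?_ ?_) c)
      · split_ifs
        · exact Commute.one_right _
        · exact Commute.zero_right _
      · exact (hE ⟨n, hn⟩ (by simp) a z).map C
      · exact commute_C_resolvent (hy ⟨n, hn⟩ (by simp))
    · exact ih a b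

lemma coeff_zero_mono (h : IsSpinChain E y) (n : ℕ) (a b : Fin r) :
    coeff 0 (mono c E y n a b) = if a = b then 1 else 0 := by
  induction n generalizing a b with
  | zero =>
    simp only [mono]
    split_ifs <;> simp
  | succ n ih =>
    by_cases hn : n < N
    · rw [mono_succ h hn, map_add, ih, coeff_mul]
      simp [resolvent]
    · rw [mono]
      simp only [dif_neg hn, ih]

lemma coeff_succ_resolvent_mul (z : A) (F : PowerSeries A) (k : ℕ) :
    coeff (k + 1) (resolvent z * F) = coeff k F + z * coeff k (resolvent z * F) := by
  conv_lhs => rw [resolvent_eq, add_mul, mul_assoc, mul_assoc, map_add, coeff_C_mul,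
    coeff_succ_X_mul, coeff_succ_X_mul]

/-- This is `mono_succ` with the denominator u - y_n cleared. The recursion serves twice: for
leading terms in the parameters and for the comparison with the operators D_i. -/
lemma coeff_succ_mono (h : IsSpinChain E y) {n : ℕ} (hn : n < N) (a b : Fin r) (k : ℕ) :
    coeff (k + 1) (mono c E y (n + 1) a b) - coeff (k + 1) (mono c E y n a b) =
      y ⟨n, hn⟩ * (coeff k (mono c E y (n + 1) a b) - coeff k (mono c E y n a b)) +
        c • ∑ x, E ⟨n, hn⟩ a x * coeff k (mono c E y n x b) := by
  have e : ∀ k, coeff k (mono c E y (n + 1) a b) - coeff k (mono c E y n a b) =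
      coeff k (resolvent (y ⟨n, hn⟩) * (c • ∑ x, C (E ⟨n, hn⟩ a x) * mono c E y n x b)) := by
    intro k
    rw [mono_succ h hn, map_add, add_sub_cancel_left]
  rw [e, e, coeff_succ_resolvent_mul, coeff_smul_single, map_sum, add_comm]
  simp only [coeff_C_mul]

/-! ### The exchange relation -/

lemma commute_C_map_C {F G : PowerSeries A} (h : ∀ p, Commute (C (coeff p F)) G) :
    (C F * map C G : PowerSeries (PowerSeries A)) = map C G * C F := by
  ext q p
  rw [coeff_C_mul_map_C, coeff_map_C_mul_C, coeff_mul_C, coeff_C_mul]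
  exact commute_C_iff.mp (h p) q

/-- The evaluation representation at y_i: the coefficients are c E^{ab} y_i^n, so the matrix unit
relations suffice. -/
lemma exchangeRel_lax (h : IsSpinChain E y) (i : Fin N) :
    ExchangeRel (specDiff A 0) (specConst A c) (fun a b => C (lax c E y i a b))
      (fun a b => map C (lax c E y i a b)) := by
  have hc : ∀ n a b, coeff (n + 1) (lax c E y i a b) = c • (E i a b * y i ^ n) := by
    intro n a b
    rw [lax, map_add, coeff_smul_single, coeff_C_mul]
    have : coeff (n + 1) (if a = b then (1 : PowerSeries A) else 0) = 0 := by
      split_ifs <;> simp [coeff_one]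
    rw [this, zero_add]
    simp [resolvent]
  have hc0 : ∀ a b, coeff 0 (lax c E y i a b) = if a = b then 1 else 0 := by
    intro a b
    rw [lax, map_add, coeff_smul_single, coeff_C_mul]
    split_ifs <;> simp [resolvent]
  have hm : ∀ m n a b d e, E i a b * y i ^ m * (E i d e * y i ^ n) =
      if b = d then E i a e * y i ^ (m + n) else 0 := by
    intro m n a b d e
    rw [mul_assoc, ← mul_assoc (y i ^ m), ((h.par_unit i i d e).pow_left m).eq, mul_assoc, ← pow_add,
      ← mul_assoc, h.unit_mul]
    split_ifs <;> simp
  refine exchangeRel_of_coeff hc0 fun a b d e p q => ?_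
  rcases p with _ | p <;> rcases q with _ | q
  case succ.succ =>
    have e1 : p + 1 + q = p + (q + 1) := by lia
    have e2 : q + (p + 1) = p + (q + 1) := by lia
    have e3 : q + 1 + p = p + (q + 1) := by lia
    have e4 : q + p = p + q := by lia
    simp only [hc, smul_mul_smul_comm, hm, eq_comm (a := e) (b := a), e1, e2, e3, e4]
    split_ifs <;> module
  all_goals
    simp only [hc, hc0, smul_mul_smul_comm, hm, ite_mul, mul_ite, one_mul, zero_mul, mul_one,
      mul_zero, eq_comm (a := d) (b := b), eq_comm (a := e) (b := a), zero_add, add_zero]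
    by_cases h1 : b = d <;> by_cases h2 : a = e <;>
    try simp only [h1, h2, if_true, if_false]
  all_goals module

/-- The L-operator of a new site commutes entrywise with the monodromy matrix of the earlier ones,
so `ExchangeRel.mul` applies. -/
lemma exchangeRel_mono (h : IsSpinChain E y) (n : ℕ) :
    ExchangeRel (specDiff A 0) (specConst A c) (fun a b => C (mono c E y n a b))
      (fun a b => map C (mono c E y n a b)) := by
  have hf := fun x => ((Subring.mem_center_iff.mp (specDiff_mem_center (A := A) 0)) x).symm
  have hκ := fun x => ((Subring.mem_center_iff.mp (smul_C_X_mul_mem_center (A := A) c)) x).symm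
  induction n with
  | zero =>
    intro a b d e
    simp only [mono]
    split_ifs <;> simp
  | succ n ih =>
    by_cases hn : n < N
    · have hEm : ∀ a b d e, Commute (C (E ⟨n, hn⟩ a b)) (mono c E y n d e) := fun a b d e =>
        commute_C_mono (fun i hi _ _ => h.unit_comm _ _ _ _ _ _ (by rintro rfl; simp at hi))
          (fun i _ => (h.par_unit _ _ _ _).symm) d e
      have hym : ∀ d e, Commute (C (y ⟨n, hn⟩)) (mono c E y n d e) := fun d e =>
        commute_C_mono (fun i hi _ _ => h.par_unit _ _ _ _) (fun i _ => h.par_comm _ _) d e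
      have hLm : ∀ p a b d e, Commute (C (coeff p (lax c E y ⟨n, hn⟩ a b))) (mono c E y n d e) := by
        intro p a b d e
        rw [lax, map_add, coeff_smul_single, coeff_C_mul, resolvent, coeff_mk, map_add]
        refine Commute.add_left ?_ ?_
        · split_ifs
          · rw [coeff_one]
            split_ifs
            · rw [map_one]; exact Commute.one_left _
            · rw [map_zero]; exact Commute.zero_left _
          · rw [map_zero, map_zero]; exact Commute.zero_left _
        · have hsm : ∀ x : A, C (c • x) = c • C x := by
            intro x
            ext l
            rw [coeff_smul_single, coeff_C, coeff_C]
            split_ifs <;> simp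
          rw [hsm, map_mul]
          refine (Commute.mul_left (hEm _ _ _ _) ?_).smul_left c
          split_ifs
          · rw [map_zero]; exact Commute.zero_left _
          · rw [map_pow]; exact (hym _ _).pow_left _
      have hmL : ∀ p a b d e, Commute (C (coeff p (mono c E y n d e))) (lax c E y ⟨n, hn⟩ a b) := by
        intro p a b d e
        rw [commute_C_iff]
        intro q
        exact (commute_C_iff.mp (hLm q a b d e) p).symm
      have := ExchangeRel.mul (κ := specConst A c) hf hκ (exchangeRel_lax (c := c) h ⟨n, hn⟩) ih
        (fun a b d e => commute_C_map_C fun p => hmL p d e a b)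
        (fun a b d e => (commute_C_map_C fun p => hLm p d e a b).symm)
      intro a b d e
      simpa only [mono, dif_pos hn, map_sum, map_mul] using this a b d e
    · intro a b d e
      simpa only [mono, dif_neg hn] using ih a b d e

end Monodromy


/-! ## The centre of the Yangian -/

section Yangian

open PowerSeries

lemma isCommSub_adjoin {A : Type*} [Semiring A] [Algebra ℂ A] {s : Set A}
    (h : ∀ x ∈ s, ∀ y ∈ s, x * y = y * x) : IsCommSub (Algebra.adjoin ℂ s) := by
  have h1 : Algebra.adjoin ℂ s ≤ Subalgebra.centralizer ℂ s :=
    Algebra.adjoin_le fun x hx => Subalgebra.mem_centralizer_iff _ |>.2 fun y hy => h y hy x hx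
  have h2 : Algebra.adjoin ℂ s ≤ Subalgebra.centralizer ℂ (Algebra.adjoin ℂ s : Set A) :=
    Algebra.adjoin_le fun x hx => Subalgebra.mem_centralizer_iff _ |>.2 fun y hy =>
      (Subalgebra.mem_centralizer_iff _ |>.1 (h1 hy) x hx).symm
  exact fun x hx y hy => (Subalgebra.mem_centralizer_iff _ |>.1 (h2 hy) x hx)

lemma IsCommSub.map {A B : Type*} [Semiring A] [Algebra ℂ A] [Semiring B] [Algebra ℂ B]
    {S : Subalgebra ℂ A} (h : IsCommSub S) (f : A →ₐ[ℂ] B) : IsCommSub (S.map f) := by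
  rintro _ ⟨x, hx, rfl⟩ _ ⟨y, hy, rfl⟩
  change f x * f y = f y * f x
  rw [← map_mul, ← map_mul, h x hx y hy]

/-- Adjoining the centre to a commutative subalgebra keeps it commutative. -/
lemma center_le_of_maximal {A : Type*} [Semiring A] [Algebra ℂ A] {B : Subalgebra ℂ A}
    (hB : Maximal IsCommSub B) : Subalgebra.center ℂ A ≤ B := by
  have h1 : IsCommSub (Algebra.adjoin ℂ ((B : Set A) ∪ Subalgebra.center ℂ A)) := by
    refine isCommSub_adjoin ?_
    rintro x (hx | hx) y (hy | hy)
    · exact hB.prop x hx y hy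
    · exact Subalgebra.mem_center_iff.1 hy x
    · exact (Subalgebra.mem_center_iff.1 hx y).symm
    · exact Subalgebra.mem_center_iff.1 hy x
  have h2 : B ≤ Algebra.adjoin ℂ ((B : Set A) ∪ Subalgebra.center ℂ A) :=
    fun x hx => Algebra.subset_adjoin (Or.inl hx)
  exact fun x hx => hB.le_of_ge h1 h2 (Algebra.subset_adjoin (Or.inr hx))

variable {r : ℕ} {c : ℂ}

lemma tcoef_zero (a b : Fin r) : tcoef c a b 0 = if a = b then 1 else 0 := by
  simp only [tcoef, freeT]
  split_ifs <;> simp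

lemma adjoin_tcoef : Algebra.adjoin ℂ
    (Set.range fun x : Fin r × Fin r × ℕ => tcoef c x.1 x.2.1 (x.2.2 + 1)) = ⊤ := by
  rw [eq_top_iff]
  rintro z -
  obtain ⟨w, rfl⟩ := RingQuot.mkAlgHom_surjective ℂ (RTT r c) z
  induction w using FreeAlgebra.induction with
  | grade0 s =>
    rw [AlgHom.commutes]
    exact Subalgebra.algebraMap_mem _ _
  | grade1 x => exact Algebra.subset_adjoin ⟨x, rfl⟩
  | mul x y hx hy =>
    rw [map_mul]
    exact Subalgebra.mul_mem _ hx hy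
  | add x y hx hy =>
    rw [map_add]
    exact Subalgebra.add_mem _ hx hy

lemma mem_center_of_commute {z : Yangian r c}
    (h : ∀ a b n, z * tcoef c a b n = tcoef c a b n * z) :
    z ∈ Subalgebra.center ℂ (Yangian r c) := by
  have h1 : (⊤ : Subalgebra ℂ (Yangian r c)) ≤ Subalgebra.centralizer ℂ {z} := by
    rw [← adjoin_tcoef]
    refine Algebra.adjoin_le ?_
    rintro _ ⟨x, rfl⟩
    refine Subalgebra.mem_centralizer_iff _ |>.2 ?_
    rintro y rfl
    exact h _ _ _
  rw [Subalgebra.mem_center_iff]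
  intro w
  exact (Subalgebra.mem_centralizer_iff _ |>.1 (h1 (Algebra.mem_top (x := w))) z rfl).symm

lemma coeff_qdet_mem_center (hc : c ≠ 0) (n : ℕ) :
    coeff n (qdet r c) ∈ Subalgebra.center ℂ (Yangian r c) := by
  refine mem_center_of_commute fun d e q => ?_
  have h : ExchangeRel (specDiff (Yangian r c) 0) (specConst (Yangian r c) c)
      (fun a b => C (tSeries c a b)) (fun a b => map C (tSeries c a b)) := by
    refine exchangeRel_of_coeff ?_ ?_
    · intro a b
      rw [tSeries, coeff_mk, tcoef_zero]
    · intro a b d e p q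
      simpa only [tSeries, coeff_mk] using tcoef_rel c a b d e p q
  have := qdetSeries_commute hc h d e n q
  rwa [tSeries, coeff_mk] at this

/-! ### Representations -/

variable {A : Type*} [Ring A] [Algebra ℂ A]

/-- The homomorphism from the Yangian determined by a solution of the exchange relation. -/
def yangianLift (T : Fin r → Fin r → PowerSeries A)
    (h0 : ∀ a b, coeff 0 (T a b) = if a = b then 1 else 0)
    (h : ExchangeRel (specDiff A 0) (specConst A c) (fun a b => C (T a b))
      (fun a b => map C (T a b))) : Yangian r c →ₐ[ℂ] A :=
  RingQuot.liftAlgHom ℂ ⟨FreeAlgebra.lift ℂ fun x => coeff (x.2.2 + 1) (T x.1 x.2.1), by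
    have hT : ∀ a b n, FreeAlgebra.lift ℂ (fun x : Fin r × Fin r × ℕ =>
        coeff (x.2.2 + 1) (T x.1 x.2.1)) (freeT a b n) = coeff n (T a b) := by
      intro a b n
      cases n with
      | zero =>
        rw [h0, freeT]
        split_ifs <;> simp
      | succ n => simp [freeT]
    rintro _ _ ⟨a, b, d, e, p, q⟩
    simpa only [map_sub, map_mul, map_smul, hT] using coeff_of_exchangeRel h a b d e p q⟩

lemma yangianLift_tcoef (T : Fin r → Fin r → PowerSeries A)
    (h0 : ∀ a b, coeff 0 (T a b) = if a = b then 1 else 0)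
    (h : ExchangeRel (specDiff A 0) (specConst A c) (fun a b => C (T a b))
      (fun a b => map C (T a b))) (a b : Fin r) (n : ℕ) :
    yangianLift T h0 h (tcoef c a b n) = coeff n (T a b) := by
  rw [yangianLift, tcoef, RingQuot.liftAlgHom_mkAlgHom_apply]
  cases n with
  | zero =>
    rw [h0, freeT]
    split_ifs <;> simp
  | succ n => simp [freeT]

/-! ### The Gelfand–Tsetlin subalgebra -/

lemma incl_tcoef {l r : ℕ} (h : l ≤ r) (a b : Fin l) (n : ℕ) :
    incl c h (tcoef c a b n) = tcoef c (Fin.castLE h a) (Fin.castLE h b) n := by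
  rw [incl, tcoef, RingQuot.liftAlgHom_mkAlgHom_apply, preIncl_freeT]

lemma yangian_algHom_ext {f g : Yangian r c →ₐ[ℂ] A}
    (h : ∀ a b n, f (tcoef c a b n) = g (tcoef c a b n)) : f = g := by
  refine AlgHom.ext_of_adjoin_eq_top adjoin_tcoef ?_
  rintro _ ⟨x, rfl⟩
  exact h _ _ _

lemma incl_comp {l l' r : ℕ} (h : l ≤ l') (h' : l' ≤ r) :
    (incl c h').comp (incl c h) = incl c (h.trans h') := by
  refine yangian_algHom_ext fun a b n => ?_
  rw [AlgHom.comp_apply, incl_tcoef, incl_tcoef, incl_tcoef]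
  rfl

lemma incl_self : incl c (le_refl r) = AlgHom.id ℂ (Yangian r c) := by
  refine yangian_algHom_ext fun a b n => ?_
  rw [incl_tcoef]
  rfl

/-- For l ≤ l' the inclusion of the smaller Yangian factors through the larger one, whose centre
commutes with everything in it. -/
lemma isCommSub_gelfandTsetlin : IsCommSub (gelfandTsetlin r c) := by
  have key : ∀ l l' : Fin r, l ≤ l' → ∀ z ∈ Subalgebra.center ℂ (Yangian (l + 1) c),
      ∀ z' ∈ Subalgebra.center ℂ (Yangian (l' + 1) c),
      incl c (Nat.succ_le_of_lt l.2) z * incl c (Nat.succ_le_of_lt l'.2) z' =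
        incl c (Nat.succ_le_of_lt l'.2) z' * incl c (Nat.succ_le_of_lt l.2) z := by
    intro l l' hl z hz z' hz'
    have h1 : (l : ℕ) + 1 ≤ l' + 1 := Nat.succ_le_succ hl
    rw [← incl_comp h1 (Nat.succ_le_of_lt l'.2), AlgHom.comp_apply, ← map_mul, ← map_mul,
      Subalgebra.mem_center_iff.1 hz']
  have : gelfandTsetlin r c = Algebra.adjoin ℂ (⋃ l : Fin r,
      (((Subalgebra.center ℂ (Yangian (l + 1) c)).map (incl c (Nat.succ_le_of_lt l.2)) :
        Subalgebra ℂ (Yangian r c)) : Set (Yangian r c))) := by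
    rw [Algebra.adjoin_iUnion]
    simp only [Algebra.adjoin_eq]
    rfl
  rw [this]
  refine isCommSub_adjoin fun x hx y hy => ?_
  obtain ⟨l, z, hz, rfl⟩ := Set.mem_iUnion.1 hx
  obtain ⟨l', z', hz', rfl⟩ := Set.mem_iUnion.1 hy
  rcases le_total l l' with h | h
  · exact key l l' h z hz z' hz'
  · exact (key l' l h z' hz' z hz).symm

lemma center_le_gelfandTsetlin (hr : 0 < r) :
    Subalgebra.center ℂ (Yangian r c) ≤ gelfandTsetlin r c := by
  obtain ⟨n, rfl⟩ : ∃ n, r = n + 1 := ⟨r - 1, by lia⟩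
  intro z hz
  refine (le_iSup (fun l : Fin (n + 1) => (Subalgebra.center ℂ (Yangian (l + 1) c)).map
    (incl c (Nat.succ_le_of_lt l.2))) (Fin.last n)) ?_
  refine ⟨z, hz, ?_⟩
  change incl c (le_refl (n + 1)) z = z
  rw [incl_self]
  rfl

end Yangian


/-! ## The quantum determinant and the exchange of neighbouring sites of a spin chain -/

section CentralParameters

set_option linter.unusedSectionVars false

open PowerSeries

lemma map_resolvent {A A' : Type*} [Ring A] [Ring A'] (f : A →+* A') (y : A) :
    map f (resolvent y) = resolvent (f y) := by
  ext n
  rw [coeff_map, resolvent, resolvent, coeff_mk, coeff_mk]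
  split_ifs <;> simp

lemma map_smul_series {A A' : Type*} [Ring A] [Ring A'] [Algebra ℂ A] [Algebra ℂ A']
    (f : A →ₐ[ℂ] A') (s : ℂ) (F : PowerSeries A) :
    map (f : A →+* A') (s • F) = s • map (f : A →+* A') F := by
  ext n
  rw [coeff_map, coeff_smul_single, coeff_smul_single, coeff_map]
  exact map_smul f s _

lemma map_mono {N r : ℕ} {A A' : Type*} [Ring A] [Ring A'] [Algebra ℂ A] [Algebra ℂ A']
    (f : A →ₐ[ℂ] A') (c : ℂ) (E : Fin N → Fin r → Fin r → A) (y : Fin N → A) (n : ℕ)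
    (a b : Fin r) :
    map (f : A →+* A') (mono c E y n a b) =
      mono c (fun i a b => f (E i a b)) (fun i => f (y i)) n a b := by
  induction n generalizing a b with
  | zero =>
    simp only [mono]
    split_ifs <;> simp
  | succ n ih =>
    simp only [mono]
    split_ifs with h
    · simp only [map_sum, map_mul, ih, lax, map_add, map_smul_series, map_resolvent, map_C]
      refine Finset.sum_congr rfl fun x _ => ?_
      split_ifs <;> simp
    · exact ih a b

lemma resolvent_sub {B : Type*} [CommRing B] [Algebra ℂ B] (y z : B) :
    resolvent z - resolvent y = C (z - y) * (resolvent y * resolvent z) := by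
  have h1 := resolvent_eq y
  have h2 := resolvent_eq z
  have h3 : (resolvent z - resolvent y) * X = C (z - y) * (resolvent y * resolvent z) * X := by
    rw [map_sub]
    linear_combination (resolvent y) * h2 - (resolvent z) * h1
  ext n
  have := congrArg (coeff (n + 1)) h3
  rwa [coeff_succ_mul_X, coeff_succ_mul_X] at this

variable {N r : ℕ} {B A : Type*} [CommRing B] [Algebra ℂ B] [Ring A] [Algebra ℂ A] [Algebra B A]
  [IsScalarTower ℂ B A]

lemma commute_map_algebraMap (F : PowerSeries B) (G : PowerSeries A) :
    Commute (map (algebraMap B A) F) G := by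
  ext n
  rw [coeff_mul, coeff_mul, ← Finset.Nat.sum_antidiagonal_swap]
  refine Finset.sum_congr rfl fun p _ => ?_
  rw [coeff_map]
  exact Algebra.commutes _ _

/-- The product of the series `1 + c (u - η_i)⁻¹` over the first `n` sites. -/
def siteProd (c : ℂ) (η : Fin N → B) : ℕ → PowerSeries B
  | 0 => 1
  | n + 1 => if h : n < N then (1 + c • resolvent (η ⟨n, h⟩)) * siteProd c η n
      else siteProd c η n

variable {c : ℂ} {E : Fin N → Fin r → Fin r → A} {η : Fin N → B}

lemma isSpinChain_algebraMap
    (h₁ : ∀ i a b d e, E i a b * E i d e = if b = d then E i a e else 0)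
    (h₂ : ∀ i j a b d e, i ≠ j → Commute (E i a b) (E j d e)) :
    IsSpinChain E fun i => algebraMap B A (η i) where
  unit_mul := h₁
  unit_comm := h₂
  par_unit _ _ _ _ := Algebra.commutes _ _
  par_comm _ _ := Algebra.commutes _ _

section HighestVector

variable {o : Fin r} {e : A}

/-- On a vector killed by every E^{ab} with b ≠ o, the columns b ≠ o of the monodromy matrix act as
those of the identity matrix. -/
lemma mono_mul_C_of_ne (h : IsSpinChain E fun i => algebraMap B A (η i))
    (he : ∀ i a b, b ≠ o → E i a b * e = 0) {n : ℕ} (hn : n ≤ N) (a b : Fin r) (hb : b ≠ o) :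
    mono c E (fun i => algebraMap B A (η i)) n a b * C e = if a = b then C e else 0 := by
  induction n generalizing a with
  | zero =>
    simp only [mono, ite_mul, one_mul, zero_mul]
  | succ n ih =>
    rw [mono_succ h hn, add_mul, ih (by lia), mul_assoc, smul_mul_assoc, Finset.sum_mul]
    simp only [mul_assoc, ih (Nat.le_of_succ_le hn), mul_ite, mul_zero, Finset.sum_ite_eq',
      Finset.mem_univ, if_true]
    rw [← map_mul, he _ _ _ hb, map_zero, smul_zero, mul_zero, add_zero]

lemma map_siteProd_succ {n : ℕ} (hn : n < N) : map (algebraMap B A) (siteProd c η (n + 1)) =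
    (1 + c • resolvent (algebraMap B A (η ⟨n, hn⟩))) *
      map (algebraMap B A) (siteProd c η n) := by
  rw [siteProd, dif_pos hn, map_mul, map_add, map_one]
  have := map_smul_series (IsScalarTower.toAlgHom ℂ B A) c (resolvent (η ⟨n, hn⟩))
  rw [← map_resolvent]
  congr 2

/-- Since the unit of the new site commutes with the earlier monodromy, it can act on e first, and
only E^{oo} survives; each site contributes the factor 1 + c (u - η_i)⁻¹. -/
lemma mono_mul_C_self (h : IsSpinChain E fun i => algebraMap B A (η i))
    (he : ∀ i a b, b ≠ o → E i a b * e = 0) (he' : ∀ i, E i o o * e = e) {n : ℕ} (hn : n ≤ N) :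
    mono c E (fun i => algebraMap B A (η i)) n o o * C e =
      map (algebraMap B A) (siteProd c η n) * C e := by
  induction n with
  | zero => simp only [mono, siteProd, if_true, map_one]
  | succ n ih =>
    have hcomm : ∀ x, C (E ⟨n, hn⟩ o x) * mono c E (fun i => algebraMap B A (η i)) n x o =
        mono c E (fun i => algebraMap B A (η i)) n x o * C (E ⟨n, hn⟩ o x) := fun x =>
      commute_C_mono (fun i hi a b => h.unit_comm _ _ _ _ _ _ (by
        rintro rfl
        exact lt_irrefl _ hi)) (fun i _ => Algebra.commute_algebraMap_right _ _) x o
    have hs : (∑ x, C (E ⟨n, hn⟩ o x) * mono c E (fun i => algebraMap B A (η i)) n x o) * C e =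
        mono c E (fun i => algebraMap B A (η i)) n o o * C e := by
      simp only [hcomm, Finset.sum_mul, mul_assoc, ← map_mul]
      rw [Finset.sum_eq_single o, he']
      · intro x _ hx
        rw [he _ _ _ hx, map_zero, mul_zero]
      · simp
    rw [mono_succ h hn, add_mul, mul_assoc, smul_mul_assoc, hs, ih (by lia), map_siteProd_succ hn,
      mul_assoc, add_mul, one_mul, smul_mul_assoc, mul_smul_comm]

lemma list_prod_mul_of_forall {R : Type*} [Ring R] {z : R} (l : List R) (h : ∀ x ∈ l, x * z = z) :
    l.prod * z = z := by
  induction l with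
  | nil => simp
  | cons x l ih =>
    rw [List.prod_cons, mul_assoc, ih fun w hw => h w (List.mem_cons_of_mem _ hw),
      h x List.mem_cons_self]

lemma list_prod_mul_eq_zero {R : Type*} [Ring R] {z : R} (l : List R)
    (h : ∀ x ∈ l, x * z = z ∨ x * z = 0) (h' : ∃ x ∈ l, x * z = 0) : l.prod * z = 0 := by
  induction l with
  | nil => simp at h'
  | cons x l ih =>
    rw [List.prod_cons, mul_assoc]
    have hl : ∀ w ∈ l, w * z = z ∨ w * z = 0 := fun w hw => h w (List.mem_cons_of_mem _ hw)
    by_cases hz : ∃ w ∈ l, w * z = 0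
    · rw [ih hl hz, mul_zero]
    · push Not at hz
      rw [list_prod_mul_of_forall l fun w hw => (hl w hw).resolve_right (hz w hw)]
      obtain ⟨w, hw, hw'⟩ := h'
      rcases List.mem_cons.1 hw with rfl | hw
      · exact hw'
      · exact absurd hw' (hz w hw)

end HighestVector

lemma shift_zero_left (f : PowerSeries A) : shift 0 f = f := by
  ext l
  rw [shift, coeff_mk, Finset.sum_eq_single l]
  · simp
  · intro n _ hn
    simp [coeff_X_pow, hn.symm]
  · simp

/-- The value of the quantum determinant on a highest vector. -/
lemma qdetSeries_mul_C {n : ℕ} {T : Fin (n + 1) → Fin (n + 1) → PowerSeries A}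
    {F : PowerSeries B} {e : A}
    (h : ∀ a b, b ≠ Fin.last n → T a b * C e = if a = b then C e else 0)
    (h' : T (Fin.last n) (Fin.last n) * C e = map (algebraMap B A) F * C e) :
    qdetSeries c T * C e = map (algebraMap B A) F * C e := by
  have hs : ∀ s a b, b ≠ Fin.last n → shift s (T a b) * C e = if a = b then C e else 0 := by
    intro s a b hb
    have := congrArg (shift s) (h a b hb)
    rw [shift_mul, shift_C] at this
    rw [this]
    split_ifs
    · exact shift_C _ _
    · exact (shiftHom A s).map_zero
  -- The factor of the last row carries the shift 0, so F enters unshifted.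
  have hprod : ∀ σ : Equiv.Perm (Fin (n + 1)), (List.ofFn fun a : Fin (n + 1) =>
      shift (c * (((n + 1 : ℕ) : ℂ) - 1 - (a : ℕ))) (T a (σ a))).prod =
      (List.ofFn fun a : Fin n => shift (c * (((n + 1 : ℕ) : ℂ) - 1 - (a : ℕ)))
        (T a.castSucc (σ a.castSucc))).prod * T (Fin.last n) (σ (Fin.last n)) := by
    intro σ
    rw [List.ofFn_succ', List.concat_eq_append, List.prod_append, List.prod_singleton]
    have : c * (((n + 1 : ℕ) : ℂ) - 1 - ((Fin.last n : Fin (n + 1)) : ℕ)) = 0 := by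
      simp
    rw [this, shift_zero_left]
    rfl
  have hF : ∀ G : PowerSeries A, G * (map (algebraMap B A) F * C e) =
      map (algebraMap B A) F * (G * C e) := by
    intro G
    rw [← mul_assoc, ← (commute_map_algebraMap F G).eq, mul_assoc]
  rw [qdetSeries, ncDet, Finset.sum_mul, Finset.sum_eq_single 1]
  · rw [Equiv.Perm.sign_one, Units.val_one, one_smul, hprod, mul_assoc, Equiv.Perm.one_apply, h',
      hF, list_prod_mul_of_forall]
    intro x hx
    obtain ⟨a, rfl⟩ := (List.mem_ofFn' _ _).1 hx
    exact (hs _ _ _ (Fin.castSucc_lt_last a).ne).trans (if_pos rfl)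
  · intro σ _ hσ
    -- A non-trivial σ either moves the last row, whose factor then annihilates e, or fixes it and
    -- moves another row, which does.
    rw [smul_mul_assoc, hprod, mul_assoc]
    by_cases hl : σ (Fin.last n) = Fin.last n
    · have hne : ∀ a : Fin n, σ a.castSucc ≠ Fin.last n := fun a ha =>
        (Fin.castSucc_lt_last a).ne (σ.injective (ha.trans hl.symm))
      rw [hl, h', hF, list_prod_mul_eq_zero, mul_zero, smul_zero]
      · intro x hx
        obtain ⟨a, rfl⟩ := (List.mem_ofFn' _ _).1 hx
        rw [hs _ _ _ (hne a)]
        split_ifs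
        · exact Or.inl rfl
        · exact Or.inr rfl
      · obtain ⟨a, ha⟩ : ∃ a, σ a ≠ a := by
          by_contra! hall
          exact hσ (Equiv.ext hall)
        obtain ⟨a, rfl⟩ : ∃ b : Fin n, b.castSucc = a :=
          Fin.exists_castSucc_eq.2 fun hal => ha (hal ▸ hl)
        refine ⟨_, (List.mem_ofFn' _ _).2 ⟨a, rfl⟩, ?_⟩
        rw [hs _ _ _ (hne a), if_neg ha.symm]
    · rw [h _ _ hl, if_neg (Ne.symm hl), mul_zero, smul_zero]
  · simp

end CentralParameters


/-! ### Exchange of neighbouring parameters by an R-matrix. -/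

section Exchange

open PowerSeries

set_option linter.unusedSectionVars false

/-- The quantum Yang–Baxter equation for two neighbouring sites, in terms of central elements. -/
lemma two_site_exchange {K R : Type*} [CommRing K] [Ring R] (φ : K →+* R)
    (hφ : ∀ k x, φ k * x = x * φ k) {κ d g₁ g₂ δ : K} {e f p : R} (hp : p * p = 1)
    (he : p * e = f * p) (hf : p * f = e * p) (hg : g₂ - g₁ = d * (g₁ * g₂)) :
    (φ κ + φ d * p) * (φ δ + φ (κ * g₂) * f + φ (κ * g₁) * e + φ (κ ^ 2 * (g₁ * g₂)) * (p * e)) =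
      (φ δ + φ (κ * g₁) * f + φ (κ * g₂) * e + φ (κ ^ 2 * (g₁ * g₂)) * (p * e)) *
        (φ κ + φ d * p) := by
  let _ : Algebra K R := φ.toAlgebra' hφ
  have h1 : ∀ k x, φ k * x = k • x := fun k x => (Algebra.smul_def k x).symm
  have h2 : ∀ k, φ k = k • (1 : R) := fun k => Algebra.algebraMap_eq_smul_one k
  have e1 : p * (p * e) = e := by rw [← mul_assoc, hp, one_mul]
  have e2 : f * p * p = f := by rw [mul_assoc, hp, mul_one]
  simp only [h1, h2 δ, h2 κ, add_mul, mul_add, smul_mul_assoc, mul_smul_comm, one_mul, mul_one,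
    he, hf, e2, smul_add, smul_smul]
  have e3 : p * (f * p) = e := by rw [← he, e1]
  rw [e3]
  -- The two sides differ exactly by a multiple of the resolvent identity `hg`.
  have e4 : (κ ^ 2 * (g₂ - g₁ - d * (g₁ * g₂))) • (f - e) = 0 := by
    rw [hg, sub_self, mul_zero, zero_smul]
  rw [← sub_eq_zero, ← e4]
  module

variable {N r : ℕ} {B A : Type*} [CommRing B] [Algebra ℂ B] [Ring A] [Algebra ℂ A] [Algebra B A]
  [IsScalarTower ℂ B A]

lemma mono_congr {c : ℂ} {E : Fin N → Fin r → Fin r → A} {y y' : Fin N → A} {n : ℕ}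
    (h : ∀ i : Fin N, (i : ℕ) < n → y i = y' i) (a b : Fin r) :
    mono c E y n a b = mono c E y' n a b := by
  induction n generalizing a b with
  | zero => rfl
  | succ n ih =>
    have ih := ih fun i hi => h i (by lia)
    simp only [mono]
    split_ifs with hn
    · simp only [lax, ih, h ⟨n, hn⟩ (Nat.lt_succ_self n)]
    · exact ih a b

variable {c : ℂ} {E : Fin N → Fin r → Fin r → A} {η : Fin N → B}

lemma lax_algebraMap (i : Fin N) (a b : Fin r) :
    lax c E (fun i => algebraMap B A (η i)) i a b =
      map (algebraMap B A) (if a = b then 1 else 0) +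
        map (algebraMap B A) (C (algebraMap ℂ B c) * resolvent (η i)) * C (E i a b) := by
  rw [lax, (commute_map_algebraMap _ _).eq, map_mul, map_C, map_resolvent, smul_eq_mul_X,
    ← IsScalarTower.algebraMap_apply, ← mul_assoc, ← mul_assoc, ← map_mul, ← map_mul,
    Algebra.commutes]
  split_ifs <;> simp

lemma sum_lax_mul_lax {i j : Fin N} {w : A} {a b : Fin r} (hw : ∑ x, E j a x * E i x b = w) :
    ∑ x, lax c E (fun i => algebraMap B A (η i)) j a x *
        lax c E (fun i => algebraMap B A (η i)) i x b =
      map (algebraMap B A) (if a = b then 1 else 0) +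
        map (algebraMap B A) (C (algebraMap ℂ B c) * resolvent (η j)) * C (E j a b) +
        map (algebraMap B A) (C (algebraMap ℂ B c) * resolvent (η i)) * C (E i a b) +
        map (algebraMap B A) (C (algebraMap ℂ B c) ^ 2 * (resolvent (η i) * resolvent (η j))) *
          C w := by
  have h1 : ∀ x, map (algebraMap B A) (C (algebraMap ℂ B c) * resolvent (η j)) * C (E j a x) *
      (map (algebraMap B A) (C (algebraMap ℂ B c) * resolvent (η i)) * C (E i x b)) =
      map (algebraMap B A) (C (algebraMap ℂ B c) ^ 2 * (resolvent (η i) * resolvent (η j))) *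
        C (E j a x * E i x b) := by
    intro x
    rw [mul_assoc, ← mul_assoc (C (E j a x)), ← (commute_map_algebraMap _ (C (E j a x))).eq,
      mul_assoc, ← mul_assoc, ← map_mul, ← map_mul]
    congr 2
    ring
  simp only [lax_algebraMap, add_mul, mul_add, Finset.sum_add_distrib, h1]
  rw [← Finset.mul_sum, ← map_sum, hw]
  simp only [apply_ite (map (algebraMap B A)), map_one, map_zero, ite_mul, one_mul, zero_mul,
    mul_ite, mul_one, mul_zero, Finset.sum_ite_eq, Finset.sum_ite_eq', Finset.mem_univ, if_true]
  abel

/-- Exchanging the parameters of two neighbouring sites. -/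
lemma exchange_mul_mono {i₀ : ℕ} (hi : i₀ + 1 < N) {p : A}
    (hp : p * p = 1) (hpE : ∀ a b, p * E ⟨i₀, by lia⟩ a b = E ⟨i₀ + 1, hi⟩ a b * p)
    (hpE' : ∀ a b, p * E ⟨i₀ + 1, hi⟩ a b = E ⟨i₀, by lia⟩ a b * p)
    (hpc : ∀ l : Fin N, (l : ℕ) ≠ i₀ → (l : ℕ) ≠ i₀ + 1 → ∀ a b, Commute p (E l a b))
    (hw : ∀ a b, ∑ x, E ⟨i₀ + 1, hi⟩ a x * E ⟨i₀, by lia⟩ x b = p * E ⟨i₀, by lia⟩ a b)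
    {R : A} (hR : R = algebraMap B A (algebraMap ℂ B c) +
      algebraMap B A (η ⟨i₀ + 1, hi⟩ - η ⟨i₀, by lia⟩) * p) {n : ℕ} (hn : i₀ + 2 ≤ n) (hnN : n ≤ N)
    (a b : Fin r) :
    C R * mono c E (fun i => algebraMap B A (η i)) n a b =
      mono c E (fun i => algebraMap B A (η (Equiv.swap ⟨i₀, by lia⟩ ⟨i₀ + 1, hi⟩ i))) n a b *
        C R := by
  set s : Equiv.Perm (Fin N) := Equiv.swap ⟨i₀, by lia⟩ ⟨i₀ + 1, hi⟩ with hs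
  have hRE : ∀ l : Fin N, (l : ℕ) ≠ i₀ → (l : ℕ) ≠ i₀ + 1 → ∀ a b, Commute R (E l a b) := by
    intro l hl hl' a b
    rw [hR]
    exact (Algebra.commute_algebraMap_left _ _).add_left
      ((Algebra.commute_algebraMap_left _ _).mul_left (hpc l hl hl' a b))
  have hsl : ∀ l : Fin N, (l : ℕ) ≠ i₀ → (l : ℕ) ≠ i₀ + 1 → s l = l := by
    intro l hl hl'
    exact Equiv.swap_apply_of_ne_of_ne (fun h => hl (congrArg Fin.val h))
      (fun h => hl' (congrArg Fin.val h))
  induction n, hn using Nat.le_induction generalizing a b with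
  | base =>
    -- The sites below i₀ keep their parameters and commute with R, so only the product of the two
    -- L-operators at i₀ + 1 and i₀ matters.
    have h1 : ∀ z, C R * mono c E (fun i => algebraMap B A (η i)) i₀ z b =
        mono c E (fun i => algebraMap B A (η (s i))) i₀ z b * C R := by
      intro z
      rw [mono_congr (y' := fun i => algebraMap B A (η (s i)))]
      · exact commute_C_mono (fun l hl a b => hRE l (by lia) (by lia) a b)
          (fun i _ => Algebra.commute_algebraMap_right _ _) z b
      · intro l hl
        rw [hsl l (by lia) (by lia)]
    have h2 : ∀ (η : Fin N → B), mono c E (fun i => algebraMap B A (η i)) (i₀ + 2) a b =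
        ∑ z, (∑ x, lax c E (fun i => algebraMap B A (η i)) ⟨i₀ + 1, hi⟩ a x *
          lax c E (fun i => algebraMap B A (η i)) ⟨i₀, by lia⟩ x z) *
          mono c E (fun i => algebraMap B A (η i)) i₀ z b := by
      intro η
      rw [mono]
      simp only [dif_pos hi]
      rw [mono]
      simp only [dif_pos (Nat.lt_of_succ_lt hi), Finset.mul_sum, Finset.sum_mul, mul_assoc]
      exact Finset.sum_comm
    have e1 : s ⟨i₀ + 1, hi⟩ = ⟨i₀, by lia⟩ := Equiv.swap_apply_right _ _
    have e2 : s ⟨i₀, by lia⟩ = ⟨i₀ + 1, hi⟩ := Equiv.swap_apply_left _ _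
    rw [h2 η, h2 fun i => η (s i), Finset.mul_sum, Finset.sum_mul]
    refine Finset.sum_congr rfl fun z _ => ?_
    rw [mul_assoc _ _ (C R), ← h1, ← mul_assoc, ← mul_assoc]
    congr 1
    rw [sum_lax_mul_lax (hw a z), sum_lax_mul_lax (η := fun i => η (s i)) (hw a z), e1, e2]
    have := two_site_exchange (map (algebraMap B A)) (fun k x => (commute_map_algebraMap k x).eq)
      (κ := C (algebraMap ℂ B c)) (d := C (η ⟨i₀ + 1, hi⟩ - η ⟨i₀, by lia⟩))
      (δ := if a = z then 1 else 0)
      (p := C p) (e := C (E ⟨i₀, by lia⟩ a z)) (f := C (E ⟨i₀ + 1, hi⟩ a z))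
      (by rw [← map_mul, hp, map_one]) (by rw [← map_mul, ← map_mul, hpE])
      (by rw [← map_mul, ← map_mul, hpE']) (resolvent_sub (η ⟨i₀, by lia⟩) (η ⟨i₀ + 1, hi⟩))
    have hR' : C R = map (algebraMap B A) (C (algebraMap ℂ B c)) +
        map (algebraMap B A) (C (η ⟨i₀ + 1, hi⟩ - η ⟨i₀, by lia⟩)) * C p := by
      rw [hR, map_add, map_mul, map_C, map_C]
    rw [hR', map_mul C, mul_comm (resolvent (η ⟨i₀ + 1, hi⟩)) (resolvent (η ⟨i₀, by lia⟩))]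
    exact this
  | succ n hn ih =>
    have ih := fun a b => ih (by lia) a b
    have hs' : s ⟨n, hnN⟩ = ⟨n, hnN⟩ := hsl _ (by simp; lia) (by simp; lia)
    have hl : ∀ x, C R * lax c E (fun i => algebraMap B A (η i)) ⟨n, hnN⟩ a x =
        lax c E (fun i => algebraMap B A (η (s i))) ⟨n, hnN⟩ a x * C R := by
      intro x
      rw [lax_algebraMap, lax_algebraMap (η := fun i => η (s i)), hs']
      exact (((commute_map_algebraMap _ (C R)).add_left ((commute_map_algebraMap _ (C R)).mul_left
        ((hRE ⟨n, hnN⟩ (by simp; lia) (by simp; lia) a x).symm.map C)))).eq.symm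
    rw [mono, mono]
    simp only [dif_pos (Nat.lt_of_succ_le hnN)]
    rw [Finset.mul_sum, Finset.sum_mul]
    refine Finset.sum_congr rfl fun x _ => ?_
    rw [← mul_assoc, hl, mul_assoc, ih, mul_assoc]

end Exchange


/-! ## Generators of the algebra of symmetric polynomials -/

section Symmetric

open PowerSeries

set_option linter.unusedSectionVars false

lemma siteProd_eq_prod {N : ℕ} {B : Type*} [CommRing B] [Algebra ℂ B] (c : ℂ) (η : Fin N → B) :
    siteProd c η N = ∏ i, (1 + c • resolvent (η i)) := by
  have h : ∀ n (hn : n ≤ N), siteProd c η n =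
      ∏ i : Fin n, (1 + c • resolvent (η (Fin.castLE hn i))) := by
    intro n
    induction n with
    | zero => exact fun _ => by simp [siteProd]
    | succ n ih =>
      intro hn
      rw [siteProd, dif_pos (Nat.lt_of_succ_le hn), ih (by lia), Fin.prod_univ_castSucc, mul_comm]
      rfl
  exact h N le_rfl

lemma prod_sub_mul_eq {σ R : Type*} [Fintype σ] [CommRing R] (a b : R) (y : σ → R) :
    ∏ i, (a - y i * b) = ∑ j ∈ Finset.range (Fintype.card σ + 1),
      (-1) ^ j * (∑ t ∈ Finset.powersetCard j Finset.univ, ∏ i ∈ t, y i) *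
        (b ^ j * a ^ (Fintype.card σ - j)) := by
  classical
  have h : ∀ i, a - y i * b = -(y i * b) + a := fun i => by ring
  simp only [h]
  rw [Finset.prod_add, Finset.sum_powerset, Finset.card_univ]
  refine Finset.sum_congr rfl fun j _ => ?_
  rw [Finset.mul_sum, Finset.sum_mul]
  refine Finset.sum_congr rfl fun t ht => ?_
  obtain ⟨-, ht⟩ := Finset.mem_powersetCard.1 ht
  rw [Finset.prod_const, Finset.card_sdiff_of_subset (Finset.subset_univ t), Finset.card_univ, ht,
    ← ht, Finset.prod_neg, Finset.prod_mul_distrib, Finset.prod_const]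
  ring

lemma one_add_smul_resolvent_mul {B : Type*} [CommRing B] [Algebra ℂ B] (c : ℂ) (y : B) :
    (1 + c • resolvent y) * (1 - C y * X) = (1 + C (algebraMap ℂ B c) * X) - C y * X := by
  rw [smul_eq_mul_X]
  linear_combination C (algebraMap ℂ B c) * resolvent_eq y

variable {N : ℕ}

/-- The coefficient of `u^{-n}` in `∏_i (1 + c (u - y_i)⁻¹)`. -/
def siteCoeff (N : ℕ) (c : ℂ) (n : ℕ) : MvPolynomial (Fin N) ℂ :=
  coeff n (siteProd c (MvPolynomial.X : Fin N → MvPolynomial (Fin N) ℂ) N)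

lemma siteCoeff_isSymmetric (c : ℂ) (n : ℕ) : (siteCoeff N c n).IsSymmetric := by
  intro w
  have h : map (MvPolynomial.rename w : MvPolynomial (Fin N) ℂ →ₐ[ℂ] _).toRingHom
      (siteProd c (MvPolynomial.X : Fin N → MvPolynomial (Fin N) ℂ) N) =
      siteProd c (MvPolynomial.X : Fin N → MvPolynomial (Fin N) ℂ) N := by
    rw [siteProd_eq_prod, map_prod]
    rw [← Equiv.prod_comp w fun i => 1 + c • resolvent (MvPolynomial.X i : MvPolynomial (Fin N) ℂ)]
    refine Finset.prod_congr rfl fun i _ => ?_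
    have := map_smul_series (MvPolynomial.rename w : MvPolynomial (Fin N) ℂ →ₐ[ℂ] _) c
      (resolvent (MvPolynomial.X i))
    rw [map_add, map_one]
    congr 1
    refine this.trans ?_
    rw [map_resolvent]
    simp
  have := congrArg (coeff n) h
  rwa [coeff_map] at this

lemma coeff_zero_one_add_smul_resolvent {B : Type*} [CommRing B] [Algebra ℂ B] (c : ℂ) (y : B) :
    coeff 0 (1 + c • resolvent y) = 1 := by
  rw [map_add, coeff_smul_single, resolvent, coeff_mk]
  simp

lemma coeff_zero_siteProd (c : ℂ) : siteCoeff N c 0 = 1 := by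
  rw [siteCoeff, siteProd_eq_prod, coeff_zero_eq_constantCoeff, map_prod]
  refine Finset.prod_eq_one fun i _ => ?_
  rw [← coeff_zero_eq_constantCoeff_apply, coeff_zero_one_add_smul_resolvent]

/-- Compare the coefficients of u^{-m} in F(u) ∏ (1 - y_i u⁻¹) = ∏ (1 + c u⁻¹ - y_i u⁻¹), with both
products expanded in elementary symmetric polynomials. -/
lemma sum_esymm_eq_zero (c : ℂ) (m : ℕ) : ∑ j ∈ Finset.range (N + 1),
    (-1) ^ j * MvPolynomial.esymm (Fin N) ℂ j * (if j ≤ m then siteCoeff N c (m - j) -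
      algebraMap ℂ _ (coeff (m - j) ((1 + C c * X) ^ (N - j) : PowerSeries ℂ)) else 0) = 0 := by
  let B := MvPolynomial (Fin N) ℂ
  let F := siteProd c (MvPolynomial.X : Fin N → B) N
  have he : ∀ j, ∑ t ∈ Finset.powersetCard j (Finset.univ : Finset (Fin N)),
      ∏ i ∈ t, C (MvPolynomial.X i : B) = C (MvPolynomial.esymm (Fin N) ℂ j) := by
    intro j
    rw [MvPolynomial.esymm, map_sum]
    simp only [map_prod]
  have h1 : F * ∏ i, (1 - C (MvPolynomial.X i : B) * X) =
      ∏ i, ((1 + C (algebraMap ℂ B c) * X) - C (MvPolynomial.X i : B) * X) := by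
    change siteProd c (MvPolynomial.X : Fin N → B) N * _ = _
    rw [siteProd_eq_prod, ← Finset.prod_mul_distrib]
    exact Finset.prod_congr rfl fun i _ => one_add_smul_resolvent_mul _ _
  rw [prod_sub_mul_eq, prod_sub_mul_eq, Fintype.card_fin, Finset.mul_sum, ← sub_eq_zero,
    ← Finset.sum_sub_distrib] at h1
  have h2 := congrArg (coeff m) h1
  rw [map_sum, map_zero] at h2
  refine Eq.trans ?_ h2
  refine Finset.sum_congr rfl fun j _ => ?_
  have h3 : (1 + C (algebraMap ℂ B c) * X : PowerSeries B) ^ (N - j) =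
      map (algebraMap ℂ B) ((1 + C c * X) ^ (N - j)) := by
    simp
  rw [he, h3]
  have h4 : F * ((-1) ^ j * C (MvPolynomial.esymm (Fin N) ℂ j) * (X ^ j * 1 ^ (N - j))) -
      (-1) ^ j * C (MvPolynomial.esymm (Fin N) ℂ j) *
        (X ^ j * map (algebraMap ℂ B) ((1 + C c * X) ^ (N - j))) =
      C ((-1) ^ j * MvPolynomial.esymm (Fin N) ℂ j) *
        (X ^ j * (F - map (algebraMap ℂ B) ((1 + C c * X) ^ (N - j)))) := by
    have h5 : C ((-1 : B) ^ j) = (-1 : PowerSeries B) ^ j := by simp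
    rw [map_mul C, h5, one_pow]
    ring
  rw [h4, coeff_C_mul, coeff_X_pow_mul']
  congr 1

/-- The relation of degree m + 1 determines e_m from the lower ones: e_{m+1} drops out because F has
constant term 1, and e_m has the coefficient ±(c N - c (N - m)) = ±c m, non-zero for m ≥ 1. -/
lemma esymm_mem_adjoin {c : ℂ} (hc : c ≠ 0) (m : ℕ) : MvPolynomial.esymm (Fin N) ℂ m ∈
    Algebra.adjoin ℂ (Set.range (siteCoeff N c)) := by
  set S := Algebra.adjoin ℂ (Set.range (siteCoeff N c)) with hS
  have hS1 : ∀ n, siteCoeff N c n ∈ S := fun n => Algebra.subset_adjoin ⟨n, rfl⟩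
  have hc1 : ∀ k : ℕ, coeff 1 ((1 + C c * X) ^ k : PowerSeries ℂ) = k * c := by
    intro k
    rw [coeff_one_pow]
    simp
  have hc0 : ∀ k : ℕ, coeff 0 ((1 + C c * X) ^ k : PowerSeries ℂ) = 1 := by
    intro k
    simp
  have hf1 : siteCoeff N c 1 = algebraMap ℂ _ (N * c) := by
    have := sum_esymm_eq_zero (N := N) c 1
    rw [Finset.sum_eq_single 0] at this
    · simpa [hc1, sub_eq_zero] using this
    · intro j _ hj
      obtain rfl | hj : j = 1 ∨ ¬ j ≤ 1 := by lia
      · rw [if_pos le_rfl, Nat.sub_self, coeff_zero_siteProd, hc0, map_one, sub_self, mul_zero]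
      · rw [if_neg hj, mul_zero]
    · simp
  induction m using Nat.strong_induction_on with
  | _ m ih =>
  rcases Nat.eq_zero_or_pos m with rfl | hm
  · simp [MvPolynomial.esymm_zero, S.one_mem]
  rcases lt_or_ge N m with hN | hN
  · rw [MvPolynomial.esymm, Finset.powersetCard_eq_empty.2 (by simpa using hN), Finset.sum_empty]
    exact S.zero_mem
  have key := sum_esymm_eq_zero (N := N) c (m + 1)
  rw [← Finset.add_sum_erase _ _ (Finset.mem_range.2 (Nat.lt_succ_of_le hN)), if_pos (Nat.le_succ m),
    Nat.add_sub_cancel_left, hf1, hc1, ← map_sub] at key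
  have hr : (N * c - (N - m : ℕ) * c : ℂ) = m * c := by
    rw [Nat.cast_sub hN]
    ring
  rw [hr] at key
  have hmem : (∑ j ∈ (Finset.range (N + 1)).erase m, (-1) ^ j * MvPolynomial.esymm (Fin N) ℂ j *
      (if j ≤ m + 1 then siteCoeff N c (m + 1 - j) -
        algebraMap ℂ _ (coeff (m + 1 - j) ((1 + C c * X) ^ (N - j) : PowerSeries ℂ)) else 0)) ∈ S := by
    refine S.sum_mem fun j hj => ?_
    have hjm := (Finset.mem_erase.1 hj).1
    by_cases h1 : j < m
    · rw [if_pos (by lia)]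
      exact S.mul_mem (S.mul_mem (S.pow_mem (S.neg_mem S.one_mem) _) (ih j h1))
        (S.sub_mem (hS1 _) (S.algebraMap_mem _))
    · by_cases h2 : j = m + 1
      · rw [if_pos h2.le, h2, Nat.sub_self, coeff_zero_siteProd, hc0, map_one, sub_self, mul_zero]
        exact S.zero_mem
      · rw [if_neg (by lia), mul_zero]
        exact S.zero_mem
  have hne : (m * c : ℂ) ≠ 0 := mul_ne_zero (by exact_mod_cast hm.ne') hc
  have hfin : MvPolynomial.esymm (Fin N) ℂ m =
      ((-1) ^ (m + 1) * (m * c)⁻¹ : ℂ) • (∑ j ∈ (Finset.range (N + 1)).erase m,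
      (-1) ^ j * MvPolynomial.esymm (Fin N) ℂ j *
      (if j ≤ m + 1 then siteCoeff N c (m + 1 - j) -
        algebraMap ℂ _ (coeff (m + 1 - j) ((1 + C c * X) ^ (N - j) : PowerSeries ℂ)) else 0)) := by
    rw [← neg_eq_iff_add_eq_zero] at key
    rw [← key, mul_comm _ (algebraMap ℂ _ _), ← Algebra.smul_def, smul_neg, smul_smul, mul_assoc,
      inv_mul_cancel₀ hne, mul_one]
    rcases Nat.even_or_odd m with h | h
    · rw [h.neg_one_pow, h.add_one.neg_one_pow]
      simp
    · rw [h.neg_one_pow, h.add_one.neg_one_pow]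
      simp
  rw [hfin]
  exact S.smul_mem hmem _

lemma adjoin_siteCoeff {c : ℂ} (hc : c ≠ 0) :
    Algebra.adjoin ℂ (Set.range (siteCoeff N c)) =
      MvPolynomial.symmetricSubalgebra (Fin N) ℂ := by
  refine le_antisymm (Algebra.adjoin_le ?_) ?_
  · rintro _ ⟨n, rfl⟩
    exact siteCoeff_isSymmetric c n
  · intro p hp
    obtain ⟨q, hq⟩ := MvPolynomial.esymmAlgHom_surjective (R := ℂ) (σ := Fin N) (n := N) (by simp)
      ⟨p, hp⟩
    have hq' := congrArg Subtype.val hq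
    change _ = p at hq'
    rw [← hq']
    clear hq hq' hp p
    induction q using MvPolynomial.induction_on with
    | C a =>
      rw [← MvPolynomial.algebraMap_eq, AlgHom.commutes]
      exact Subalgebra.algebraMap_mem _ _
    | add f g hf hg =>
      rw [map_add]
      exact Subalgebra.add_mem _ hf hg
    | mul_X f i hf =>
      rw [map_mul]
      refine Subalgebra.mul_mem _ hf ?_
      rw [MvPolynomial.esymmAlgHom, MvPolynomial.aeval_X]
      exact esymm_mem_adjoin (N := N) hc ((i : ℕ) + 1)

end Symmetric


/-! ## Operators on the spin space -/

section SpinSpace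

variable {N r : ℕ}

/-- The matrix unit of `gl_r`. -/
def unitMap (a b : Fin r) : (Fin r → ℂ) →ₗ[ℂ] (Fin r → ℂ) :=
  Matrix.toLin' (Matrix.single a b (1 : ℂ))

lemma unitMap_apply (a b : Fin r) (v : Fin r → ℂ) : unitMap a b v = v b • Pi.single a 1 := by
  ext x
  rw [unitMap, Matrix.toLin'_apply, Matrix.single_mulVec]
  simp [Pi.single_apply, Function.update_apply]

lemma unitMap_single (a b d : Fin r) :
    unitMap a b (Pi.single d 1) = if b = d then Pi.single a 1 else 0 := by
  rw [unitMap_apply]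
  by_cases h : b = d
  · subst h
    simp
  · simp [h]

lemma unitMap_unitMap (a b d e : Fin r) (v : Fin r → ℂ) :
    unitMap a b (unitMap d e v) = if b = d then unitMap a e v else 0 := by
  rw [unitMap_apply d, map_smul, unitMap_single, unitMap_apply a e]
  split_ifs <;> simp

lemma matUnit_tprod (i : Fin N) (a b : Fin r) (v : Fin N → Fin r → ℂ) :
    matUnit i a b (PiTensorProduct.tprod ℂ v) =
      PiTensorProduct.tprod ℂ (Function.update v i (unitMap a b (v i))) := by
  rw [matUnit, PiTensorProduct.map_tprod]
  congr 1
  funext j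
  by_cases h : j = i
  · subst h
    simp [unitMap]
  · simp [h]

lemma matUnit_mul_self (i : Fin N) (a b d e : Fin r) :
    matUnit i a b * matUnit i d e = if b = d then matUnit i a e else 0 := by
  refine PiTensorProduct.ext (MultilinearMap.ext fun v => ?_)
  simp only [LinearMap.compMultilinearMap_apply, Module.End.mul_apply, matUnit_tprod,
    Function.update_self, Function.update_idem, unitMap_unitMap]
  split_ifs
  · rw [matUnit_tprod]
  · rw [MultilinearMap.map_update_zero]
    rfl

lemma matUnit_commute {i j : Fin N} (h : i ≠ j) (a b d e : Fin r) :
    Commute (matUnit i a b) (matUnit j d e) := by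
  refine PiTensorProduct.ext (MultilinearMap.ext fun v => ?_)
  simp only [LinearMap.compMultilinearMap_apply, Module.End.mul_apply, matUnit_tprod,
    Function.update_of_ne h, Function.update_of_ne h.symm]
  rw [Function.update_comm h]

lemma permU_tprod (w : Equiv.Perm (Fin N)) (v : Fin N → Fin r → ℂ) :
    permU r w (PiTensorProduct.tprod ℂ v) = PiTensorProduct.tprod ℂ fun i => v (w.symm i) :=
  PiTensorProduct.reindex_tprod _ _

lemma permU_one : permU r (1 : Equiv.Perm (Fin N)) = 1 := by
  refine PiTensorProduct.ext (MultilinearMap.ext fun v => ?_)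
  simp only [LinearMap.compMultilinearMap_apply, permU_tprod]
  rfl

lemma permU_mul (v w : Equiv.Perm (Fin N)) : permU r (v * w) = permU r v * permU r w := by
  refine PiTensorProduct.ext (MultilinearMap.ext fun u => ?_)
  simp only [LinearMap.compMultilinearMap_apply, Module.End.mul_apply, permU_tprod]
  rfl

lemma permU_mul_matUnit (w : Equiv.Perm (Fin N)) (i : Fin N) (a b : Fin r) :
    permU r w * matUnit i a b = matUnit (w i) a b * permU r w := by
  refine PiTensorProduct.ext (MultilinearMap.ext fun v => ?_)
  simp only [LinearMap.compMultilinearMap_apply, Module.End.mul_apply, matUnit_tprod, permU_tprod]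
  congr 1
  funext j
  by_cases h : j = w i
  · subst h
    simp
  · have : w.symm j ≠ i := fun h' => h (by rw [← h', Equiv.apply_symm_apply])
    simp [h, this]

/-- A form of P_ij = Σ E_i^{xy} E_j^{yx}. It is how permutations of tensor factors arise from
products of L-operators. -/
lemma sum_matUnit_mul_matUnit {i j : Fin N} (h : i ≠ j) (a b : Fin r) :
    ∑ x, matUnit j a x * matUnit i x b = permU r (Equiv.swap i j) * matUnit i a b := by
  refine PiTensorProduct.ext (MultilinearMap.ext fun v => ?_)
  simp only [LinearMap.compMultilinearMap_apply, LinearMap.sum_apply, Module.End.mul_apply,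
    matUnit_tprod, permU_tprod, Function.update_of_ne h.symm]
  have h1 : (fun l => Function.update v i (unitMap a b (v i)) ((Equiv.swap i j).symm l)) =
      Function.update (Function.update v j (unitMap a b (v i))) i (v j) := by
    funext l
    rw [Equiv.symm_swap]
    by_cases hi : l = i
    · subst hi
      simp [h.symm]
    · by_cases hj : l = j
      · subst hj
        simp [hi]
      · simp [Equiv.swap_apply_of_ne_of_ne hi hj, hi, hj]
  have h2 : v j = ∑ x, v j x • Pi.single x (1 : ℂ) := (pi_eq_sum_univ' (v j)).trans (by
    refine Finset.sum_congr rfl fun x _ => ?_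
    congr 1)
  rw [h1]
  conv_rhs => rw [h2]
  rw [MultilinearMap.map_update_sum]
  refine Finset.sum_congr rfl fun x _ => ?_
  rw [MultilinearMap.map_update_smul, Function.update_comm h, unitMap_apply a x, unitMap_apply x b,
    unitMap_apply a b, MultilinearMap.map_update_smul, Function.update_comm h.symm,
    MultilinearMap.map_update_smul, Function.update_comm h, Function.update_comm h.symm (v i b • _),
    MultilinearMap.map_update_smul, smul_comm, Function.update_comm h]

/-- The tensor product of matrix units. -/
def unitTensor (f g : Fin N → Fin r) : Module.End ℂ (Spin N r) :=
  PiTensorProduct.map fun i => unitMap (f i) (g i)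

lemma commute_unitTensor {T : Module.End ℂ (Spin N r)} (hT : ∀ i a b, Commute T (matUnit i a b))
    (f g : Fin N → Fin r) : Commute T (unitTensor f g) := by
  have key : ∀ s : Finset (Fin N), Commute T (PiTensorProduct.map fun i =>
      if i ∈ s then unitMap (f i) (g i) else LinearMap.id) := by
    intro s
    induction s using Finset.induction_on with
    | empty =>
      simp only [Finset.notMem_empty, if_false, PiTensorProduct.map_id]
      exact Commute.one_right T
    | insert i s hi ih =>
      have : (PiTensorProduct.map fun j => if j ∈ insert i s then unitMap (f j) (g j)
          else LinearMap.id) = matUnit i (f i) (g i) * (PiTensorProduct.map fun j =>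
            if j ∈ s then unitMap (f j) (g j) else LinearMap.id) := by
        refine PiTensorProduct.ext (MultilinearMap.ext fun v => ?_)
        simp only [LinearMap.compMultilinearMap_apply, Module.End.mul_apply,
          PiTensorProduct.map_tprod, matUnit_tprod]
        congr 1
        funext j
        by_cases hj : j = i
        · subst hj
          simp [hi]
        · simp [hj]
      rw [this]
      exact (hT i _ _).mul_right ih
  have := key Finset.univ
  simpa only [Finset.mem_univ, if_true, unitTensor] using this

/-- The operators commuting with all the matrix units are the scalars. -/
lemma eq_algebraMap_of_commute_matUnit (hr : 0 < r) {T : Module.End ℂ (Spin N r)}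
    (hT : ∀ i a b, Commute T (matUnit i a b)) : ∃ s : ℂ, T = algebraMap ℂ _ s := by
  let o : Fin N → Fin r := fun _ => ⟨0, hr⟩
  let e : (Fin N → Fin r) → Spin N r := fun f =>
    PiTensorProduct.tprod ℂ fun i => Pi.single (f i) (1 : ℂ)
  have h1 : ∀ f g, unitTensor f g (e g) = e f := by
    intro f g
    simp only [unitTensor, e, PiTensorProduct.map_tprod, unitMap_single, if_true]
  have h2 : ∀ u, ∃ s : ℂ, unitTensor o o u = s • e o := by
    intro u
    induction u using PiTensorProduct.induction_on with
    | smul_tprod a v =>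
      refine ⟨a * ∏ i, v i (o i), ?_⟩
      simp only [unitTensor, map_smul, PiTensorProduct.map_tprod, unitMap_apply, e]
      rw [MultilinearMap.map_smul_univ, smul_smul]
    | add x y hx hy =>
      obtain ⟨s, hs⟩ := hx
      obtain ⟨t, ht⟩ := hy
      exact ⟨s + t, by rw [map_add, hs, ht, add_smul]⟩
  -- `unitTensor o o` projects onto the line of e o, so T preserves this line; `unitTensor f o`
  -- carries the eigenvalue to the other basis vectors.
  obtain ⟨s, hs⟩ := h2 (T (e o))
  have h3 : T (e o) = s • e o := by
    have := LinearMap.congr_fun (commute_unitTensor hT o o).eq (e o)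
    rw [Module.End.mul_apply, Module.End.mul_apply, h1] at this
    rw [this, hs]
  refine ⟨s, (Basis.piTensorProduct fun _ : Fin N => Pi.basisFun ℂ (Fin r)).ext fun f => ?_⟩
  have h4 : Basis.piTensorProduct (fun _ : Fin N => Pi.basisFun ℂ (Fin r)) f = e f := by
    rw [Basis.piTensorProduct_apply]
    simp only [Pi.basisFun_apply, e]
  have h5 := LinearMap.congr_fun (commute_unitTensor hT f o).eq (e o)
  rw [Module.End.mul_apply, Module.End.mul_apply, h1, h3, map_smul, h1] at h5
  rw [h4, h5, Module.algebraMap_end_apply]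

end SpinSpace


/-! ## The commutant of the monodromy matrix -/

section Commutant

open PowerSeries

variable {N r : ℕ}

lemma sum_filter_lt_succ {M : Type*} [AddCommMonoid M] {n : ℕ} (hn : n < N) (f : Fin N → M) :
    ∑ i ∈ Finset.univ.filter (fun i : Fin N => (i : ℕ) < n + 1), f i = (∑ i ∈ Finset.univ.filter (fun i : Fin N => (i : ℕ) < n), f i) + f ⟨n, hn⟩ := by
  have : (Finset.univ.filter fun i : Fin N => (i : ℕ) < n + 1) =
      insert ⟨n, hn⟩ (Finset.univ.filter fun i : Fin N => (i : ℕ) < n) := by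
    ext i
    simp only [Finset.mem_filter, Finset.mem_univ, true_and, Finset.mem_insert, Fin.ext_iff]
    lia
  rw [this, Finset.sum_insert (by simp), add_comm]

/-- Families of matrix units at commuting sites whose commutant consists of the scalars. -/
structure IsUnitFamily {R : Type*} [Ring R] [Algebra ℂ R] (m : Fin N → Fin r → Fin r → R) :
    Prop where
  unit_mul : ∀ i a b d e, m i a b * m i d e = if b = d then m i a e else 0
  unit_comm : ∀ i j a b d e, i ≠ j → Commute (m i a b) (m j d e)
  exists_scalar : ∀ T : R, (∀ i a b, Commute T (m i a b)) → ∃ s : ℂ, T = algebraMap ℂ R s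

/-- The elements of `R` with coefficients depending polynomially on the parameters. -/
abbrev SpinAlg (N : ℕ) (R : Type*) [Ring R] [Algebra ℂ R] : Type _ :=
  MvPolynomial (Fin N) ℂ ⊗[ℂ] R

variable {R : Type*} [Ring R] [Algebra ℂ R] {m : Fin N → Fin r → Fin r → R}

/-- The matrix units as elements of `SpinAlg N R`. -/
def siteUnit (m : Fin N → Fin r → Fin r → R) (i : Fin N) (a b : Fin r) : SpinAlg N R :=
  1 ⊗ₜ m i a b

/-- The parameters as elements of `SpinAlg N R`. -/
def sitePar (R : Type*) [Ring R] [Algebra ℂ R] (i : Fin N) : SpinAlg N R :=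
  algebraMap (MvPolynomial (Fin N) ℂ) (SpinAlg N R) (MvPolynomial.X i)

lemma isSpinChain_site (hm : IsUnitFamily m) : IsSpinChain (siteUnit m) (sitePar R) := by
  refine isSpinChain_algebraMap ?_ ?_
  · intro i a b d e
    rw [siteUnit, siteUnit, Algebra.TensorProduct.tmul_mul_tmul, hm.unit_mul, one_mul]
    split_ifs
    · rfl
    · exact TensorProduct.tmul_zero _ _
  · intro i j a b d e h
    rw [Commute, SemiconjBy, siteUnit, siteUnit, Algebra.TensorProduct.tmul_mul_tmul,
      Algebra.TensorProduct.tmul_mul_tmul, (hm.unit_comm i j a b d e h).eq]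

/-- The monodromy matrix of the spin chain. -/
def siteMono (m : Fin N → Fin r → Fin r → R) (c : ℂ) (n : ℕ) (a b : Fin r) :
    PowerSeries (SpinAlg N R) :=
  mono c (siteUnit m) (sitePar R) n a b

lemma map_commute_C {S : Type*} [Ring S] [Algebra ℂ S] (p : Polynomial ℂ) (T : S) :
    Commute (p.map (algebraMap ℂ S)) (Polynomial.C T) := by
  ext n
  rw [Polynomial.coeff_mul_C, Polynomial.coeff_C_mul, Polynomial.coeff_map, Algebra.commutes]

/-- The specialization of the parameters `y_i` to the linear polynomials `η_i s`. -/
def lineEval (R : Type*) [Ring R] [Algebra ℂ R] (η : Fin N → ℂ) :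
    SpinAlg N R →ₐ[ℂ] Polynomial R :=
  Algebra.TensorProduct.lift
    ((Polynomial.mapAlgHom (Algebra.ofId ℂ R)).comp
      (MvPolynomial.aeval fun i => Polynomial.C (η i) * Polynomial.X))
    Polynomial.CAlgHom fun _ _ => map_commute_C _ _

lemma lineEval_tmul (η : Fin N → ℂ) (f : MvPolynomial (Fin N) ℂ) (T : R) :
    lineEval R η (f ⊗ₜ T) = (MvPolynomial.aeval
      (fun i => Polynomial.C (η i) * Polynomial.X) f).map (algebraMap ℂ _) * Polynomial.C T :=
  Algebra.TensorProduct.lift_tmul _ _ _ _ _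

lemma lineEval_siteUnit (η : Fin N → ℂ) (i : Fin N) (a b : Fin r) :
    lineEval R η (siteUnit m i a b) = Polynomial.C (m i a b) := by
  rw [siteUnit, lineEval_tmul, map_one, Polynomial.map_one, one_mul]

lemma lineEval_sitePar (η : Fin N → ℂ) (i : Fin N) :
    lineEval R η (sitePar R i) = Polynomial.C (algebraMap ℂ _ (η i)) * Polynomial.X := by
  rw [sitePar, Algebra.TensorProduct.algebraMap_apply, lineEval_tmul]
  simp

lemma lineEval_eval_one (η : Fin N → ℂ) (f : MvPolynomial (Fin N) ℂ)
    (T : R) :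
    (lineEval R η (f ⊗ₜ T)).eval 1 = MvPolynomial.eval η f • T := by
  have h : (MvPolynomial.aeval (fun i => Polynomial.C (η i) * Polynomial.X) f).eval 1 =
      MvPolynomial.eval η f := by
    have : (Polynomial.aeval (1 : ℂ)).comp (MvPolynomial.aeval
        (fun i => Polynomial.C (η i) * Polynomial.X)) = MvPolynomial.aeval η := by
      ext i
      simp
    have := AlgHom.congr_fun this f
    rwa [AlgHom.comp_apply, Polynomial.coe_aeval_eq_eval, MvPolynomial.aeval_eq_eval] at this
  rw [lineEval_tmul, (map_commute_C _ T).eq, Polynomial.eval_C_mul, Polynomial.eval_one_map, h,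
    ← Algebra.commutes, ← Algebra.smul_def]

/-- After multiplication by the product of all differences y_i - y_j the polynomial vanishes at
every point. -/
lemma eq_zero_of_forall_injective {f : MvPolynomial (Fin N) ℂ}
    (h : ∀ η : Fin N → ℂ, Function.Injective η → MvPolynomial.eval η f = 0) : f = 0 := by
  let v : MvPolynomial (Fin N) ℂ := ∏ p ∈ (Finset.univ : Finset (Fin N)).offDiag,
    (MvPolynomial.X p.1 - MvPolynomial.X p.2)
  have hv : v ≠ 0 := by
    refine Finset.prod_ne_zero_iff.2 fun p hp => sub_ne_zero.2 fun he => ?_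
    exact (Finset.mem_offDiag.1 hp).2.2 (MvPolynomial.X_injective he)
  refine (mul_eq_zero.1 (?_ : f * v = 0)).resolve_right hv
  refine MvPolynomial.funext fun η => ?_
  rw [map_mul, map_zero]
  by_cases hη : Function.Injective η
  · rw [h η hη, zero_mul]
  · rw [Function.not_injective_iff] at hη
    obtain ⟨i, j, hij, hne⟩ := hη
    rw [map_prod, Finset.prod_eq_zero (i := (i, j)) (by simp [hne]) (by simp [hij]), mul_zero]

/-- At s = 1 the line passes through η, so the coordinates of z in a basis of R vanish at all points
with distinct entries. -/
lemma eq_zero_of_lineEval {z : SpinAlg N R}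
    (h : ∀ η : Fin N → ℂ, Function.Injective η → lineEval R η z = 0) : z = 0 := by
  let b := Module.Basis.ofVectorSpace ℂ R
  refine (b.baseChange (MvPolynomial (Fin N) ℂ)).ext_elem fun j => ?_
  rw [map_zero, Finsupp.zero_apply]
  refine eq_zero_of_forall_injective fun η hη => ?_
  have key : ∀ w : SpinAlg N R, MvPolynomial.eval η
      ((b.baseChange (MvPolynomial (Fin N) ℂ)).repr w j) = b.repr ((lineEval R η w).eval 1) j := by
    intro w
    induction w using TensorProduct.induction_on with
    | zero => simp
    | add x y hx hy =>
      simp only [map_add, Finsupp.add_apply, hx, hy, Polynomial.eval_add]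
    | tmul f T =>
      rw [lineEval_eval_one, Module.Basis.baseChange_repr_tmul, MvPolynomial.smul_eval, map_smul,
        Finsupp.smul_apply, smul_eq_mul, mul_comm]
  rw [key, h η hη]
  simp

/-- The leading coefficients of the monodromy matrix along the line through `η`. -/
lemma lineEval_coeff_siteMono (hm : IsUnitFamily m) (c : ℂ) (η : Fin N → ℂ) {n : ℕ} (hn : n ≤ N) (k : ℕ) (a b : Fin r) :
    (lineEval R η (coeff (k + 1) (siteMono m c n a b))).natDegree ≤ k ∧
      (lineEval R η (coeff (k + 1) (siteMono m c n a b))).coeff k =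
        c • ∑ i ∈ Finset.univ.filter (fun i : Fin N => (i : ℕ) < n), η i ^ k • m i a b := by
  induction n generalizing k a b with
  | zero =>
    have : coeff (k + 1) (siteMono m c 0 a b : PowerSeries (SpinAlg N R)) = 0 := by
      simp only [siteMono, mono]
      split_ifs <;> simp [coeff_one]
    rw [this, map_zero]
    simp
  | succ n ih =>
    have ih := fun k a b => ih (Nat.le_of_succ_le hn) k a b
    have hrec := fun k => congrArg (lineEval R η)
      (coeff_succ_mono (c := c) (isSpinChain_site hm) hn a b k)
    simp only [map_sub, map_add, map_mul, map_smul, map_sum, lineEval_siteUnit,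
      lineEval_sitePar] at hrec
    change ∀ k, lineEval R η (coeff (k + 1) (siteMono m c (n + 1) a b)) -
      lineEval R η (coeff (k + 1) (siteMono m c n a b)) =
      Polynomial.C (algebraMap ℂ _ (η ⟨n, hn⟩)) * Polynomial.X *
        (lineEval R η (coeff k (siteMono m c (n + 1) a b)) -
          lineEval R η (coeff k (siteMono m c n a b))) +
        c • ∑ x, Polynomial.C (m ⟨n, hn⟩ a x) * lineEval R η (coeff k (siteMono m c n x b))
      at hrec
    induction k with
    | zero =>
      have h0 : ∀ n a b, lineEval R η (coeff 0 (siteMono m c n a b)) = if a = b then 1 else 0 := by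
        intro n a b
        rw [siteMono, coeff_zero_mono (isSpinChain_site hm)]
        split_ifs <;> simp
      have h1 := hrec 0
      simp only [h0, sub_self, mul_zero, zero_add, mul_ite, mul_one, Finset.sum_ite_eq',
        Finset.mem_univ, if_true] at h1
      rw [sub_eq_iff_eq_add, Polynomial.smul_C] at h1
      have h2 := ih 0 a b
      rw [zero_add] at h2 ⊢
      rw [h1]
      refine ⟨Polynomial.natDegree_add_le_of_degree_le (Polynomial.natDegree_C _).le h2.1, ?_⟩
      rw [Polynomial.coeff_add, h2.2, Polynomial.coeff_C_zero, sum_filter_lt_succ hn]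
      simp only [pow_zero, one_smul, smul_add]
      exact add_comm _ _
    | succ k ihk =>
      have h1 := hrec (k + 1)
      rw [sub_eq_iff_eq_add] at h1
      have h2 := ih (k + 1) a b
      rw [h1]
      -- In the recursion the term with y_n = η_n s raises the degree in s by one and the sum over x
      -- does not, so only the former reaches the top coefficient.
      have h3 : (lineEval R η (coeff (k + 1) (siteMono m c (n + 1) a b)) -
          lineEval R η (coeff (k + 1) (siteMono m c n a b))).natDegree ≤ k :=
        (Polynomial.natDegree_sub_le _ _).trans (max_le ihk.1 (ih k a b).1)
      have h4 : (c • ∑ x, Polynomial.C (m ⟨n, hn⟩ a x) *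
          lineEval R η (coeff (k + 1) (siteMono m c n x b))).natDegree ≤ k := by
        refine (Polynomial.natDegree_smul_le _ _).trans
          (Polynomial.natDegree_sum_le_of_forall_le _ _ fun x _ => ?_)
        exact (Polynomial.natDegree_C_mul_le _ _).trans (ih k x b).1
      rw [mul_assoc]
      refine ⟨Polynomial.natDegree_add_le_of_degree_le (Polynomial.natDegree_add_le_of_degree_le
        ((Polynomial.natDegree_C_mul_le _ _).trans ?_) (h4.trans (Nat.le_succ k))) h2.1, ?_⟩
      · refine Polynomial.natDegree_mul_le.trans ?_
        have := Polynomial.natDegree_X_le (R := R)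
        lia
      · rw [Polynomial.coeff_add, Polynomial.coeff_add, h2.2, Polynomial.coeff_C_mul,
          Polynomial.coeff_X_mul, Polynomial.coeff_eq_zero_of_natDegree_lt (Nat.lt_succ_of_le h4),
          Polynomial.coeff_sub, ihk.2, (ih k a b).2, sum_filter_lt_succ hn, sum_filter_lt_succ hn,
          ← Algebra.smul_def]
        simp only [smul_add, add_sub_cancel_left, smul_smul, add_zero]
        rw [add_comm]
        congr 2
        ring

/-- Operators commuting with the power sums of the matrix units weighted by distinct parameters
commute with the matrix units. -/
lemma commute_matUnit_of_commute_sum {η : Fin N → ℂ} (hη : Function.Injective η) {a b : Fin r}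
    {T : R} (h : ∀ k : ℕ, Commute T (∑ i, η i ^ k • m i a b))
    (i : Fin N) : Commute T (m i a b) := by
  have h1 : ∀ q : Polynomial ℂ, Commute T (∑ i, q.eval (η i) • m i a b) := by
    intro q
    have : ∑ i, q.eval (η i) • (m i a b : R) =
        ∑ k ∈ Finset.range (q.natDegree + 1), q.coeff k • ∑ i, η i ^ k • m i a b := by
      simp only [Polynomial.eval_eq_sum_range, Finset.sum_smul, Finset.smul_sum, smul_smul]
      exact Finset.sum_comm
    rw [this]
    exact Commute.sum_right _ _ _ fun k _ => (h k).smul_right _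
  -- Powers give all polynomial weights; the Lagrange polynomial of η_i isolates the site i.
  have h2 := h1 (Lagrange.basis Finset.univ η i)
  rw [Finset.sum_eq_single i] at h2
  · rwa [Lagrange.eval_basis_self hη.injOn (Finset.mem_univ i), one_smul] at h2
  · intro j _ hj
    rw [Lagrange.eval_basis_of_ne hj.symm (Finset.mem_univ j), zero_smul]
  · simp

/-- Top coefficients in s: that of Q commutes with c Σ η_i^k E_i^{ab} for all k, hence with every
matrix unit, hence is a scalar. Subtracting this central monomial lowers the degree. -/
lemma commute_C_of_commute_lineEval (hm : IsUnitFamily m) {c : ℂ} (hc : c ≠ 0) {η : Fin N → ℂ}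
    (hη : Function.Injective η) (d : ℕ) {Q : Polynomial R}
    (hd : Q.natDegree < d)
    (h : ∀ k a b, Commute Q (lineEval R η (coeff (k + 1) (siteMono m c N a b))))
    (i : Fin N) (a b : Fin r) : Commute Q (Polynomial.C (m i a b)) := by
  induction d generalizing Q with
  | zero => exact absurd hd (Nat.not_lt_zero _)
  | succ d ih =>
    have h1 : ∀ k a b, Commute (Q.coeff d) (∑ i, η i ^ k • m i a b) := by
      intro k a b
      obtain ⟨h2, h3⟩ := lineEval_coeff_siteMono hm c η le_rfl k a b
      have h4 := congrArg (fun P => Polynomial.coeff P (d + k)) (h k a b).eq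
      rw [Polynomial.coeff_mul_add_eq_of_natDegree_le (Nat.le_of_lt_succ hd) h2, add_comm d k,
        Polynomial.coeff_mul_add_eq_of_natDegree_le h2 (Nat.le_of_lt_succ hd), h3] at h4
      simp only [Fin.is_lt, Finset.filter_true] at h4
      have h5 : Commute (Q.coeff d) (c⁻¹ • c • ∑ i, η i ^ k • m i a b) :=
        Commute.smul_right h4 _
      rwa [inv_smul_smul₀ hc] at h5
    obtain ⟨s, hs⟩ := hm.exists_scalar _ fun i a b =>
      commute_matUnit_of_commute_sum hη (fun k => h1 k a b) i
    have hcen : ∀ P, Commute (Polynomial.monomial d (Q.coeff d)) P := by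
      intro P
      rw [hs, ← Polynomial.C_mul_X_pow_eq_monomial]
      refine Commute.mul_left ?_ (Polynomial.X_pow_mul (n := d) (p := P))
      ext n
      rw [Polynomial.coeff_mul_C, Polynomial.coeff_C_mul, Algebra.commutes]
    have hQ : Commute (Q - Polynomial.monomial d (Q.coeff d)) (Polynomial.C (m i a b)) := by
      rcases Nat.eq_zero_or_pos d with rfl | hd0
      · have : Q - Polynomial.monomial 0 (Q.coeff 0) = 0 := by
          rw [Polynomial.monomial_zero_left, sub_eq_zero]
          exact Polynomial.eq_C_of_natDegree_le_zero (Nat.le_of_lt_succ hd)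
        rw [this]
        exact Commute.zero_left _
      · obtain ⟨d, rfl⟩ : ∃ e, d = e + 1 := ⟨d - 1, by lia⟩
        refine ih ?_ fun k a b => (h k a b).sub_left (hcen _)
        refine Nat.lt_succ_of_le (Polynomial.natDegree_le_iff_coeff_eq_zero.2 fun l hl => ?_)
        rw [Polynomial.coeff_sub, Polynomial.coeff_monomial]
        split_ifs with hdl
        · rw [hdl, sub_self]
        · rw [sub_zero]
          exact Polynomial.coeff_eq_zero_of_natDegree_lt (by lia)
    have := hQ.add_left (hcen (Polynomial.C (m i a b)))
    rwa [sub_add_cancel] at this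

/-- The commutant of the entries of the monodromy matrix consists of the polynomials in the
parameters. -/
lemma exists_eq_tmul_one_of_commute (hm : IsUnitFamily m) {c : ℂ} (hc : c ≠ 0) {z : SpinAlg N R}
    (h : ∀ k a b, Commute z (coeff (k + 1) (siteMono m c N a b))) :
    ∃ f : MvPolynomial (Fin N) ℂ, z = f ⊗ₜ 1 := by
  have h1 : ∀ i a b, Commute z (siteUnit m i a b) := by
    intro i a b
    refine sub_eq_zero.1 (eq_zero_of_lineEval fun η hη => ?_)
    rw [map_sub, map_mul, map_mul, lineEval_siteUnit, sub_eq_zero]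
    exact commute_C_of_commute_lineEval hm hc hη _ (Nat.lt_succ_self _)
      (fun k a b => (h k a b).map (lineEval R η)) i a b
  let S : Set R := Set.range fun x : Fin N × Fin r × Fin r =>
    m x.1 x.2.1 x.2.2
  -- The centralizer of 1 ⊗ S is ℂ[y] ⊗ (centralizer of S), and the second factor consists of
  -- scalars.
  have h2 : z ∈ (Algebra.TensorProduct.map (AlgHom.id ℂ (MvPolynomial (Fin N) ℂ))
      (Subalgebra.centralizer ℂ S).val).range := by
    rw [← Subalgebra.centralizer_coe_image_includeRight_eq_center_tensorProduct,
      Subalgebra.mem_centralizer_iff]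
    rintro _ ⟨_, ⟨x, rfl⟩, rfl⟩
    exact (h1 x.1 x.2.1 x.2.2).eq.symm
  obtain ⟨w, rfl⟩ := h2
  clear h h1
  induction w using TensorProduct.induction_on with
  | zero => exact ⟨0, by simp⟩
  | add x y hx hy =>
    obtain ⟨f, hf⟩ := hx
    obtain ⟨g, hg⟩ := hy
    refine ⟨f + g, ?_⟩
    rw [TensorProduct.add_tmul, ← hf, ← hg]
    exact map_add _ _ _
  | tmul f T =>
    obtain ⟨s, hs⟩ := hm.exists_scalar T.1 fun i a b =>
      ((Subalgebra.mem_centralizer_iff _).1 T.2 _ ⟨(i, a, b), rfl⟩).symm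
    refine ⟨s • f, ?_⟩
    change f ⊗ₜ[ℂ] T.1 = _
    rw [hs, Algebra.algebraMap_eq_smul_one, TensorProduct.tmul_smul, TensorProduct.smul_tmul']

end Commutant


/-! ## The image of the centre -/

section CentreImage

open PowerSeries

variable {N r : ℕ} {R : Type*} [Ring R] [Algebra ℂ R] {m : Fin N → Fin r → Fin r → R}

/-- The representation of the Yangian by the monodromy matrix of the spin chain. -/
def siteHom (hm : IsUnitFamily m) (c : ℂ) : Yangian r c →ₐ[ℂ] SpinAlg N R :=
  yangianLift (siteMono m c N) (coeff_zero_mono (isSpinChain_site hm) N)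
    (exchangeRel_mono (isSpinChain_site hm) N)

lemma siteHom_tcoef (hm : IsUnitFamily m) (c : ℂ) (a b : Fin r) (n : ℕ) :
    siteHom hm c (tcoef c a b n) = coeff n (siteMono m c N a b) :=
  yangianLift_tcoef _ _ _ a b n

/-- Existence of permutations of pairs of sites. -/
structure HasSwap (m : Fin N → Fin r → Fin r → R) (i j : Fin N) (p : R) : Prop where
  mul_self : p * p = 1
  left : ∀ a b, p * m i a b = m j a b * p
  right : ∀ a b, p * m j a b = m i a b * p
  comm : ∀ l, l ≠ i → l ≠ j → ∀ a b, Commute p (m l a b)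
  sum_mul : ∀ a b, ∑ x, m j a x * m i x b = p * m i a b

lemma siteHom_mem_center (hm : IsUnitFamily m) {c : ℂ} (hc : c ≠ 0) {z : Yangian r c}
    (hz : z ∈ Subalgebra.center ℂ (Yangian r c)) :
    ∃ f : MvPolynomial (Fin N) ℂ, siteHom hm c z = algebraMap _ _ f := by
  refine exists_eq_tmul_one_of_commute hm hc fun k a b => ?_
  rw [← siteHom_tcoef hm]
  exact Commute.map (Subalgebra.mem_center_iff.1 hz _).symm (siteHom hm c)

/-- Permuting the parameters. -/
def permPar (R : Type*) [Ring R] [Algebra ℂ R] (s : Equiv.Perm (Fin N)) :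
    SpinAlg N R →ₐ[ℂ] SpinAlg N R :=
  Algebra.TensorProduct.map (MvPolynomial.rename s) (AlgHom.id ℂ R)

lemma permPar_algebraMap (s : Equiv.Perm (Fin N)) (f : MvPolynomial (Fin N) ℂ) :
    permPar R s (algebraMap _ _ f) = algebraMap _ _ (MvPolynomial.rename s f) :=
  (Algebra.TensorProduct.map_tmul _ _ _ _).trans (by rw [map_one]; rfl)

lemma permPar_siteUnit (s : Equiv.Perm (Fin N)) (i : Fin N) (a b : Fin r) :
    permPar R s (siteUnit m i a b) = siteUnit m i a b :=
  (Algebra.TensorProduct.map_tmul _ _ _ _).trans (by rw [map_one]; rfl)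

lemma algebraMap_spinAlg_injective [Nontrivial R] :
    Function.Injective (algebraMap (MvPolynomial (Fin N) ℂ) (SpinAlg N R)) := by
  rw [injective_iff_map_eq_zero]
  intro f hf
  refine eq_zero_of_forall_injective fun η _ => ?_
  have h := lineEval_eval_one (R := R) η f 1
  have h0 : (f ⊗ₜ[ℂ] (1 : R) : SpinAlg N R) = 0 := hf
  rw [h0, map_zero, Polynomial.eval_zero] at h
  exact (smul_eq_zero.1 h.symm).resolve_right one_ne_zero

/-- With Δ = y_{i₀+1} - y_{i₀}, the element Q = c + Δ P intertwines the representation with the one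
with exchanged parameters, so (f - s f) Q = 0. Multiplying by c - Δ P gives (f - s f)(c² - Δ²) = 0,
and c² - Δ² is not the zero polynomial since c ≠ 0. -/
lemma rename_swap_eq [Nontrivial R] (hm : IsUnitFamily m) {c : ℂ} (hc : c ≠ 0) {z : Yangian r c}
    {f : MvPolynomial (Fin N) ℂ} (hf : siteHom hm c z = algebraMap _ _ f)
    {i₀ : ℕ} (hi : i₀ + 1 < N) {p : R} (hp : HasSwap m ⟨i₀, by lia⟩ ⟨i₀ + 1, hi⟩ p) :
    MvPolynomial.rename (Equiv.swap ⟨i₀, by lia⟩ ⟨i₀ + 1, hi⟩ : Equiv.Perm (Fin N)) f = f := by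
  set s : Equiv.Perm (Fin N) := Equiv.swap ⟨i₀, by lia⟩ ⟨i₀ + 1, hi⟩ with hs
  let B := MvPolynomial (Fin N) ℂ
  let P : SpinAlg N R := 1 ⊗ₜ p
  let Δ : B := MvPolynomial.X ⟨i₀ + 1, hi⟩ - MvPolynomial.X ⟨i₀, by lia⟩
  let Q : SpinAlg N R := algebraMap B _ (algebraMap ℂ B c) + algebraMap B _ Δ * P
  have ht : ∀ x y : R, (1 ⊗ₜ x : SpinAlg N R) * 1 ⊗ₜ y = 1 ⊗ₜ (x * y) := fun x y => by
    rw [Algebra.TensorProduct.tmul_mul_tmul, one_mul]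
  have hPP : P * P = 1 := by
    rw [ht, hp.mul_self]
    rfl
  have hQ : ∀ a b k, Q * coeff k (siteMono m c N a b) =
      permPar R s (coeff k (siteMono m c N a b)) * Q := by
    intro a b k
    have h := exchange_mul_mono (c := c) (E := siteUnit m) (p := P) (R := Q) hi hPP
      (fun a b => (ht _ _).trans ((congrArg _ (hp.left a b)).trans (ht _ _).symm))
      (fun a b => (ht _ _).trans ((congrArg _ (hp.right a b)).trans (ht _ _).symm))
      (fun l hl hl' a b => (ht _ _).trans ((congrArg _ (hp.comm l
        (fun h => hl (congrArg Fin.val h)) (fun h => hl' (congrArg Fin.val h)) a b).eq).trans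
          (ht _ _).symm))
      (fun a b => by
        refine Eq.trans (Finset.sum_congr rfl fun x _ => ht _ _) ?_
        rw [← TensorProduct.tmul_sum, hp.sum_mul]
        exact (ht _ _).symm)
      (η := MvPolynomial.X) rfl hi le_rfl a b
    have h' := congrArg (coeff k) h
    rw [coeff_C_mul, coeff_mul_C] at h'
    refine h'.trans ?_
    congr 1
    have h2 := congrArg (coeff k) (map_mono (permPar R s) c (siteUnit m) (sitePar R) N a b)
    rw [coeff_map] at h2
    refine Eq.trans ?_ h2.symm
    simp only [permPar_siteUnit, sitePar, permPar_algebraMap, MvPolynomial.rename_X]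
    rfl
  have hQ' : ∀ w, Q * siteHom hm c w = permPar R s (siteHom hm c w) * Q := by
    intro w
    have hw : w ∈ Algebra.adjoin ℂ (Set.range fun x : Fin r × Fin r × ℕ =>
        tcoef c x.1 x.2.1 (x.2.2 + 1)) := by
      rw [adjoin_tcoef]
      exact Algebra.mem_top
    induction hw using Algebra.adjoin_induction with
    | mem x hx =>
      obtain ⟨x, rfl⟩ := hx
      rw [siteHom_tcoef]
      exact hQ _ _ _
    | algebraMap a =>
      rw [AlgHom.commutes, AlgHom.commutes]
      exact (Algebra.commutes _ _).symm
    | add x y _ _ hx hy =>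
      rw [map_add, map_add, mul_add Q, hx, hy]
      exact (add_mul _ _ _).symm
    | mul x y _ _ hx hy =>
      rw [map_mul, map_mul, ← mul_assoc, hx, mul_assoc, hy, mul_assoc]
  have h1 := hQ' z
  rw [hf, permPar_algebraMap, ← Algebra.commutes, ← sub_eq_zero, ← sub_mul, ← map_sub] at h1
  have h2 : Q * (algebraMap B _ (algebraMap ℂ B c) - algebraMap B _ Δ * P) =
      algebraMap B _ (algebraMap ℂ B c ^ 2 - Δ ^ 2) := by
    have e : ∀ b : B, P * algebraMap B _ b = algebraMap B _ b * P := fun b =>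
      (Algebra.commutes b P).symm
    have e2 : algebraMap B (SpinAlg N R) Δ * P * (algebraMap B _ Δ * P) =
        algebraMap B _ (Δ ^ 2) := by
      rw [mul_assoc, ← mul_assoc P, e, mul_assoc, hPP, mul_one, ← map_mul, sq]
    have e3 : algebraMap B (SpinAlg N R) Δ * P * algebraMap B _ (algebraMap ℂ B c) =
      algebraMap B _ (algebraMap ℂ B c) * (algebraMap B _ Δ * P) := (Algebra.commutes _ _).symm
    rw [add_mul, mul_sub, mul_sub, e2, e3, ← map_mul, ← sq]
    refine Eq.trans ?_ (map_sub _ _ _).symm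
    abel
  have h3 : algebraMap B (SpinAlg N R) (f - MvPolynomial.rename s f) * Q *
      (algebraMap B _ (algebraMap ℂ B c) - algebraMap B _ Δ * P) = 0 := by rw [h1, zero_mul]
  rw [mul_assoc, h2, ← map_mul] at h3
  have h4 := algebraMap_spinAlg_injective (h3.trans (map_zero _).symm)
  have h5 : algebraMap ℂ B c ^ 2 - Δ ^ 2 ≠ 0 := by
    intro h
    have := congrArg (MvPolynomial.eval 0) h
    simp [Δ, B, hc] at this
  exact (sub_eq_zero.1 ((mul_eq_zero.1 h4).resolve_right h5)).symm

lemma siteHom_mem_center_symmetric [Nontrivial R] (hm : IsUnitFamily m)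
    (hp : ∀ i j, i ≠ j → ∃ p : R, HasSwap m i j p) {c : ℂ} (hc : c ≠ 0) {z : Yangian r c}
    (hz : z ∈ Subalgebra.center ℂ (Yangian r c)) :
    ∃ f ∈ MvPolynomial.symmetricSubalgebra (Fin N) ℂ, siteHom hm c z = algebraMap _ _ f := by
  obtain ⟨f, hf⟩ := siteHom_mem_center hm hc hz
  refine ⟨f, ?_, hf⟩
  intro w
  rcases N with _ | n
  · rw [Subsingleton.elim w 1]
    exact MvPolynomial.rename_id_apply f
  · have hw : w ∈ Submonoid.closure (Set.range fun i : Fin n => Equiv.swap i.castSucc i.succ) := by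
      rw [Equiv.Perm.mclosure_swap_castSucc_succ]
      exact Submonoid.mem_top _
    induction hw using Submonoid.closure_induction with
    | one => exact MvPolynomial.rename_id_apply f
    | mem x hx =>
      obtain ⟨i, rfl⟩ := hx
      obtain ⟨p, hp⟩ := hp i.castSucc i.succ i.castSucc_lt_succ.ne
      exact rename_swap_eq hm hc hf (i₀ := i) (by lia) hp
    | mul x y _ _ hx hy =>
      have := MvPolynomial.rename_rename (R := ℂ) y x f
      rw [hy, hx] at this
      exact this.symm

lemma map_qdet {A : Type*} [Ring A] [Algebra ℂ A] {c : ℂ} (φ : Yangian r c →ₐ[ℂ] A) :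
    map (φ : Yangian r c →+* A) (qdet r c) =
      qdetSeries c fun a b => map (φ : Yangian r c →+* A) (tSeries c a b) := by
  rw [qdet, qdetSeries, ncDet, map_sum]
  refine Finset.sum_congr rfl fun σ _ => ?_
  rw [map_zsmul, map_list_prod, List.map_ofFn]
  congr 3
  funext a
  exact map_shift φ _ _

/-- The coefficients are central, so they act by polynomials in the parameters; these are identified
by a single non-zero highest vector e. -/
lemma siteHom_coeff_qdet [Nontrivial R] (hm : IsUnitFamily m) {c : ℂ} (hc : c ≠ 0) {o : Fin r}
    (ho : (o : ℕ) + 1 = r) {e : R} (he : ∀ i a b, b ≠ o → m i a b * e = 0)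
    (he' : ∀ i, m i o o * e = e) (he0 : e ≠ 0) (n : ℕ) :
    siteHom hm c (coeff n (qdet r c)) = algebraMap _ _ (siteCoeff N c n) := by
  obtain ⟨f, hf⟩ := siteHom_mem_center hm hc (coeff_qdet_mem_center (r := r) hc n)
  obtain ⟨l, rfl⟩ : ∃ l, r = l + 1 := ⟨o, ho.symm⟩
  obtain rfl : o = Fin.last l := Fin.ext (by simpa using ho)
  have ht : ∀ x y : R, (1 ⊗ₜ x : SpinAlg N R) * 1 ⊗ₜ y = 1 ⊗ₜ (x * y) := fun x y => by
    rw [Algebra.TensorProduct.tmul_mul_tmul, one_mul]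
  have hE : ∀ i a b, b ≠ Fin.last l → siteUnit m i a b * (1 ⊗ₜ e) = 0 := by
    intro i a b hb
    rw [siteUnit, ht, he i a b hb, TensorProduct.tmul_zero]
  have hE' : ∀ i, siteUnit m i (Fin.last l) (Fin.last l) * (1 ⊗ₜ e) = 1 ⊗ₜ e := by
    intro i
    rw [siteUnit, ht, he' i]
  have h1 : (fun a b => map (siteHom hm c : Yangian (l + 1) c →+* SpinAlg N R) (tSeries c a b)) =
      siteMono m c N := by
    funext a b
    ext k
    rw [coeff_map, tSeries, coeff_mk]
    exact siteHom_tcoef hm c a b k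
  have h2 := qdetSeries_mul_C (c := c) (T := siteMono m c N)
    (fun a b hb => mono_mul_C_of_ne (isSpinChain_site hm) hE le_rfl a b hb)
    (mono_mul_C_self (isSpinChain_site hm) hE hE' le_rfl)
  have h3 := congrArg (coeff n) h2
  rw [← h1, ← map_qdet, coeff_mul_C, coeff_mul_C, coeff_map, coeff_map] at h3
  have h4 : (f ⊗ₜ[ℂ] (1 : R) : SpinAlg N R) * 1 ⊗ₜ e =
      (siteCoeff N c n ⊗ₜ[ℂ] (1 : R) : SpinAlg N R) * 1 ⊗ₜ e :=
    (congrArg (· * _) hf).symm.trans h3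
  rw [Algebra.TensorProduct.tmul_mul_tmul, Algebra.TensorProduct.tmul_mul_tmul, one_mul, mul_one,
    mul_one] at h4
  rw [hf]
  congr 1
  refine sub_eq_zero.1 (eq_zero_of_forall_injective fun η _ => ?_)
  have h5 := lineEval_eval_one (R := R) η (f - siteCoeff N c n) e
  rw [TensorProduct.sub_tmul, h4, sub_self, map_zero, Polynomial.eval_zero] at h5
  exact (smul_eq_zero.1 h5.symm).resolve_right he0

end CentreImage

/-! ### The spin space as an instance of the abstract chain. -/

section SpinInstances

variable {N r : ℕ}

lemma isUnitFamily_matUnit (hr : 0 < r) :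
    IsUnitFamily (matUnit : Fin N → Fin r → Fin r → Module.End ℂ (Spin N r)) where
  unit_mul := matUnit_mul_self
  unit_comm _ _ a b d e h := matUnit_commute h a b d e
  exists_scalar _ h := eq_algebraMap_of_commute_matUnit hr h

lemma hasSwap_permU {i j : Fin N} (h : i ≠ j) :
    HasSwap (matUnit : Fin N → Fin r → Fin r → Module.End ℂ (Spin N r)) i j
      (permU r (Equiv.swap i j)) where
  mul_self := by rw [← permU_mul, Equiv.swap_mul_self, permU_one]
  left a b := by rw [permU_mul_matUnit, Equiv.swap_apply_left]
  right a b := by rw [permU_mul_matUnit, Equiv.swap_apply_right]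
  comm l hi hj a b := by
    rw [Commute, SemiconjBy, permU_mul_matUnit, Equiv.swap_apply_of_ne_of_ne hi hj]
  sum_mul a b := sum_matUnit_mul_matUnit h a b

lemma matUnit_mul_unitTensor (i : Fin N) (a b : Fin r) (f g : Fin N → Fin r) :
    matUnit i a b * unitTensor f g =
      if b = f i then unitTensor (Function.update f i a) g else 0 := by
  refine PiTensorProduct.ext (MultilinearMap.ext fun v => ?_)
  simp only [LinearMap.compMultilinearMap_apply, Module.End.mul_apply, unitTensor,
    PiTensorProduct.map_tprod, matUnit_tprod, unitMap_unitMap]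
  split_ifs
  · rw [PiTensorProduct.map_tprod]
    congr 1
    funext j
    by_cases h : j = i
    · subst h
      simp
    · simp [h]
  · rw [MultilinearMap.map_update_zero]
    rfl

lemma unitTensor_ne_zero (f g : Fin N → Fin r) : unitTensor f g ≠ 0 := by
  intro h
  have h1 := LinearMap.congr_fun h (PiTensorProduct.tprod ℂ fun i => Pi.single (g i) (1 : ℂ))
  simp only [unitTensor, PiTensorProduct.map_tprod, unitMap_single, if_true] at h1
  refine (Basis.piTensorProduct fun _ : Fin N => Pi.basisFun ℂ (Fin r)).ne_zero f ?_
  rw [Basis.piTensorProduct_apply]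
  simpa only [Pi.basisFun_apply] using h1.trans (LinearMap.zero_apply _)

end SpinInstances


/-! ## The action on the diagonal invariants -/

section ChainAction

open PowerSeries

variable {N r : ℕ}

/-- The coefficients of the monodromy matrix on a vector whose transforms `v_i^k` are related to
the parameters of the chain by the permutations of the sites. -/
lemma coeff_mono_apply {W : Type*} [AddCommGroup W] [Module ℂ W] {c : ℂ}
    {E : Fin N → Fin r → Fin r → Module.End ℂ W} {y : Fin N → Module.End ℂ W}
    (h : IsSpinChain E y) {P : Fin N → Fin N → Module.End ℂ W}
    (hP : ∀ i j, i ≠ j → ∀ a b, ∑ x, E i a x * E j x b = E i a b * P i j) {ξ : W}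
    {v : Fin N → ℕ → W} (hv₀ : ∀ i, v i 0 = ξ)
    (hv : ∀ i k, y i (v i k) =
      v i (k + 1) - c • ∑ j ∈ Finset.univ.filter (· < i), P i j (v j k))
    {n : ℕ} (hn : n ≤ N) (k : ℕ) (a b : Fin r) :
    coeff (k + 1) (mono c E y n a b) ξ =
      c • ∑ i ∈ Finset.univ.filter (fun i : Fin N => (i : ℕ) < n), E i a b (v i k) := by
  induction n generalizing k a b with
  | zero =>
    have : coeff (k + 1) (mono c E y 0 a b) = 0 := by
      simp only [mono]
      split_ifs <;> simp [coeff_one]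
    rw [this]
    simp
  | succ n ih =>
    have ih := fun k a b => ih (Nat.le_of_succ_le hn) k a b
    have hrec := fun k => LinearMap.congr_fun (coeff_succ_mono (c := c) h hn a b k) ξ
    simp only [LinearMap.sub_apply, LinearMap.add_apply, Module.End.mul_apply,
      LinearMap.smul_apply, LinearMap.sum_apply] at hrec
    rw [sum_filter_lt_succ hn, smul_add, ← ih, ← sub_eq_iff_eq_add']
    induction k with
    | zero =>
      rw [hrec 0, coeff_zero_mono h, coeff_zero_mono h, sub_self, map_zero, zero_add, hv₀]
      congr 1
      rw [Finset.sum_eq_single b]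
      · rw [coeff_zero_mono h, if_pos rfl, Module.End.one_apply]
      · intro x _ hx
        rw [coeff_zero_mono h, if_neg hx, LinearMap.zero_apply, map_zero]
      · simp
    | succ k ihk =>
      have hc : y ⟨n, hn⟩ (E ⟨n, hn⟩ a b (v ⟨n, hn⟩ k)) =
          E ⟨n, hn⟩ a b (y ⟨n, hn⟩ (v ⟨n, hn⟩ k)) :=
        LinearMap.congr_fun (h.par_unit ⟨n, hn⟩ ⟨n, hn⟩ a b).eq _
      have hlt : Finset.univ.filter (fun i : Fin N => (i : ℕ) < n) =
          Finset.univ.filter (· < (⟨n, hn⟩ : Fin N)) := rfl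
      -- By `ih` and `hP` the index x is summed out, E_n^{ax} E_j^{xb} becoming E_n^{ab} P_nj. The
      -- result cancels the correction in `hv`.
      have hs : ∑ x, E ⟨n, hn⟩ a x (coeff (k + 1) (mono c E y n x b) ξ) =
          c • E ⟨n, hn⟩ a b (∑ j ∈ Finset.univ.filter (· < (⟨n, hn⟩ : Fin N)),
            P ⟨n, hn⟩ j (v j k)) := by
        simp only [ih, hlt, map_smul, map_sum]
        rw [← Finset.smul_sum, Finset.sum_comm]
        congr 1
        refine Finset.sum_congr rfl fun j hj => ?_
        have := LinearMap.congr_fun (hP ⟨n, hn⟩ j (Finset.mem_filter.1 hj).2.ne' a b) (v j k)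
        simpa only [LinearMap.sum_apply, Module.End.mul_apply] using this
      rw [hrec (k + 1), ihk, hs, map_smul, hc, hv, map_sub, map_smul, smul_sub, sub_add_cancel]

/-- Evaluation of polynomials at commuting operators. -/
lemma exists_algHom_polyAt {V : Type*} [AddCommGroup V] [Module ℂ V] {T : Fin N → Module.End ℂ V}
    (hT : ∀ i j, Commute (T i) (T j)) :
    ∃ φ : MvPolynomial (Fin N) ℂ →ₐ[ℂ] Module.End ℂ V,
      (∀ i, φ (MvPolynomial.X i) = T i) ∧ ∀ p, φ p = polyAt p T := by
  have hcomm : ∀ x ∈ Set.range T, ∀ y ∈ Set.range T, x * y = y * x := by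
    rintro _ ⟨i, rfl⟩ _ ⟨j, rfl⟩
    exact hT i j
  -- Polynomials are evaluated in the commutative subalgebra generated by the T_i, where the order
  -- of the factors in `polyAt` plays no role.
  let S := Algebra.adjoin ℂ (Set.range T)
  let _ : CommRing S :=
    { (inferInstance : Ring S) with
      mul_comm := fun x y => Subtype.ext (isCommSub_adjoin hcomm x.1 x.2 y.1 y.2) }
  let t : Fin N → S := fun i => ⟨T i, Algebra.subset_adjoin ⟨i, rfl⟩⟩
  refine ⟨S.val.comp (MvPolynomial.aeval t), fun i => ?_, fun p => ?_⟩
  · rw [AlgHom.comp_apply, MvPolynomial.aeval_X]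
    rfl
  · rw [AlgHom.comp_apply, MvPolynomial.aeval_def, MvPolynomial.eval₂_eq', map_sum, polyAt]
    refine Finset.sum_congr rfl fun e _ => ?_
    rw [← Algebra.smul_def, map_smul, ← List.prod_ofFn, map_list_prod, List.map_ofFn]
    rfl

/-- The restriction of a representation to an invariant subspace. -/
def restrictHom {A W : Type*} [Semiring A] [Algebra ℂ A] [AddCommMonoid W] [Module ℂ W]
    (φ : A →ₐ[ℂ] Module.End ℂ W) (I : Submodule ℂ W) (h : ∀ a, ∀ ξ ∈ I, φ a ξ ∈ I) :
    A →ₐ[ℂ] Module.End ℂ I where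
  toFun a := (φ a).restrict (h a)
  map_one' := by
    ext ξ
    simp
  map_mul' a b := by
    ext ξ
    simp
  map_zero' := by
    ext ξ
    simp
  map_add' a b := by
    ext ξ
    simp
  commutes' s := by
    ext ξ
    simp

lemma coe_restrictHom_apply {A W : Type*} [Semiring A] [Algebra ℂ A] [AddCommMonoid W] [Module ℂ W]
    (φ : A →ₐ[ℂ] Module.End ℂ W) (I : Submodule ℂ W) (h : ∀ a, ∀ ξ ∈ I, φ a ξ ∈ I) (a : A)
    (ξ : I) : (restrictHom φ I h a ξ : W) = φ a ξ := rfl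

lemma commute_lTensor_rTensor {U M : Type*} [AddCommGroup U] [Module ℂ U] [AddCommGroup M]
    [Module ℂ M] (S : Module.End ℂ M) (T : Module.End ℂ U) :
    Commute (Module.End.lTensorAlgHom ℂ M U S) (Module.End.rTensorAlgHom ℂ U M T) :=
  TensorProduct.ext' fun _ _ => rfl

/-- The action of the polynomials with coefficients in `End U` on `U ⊗ M`. -/
def spinAction {U M : Type*} [AddCommGroup U] [Module ℂ U] [AddCommGroup M] [Module ℂ M]
    (φ : MvPolynomial (Fin N) ℂ →ₐ[ℂ] Module.End ℂ M) :
    SpinAlg N (Module.End ℂ U) →ₐ[ℂ] Module.End ℂ (U ⊗[ℂ] M) :=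
  Algebra.TensorProduct.lift ((Module.End.lTensorAlgHom ℂ M U).comp φ)
    (Module.End.rTensorAlgHom ℂ U M) fun _ _ => commute_lTensor_rTensor _ _

lemma spinAction_tmul {U M : Type*} [AddCommGroup U] [Module ℂ U] [AddCommGroup M] [Module ℂ M]
    (φ : MvPolynomial (Fin N) ℂ →ₐ[ℂ] Module.End ℂ M) (f : MvPolynomial (Fin N) ℂ)
    (T : Module.End ℂ U) : spinAction φ (f ⊗ₜ T) = TensorProduct.map T (φ f) := by
  refine (Algebra.TensorProduct.lift_tmul _ _ _ f T).trans ?_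
  exact TensorProduct.ext' fun _ _ => rfl

/-- The action of the Yangian on vectors whose transforms by operators `d_i` are related to the
parameters by the permutations of the sites. -/
lemma spinAction_siteHom_apply {U M : Type*} [AddCommGroup U] [Module ℂ U] [AddCommGroup M]
    [Module ℂ M] {m : Fin N → Fin r → Fin r → Module.End ℂ U} (hm : IsUnitFamily m) {c : ℂ}
    {p : Fin N → Fin N → Module.End ℂ U}
    (hp : ∀ i j, i ≠ j → ∀ a b, ∑ x, m i a x * m j x b = m i a b * p i j)
    (φ : MvPolynomial (Fin N) ℂ →ₐ[ℂ] Module.End ℂ M) {ξ : U ⊗[ℂ] M} {d : Fin N → Module.End ℂ M}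
    (hd : ∀ i n, TensorProduct.map (1 : Module.End ℂ U) (φ (MvPolynomial.X i))
      (TensorProduct.map (1 : Module.End ℂ U) (d i ^ n) ξ) =
        TensorProduct.map (1 : Module.End ℂ U) (d i ^ (n + 1)) ξ -
          c • ∑ j ∈ Finset.univ.filter (· < i), TensorProduct.map (p i j) (1 : Module.End ℂ M)
            (TensorProduct.map (1 : Module.End ℂ U) (d j ^ n) ξ)) (a b : Fin r) (n : ℕ) :
    spinAction φ (siteHom hm c (tcoef c a b (n + 1))) ξ =
      ∑ i, c • TensorProduct.map (m i a b) (d i ^ n) ξ := by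
  let E : Fin N → Fin r → Fin r → Module.End ℂ (U ⊗[ℂ] M) := fun i a b =>
    TensorProduct.map (m i a b) 1
  let y : Fin N → Module.End ℂ (U ⊗[ℂ] M) := fun i =>
    TensorProduct.map 1 (φ (MvPolynomial.X i))
  have hcomp : ∀ (S T : Module.End ℂ U) (S' T' : Module.End ℂ M),
      (TensorProduct.map S S' * TensorProduct.map T T' : Module.End ℂ (U ⊗[ℂ] M)) =
        TensorProduct.map (S * T) (S' * T') := fun S T S' T' =>
    (TensorProduct.map_comp _ _ _ _).symm
  have hE : (fun i a b => spinAction φ (siteUnit m i a b)) = E := by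
    funext i a b
    rw [siteUnit, spinAction_tmul, map_one]
  have hy : (fun i => spinAction φ (sitePar (Module.End ℂ U) i)) = y := by
    funext i
    exact spinAction_tmul φ (MvPolynomial.X i) 1
  have hch : IsSpinChain E y := by
    rw [← hE, ← hy]
    have h := isSpinChain_site hm
    constructor
    · intro i a b d e
      rw [← map_mul, h.unit_mul]
      split_ifs
      · rfl
      · exact map_zero _
    · exact fun i j a b d e hij => (h.unit_comm i j a b d e hij).map _
    · exact fun i j a b => (h.par_unit i j a b).map _
    · exact fun i j => (h.par_comm i j).map _
  have hmono := congrArg (coeff (n + 1))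
    (map_mono (spinAction φ) c (siteUnit m) (sitePar (Module.End ℂ U)) N a b)
  rw [coeff_map, hE, hy] at hmono
  rw [siteHom_tcoef]
  refine (LinearMap.congr_fun hmono ξ).trans ?_
  rw [coeff_mono_apply hch (P := fun i j => TensorProduct.map (p i j) 1)
    (ξ := ξ) (v := fun i n => TensorProduct.map 1 (d i ^ n) ξ) ?_ ?_ hd le_rfl]
  · simp only [Fin.is_lt, Finset.filter_true]
    rw [Finset.smul_sum]
    refine Finset.sum_congr rfl fun i _ => ?_
    have := LinearMap.congr_fun (hcomp (m i a b) 1 1 (d i ^ n)) ξ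
    rw [mul_one, one_mul] at this
    exact congrArg _ this
  · intro i j hij a b
    simp only [E, hcomp, mul_one]
    rw [← hp i j hij]
    exact (map_sum (Module.End.rTensorAlgHom ℂ U M) (fun x => m i a x * m j x b)
      Finset.univ).symm
  · intro i
    simp only [pow_zero, TensorProduct.map_one, Module.End.one_apply]

lemma exists_adjoin_qdet_of_siteCoeff {R : Type*} [Ring R] [Algebra ℂ R]
    {m : Fin N → Fin r → Fin r → R} (hm : IsUnitFamily m) {c : ℂ} (hc : c ≠ 0)
    (hq : ∀ n, siteHom hm c (coeff n (qdet r c)) = algebraMap _ _ (siteCoeff N c n))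
    {f : MvPolynomial (Fin N) ℂ} (hf : f ∈ MvPolynomial.symmetricSubalgebra (Fin N) ℂ) :
    ∃ z ∈ Algebra.adjoin ℂ (Set.range fun n => coeff n (qdet r c)),
      siteHom hm c z = algebraMap _ (SpinAlg N R) f := by
  rw [← adjoin_siteCoeff hc] at hf
  induction hf using Algebra.adjoin_induction with
  | mem x hx =>
    obtain ⟨n, rfl⟩ := hx
    exact ⟨_, Algebra.subset_adjoin ⟨n, rfl⟩, hq n⟩
  | algebraMap s =>
    refine ⟨algebraMap _ _ s, Subalgebra.algebraMap_mem _ _, ?_⟩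
    rw [AlgHom.commutes, ← IsScalarTower.algebraMap_apply]
  | add x y _ _ hx hy =>
    obtain ⟨z, hz, hz'⟩ := hx
    obtain ⟨w, hw, hw'⟩ := hy
    exact ⟨z + w, Subalgebra.add_mem _ hz hw, by rw [map_add, hz', hw', ← map_add]⟩
  | mul x y _ _ hx hy =>
    obtain ⟨z, hz, hz'⟩ := hx
    obtain ⟨w, hw, hw'⟩ := hy
    exact ⟨z * w, Subalgebra.mul_mem _ hz hw, by rw [map_mul, hz', hw', ← map_mul]⟩

end ChainAction


/-! ## The spin Calogero–Moser system -/

section QuotientOperators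

variable {N m k : ℕ} {c : ℂ}

/-- The operator induced by `trigDunkl` on the quotient. -/
def quotTrig (hk : 0 < k) (hmk : m * k ≤ N) (hcm : m ≠ 0 → c = 1 / (k : ℂ)) (i : Fin N) :
    Module.End ℂ (QuotM N m k) :=
  (vanishing N m k).mapQ _ (trigDunkl c i) (trigDunkl_mem hk hmk hcm i)

/-- The operator induced by `polyDunkl` on the quotient. -/
def quotPoly (hk : 0 < k) (hmk : m * k ≤ N) (hcm : m ≠ 0 → c = 1 / (k : ℂ)) (i : Fin N) :
    Module.End ℂ (QuotM N m k) :=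
  (vanishing N m k).mapQ _ (polyDunkl c i) (polyDunkl_mem hk hmk hcm i)

lemma isInduced_quotTrig (hk : 0 < k) (hmk : m * k ≤ N) (hcm : m ≠ 0 → c = 1 / (k : ℂ))
    (i : Fin N) : IsInduced (trigDunkl c i) (quotTrig hk hmk hcm i) := fun _ => rfl

lemma isInduced_quotPoly (hk : 0 < k) (hmk : m * k ≤ N) (hcm : m ≠ 0 → c = 1 / (k : ℂ))
    (i : Fin N) : IsInduced (polyDunkl c i) (quotPoly hk hmk hcm i) := fun _ => rfl

lemma end_quot_ext {S T : Module.End ℂ (QuotM N m k)}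
    (h : ∀ f : Laurent N, S (Submodule.Quotient.mk f) = T (Submodule.Quotient.mk f)) : S = T :=
  LinearMap.ext fun z => by
    obtain ⟨f, rfl⟩ := Submodule.Quotient.mk_surjective _ z
    exact h f

lemma quotTrig_commute (hk : 0 < k) (hmk : m * k ≤ N) (hcm : m ≠ 0 → c = 1 / (k : ℂ))
    (i j : Fin N) : Commute (quotTrig hk hmk hcm i) (quotTrig hk hmk hcm j) :=
  end_quot_ext fun f => congrArg Submodule.Quotient.mk
    (LinearMap.congr_fun (trigDunkl_commute c i j).eq f)

lemma permM_mul_quotPoly (hk : 0 < k) (hmk : m * k ≤ N) (hcm : m ≠ 0 → c = 1 / (k : ℂ))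
    (w : Equiv.Perm (Fin N)) (i : Fin N) :
    permM m k w * quotPoly hk hmk hcm i = quotPoly hk hmk hcm (w i) * permM m k w :=
  end_quot_ext fun f => congrArg Submodule.Quotient.mk
    (LinearMap.congr_fun (permAct_polyDunkl c w i) f)

lemma quotTrig_eq (hk : 0 < k) (hmk : m * k ≤ N) (hcm : m ≠ 0 → c = 1 / (k : ℂ)) (i : Fin N) :
    quotTrig hk hmk hcm i = quotPoly hk hmk hcm i -
      c • ∑ j ∈ Finset.univ.filter (· < i), permM m k (Equiv.swap i j) := by
  refine end_quot_ext fun f => ?_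
  have h := congrArg (vanishing N m k).mkQ (LinearMap.congr_fun (trigDunkl_eq c i) f)
  simp only [LinearMap.sub_apply, LinearMap.smul_apply, LinearMap.sum_apply, map_sub, map_smul,
    map_sum] at h
  simp only [LinearMap.sub_apply, LinearMap.smul_apply, LinearMap.sum_apply]
  exact h

end QuotientOperators

/-! ### Comparison of ∇_i and D_i on the diagonal invariants. -/

section InvariantVectors

lemma map_one_sub_smul_sum {U M ι : Type*} [AddCommGroup U] [Module ℂ U] [AddCommGroup M]
    [Module ℂ M] (S : Module.End ℂ M) (c : ℂ) (s : Finset ι) (T : ι → Module.End ℂ M)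
    (ζ : U ⊗[ℂ] M) : TensorProduct.map (1 : Module.End ℂ U) (S - c • ∑ j ∈ s, T j) ζ =
      TensorProduct.map (1 : Module.End ℂ U) S ζ -
        c • ∑ j ∈ s, TensorProduct.map (1 : Module.End ℂ U) (T j) ζ := by
  have h := LinearMap.congr_fun (map_sub (Module.End.lTensorAlgHom ℂ M U) S (c • ∑ j ∈ s, T j)) ζ
  rw [map_smul, map_sum, LinearMap.sub_apply, LinearMap.smul_apply, LinearMap.sum_apply] at h
  exact h

variable {N r m k : ℕ} {c : ℂ}

lemma mem_invariants_iff {ξ : SpinM N r m k} : ξ ∈ invariants N r m k ↔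
    ∀ w : Equiv.Perm (Fin N), TensorProduct.map (permU r w) (permM m k w) ξ = ξ := by
  simp [invariants, Submodule.mem_iInf, LinearMap.mem_eqLocus]

/-- The diagonal permutation is moved to the right past both operators by equivariance and then
absorbed by the invariant ξ. -/
lemma map_perm_map_matUnit_pow (hk : 0 < k) (hmk : m * k ≤ N) (hcm : m ≠ 0 → c = 1 / (k : ℂ))
    (w : Equiv.Perm (Fin N)) {ξ : SpinM N r m k} (hξ : ξ ∈ invariants N r m k)
    {S T : Module.End ℂ (Spin N r)} (hST : permU r w * S = T * permU r w) (i : Fin N) (n : ℕ) :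
    TensorProduct.map (permU r w) (permM m k w)
        (TensorProduct.map S (quotPoly hk hmk hcm i ^ n) ξ) =
      TensorProduct.map T (quotPoly hk hmk hcm (w i) ^ n) ξ := by
  have hpow : permM m k w * quotPoly hk hmk hcm i ^ n =
      quotPoly hk hmk hcm (w i) ^ n * permM m k w :=
    SemiconjBy.pow_right (permM_mul_quotPoly hk hmk hcm w i) n
  conv_rhs => rw [← mem_invariants_iff.1 hξ w]
  rw [← LinearMap.comp_apply, ← LinearMap.comp_apply, ← TensorProduct.map_comp,
    ← TensorProduct.map_comp, ← Module.End.mul_eq_comp, ← Module.End.mul_eq_comp,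
    ← Module.End.mul_eq_comp, ← Module.End.mul_eq_comp, hST, hpow]

/-- The matrix coefficients of the Yangian action preserve the invariants. -/
lemma sum_matUnit_mem_invariants (hk : 0 < k) (hmk : m * k ≤ N)
    (hcm : m ≠ 0 → c = 1 / (k : ℂ)) {ξ : SpinM N r m k} (hξ : ξ ∈ invariants N r m k)
    (a b : Fin r) (n : ℕ) :
    ∑ i, TensorProduct.map (matUnit i a b) (quotPoly hk hmk hcm i ^ n) ξ ∈
      invariants N r m k := by
  refine mem_invariants_iff.2 fun w => ?_
  rw [map_sum, ← Equiv.sum_comp w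
    fun i => TensorProduct.map (matUnit i a b) (quotPoly hk hmk hcm i ^ n) ξ]
  exact Finset.sum_congr rfl fun i _ =>
    map_perm_map_matUnit_pow hk hmk hcm w hξ (permU_mul_matUnit w i a b) i n

/-- For invariant ξ the permutation s_ij of the variables sends D_i^n ξ to P_ij D_j^n ξ, P_ij
permuting the tensor factors. With ∇_i = D_i - c Σ_{j<i} s_ij this is the recursion required by
`coeff_mono_apply` for the vectors D_i^n ξ. -/
lemma map_quotTrig_pow (hk : 0 < k) (hmk : m * k ≤ N) (hcm : m ≠ 0 → c = 1 / (k : ℂ))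
    {ξ : SpinM N r m k} (hξ : ξ ∈ invariants N r m k) (i : Fin N) (n : ℕ) :
    TensorProduct.map (1 : Module.End ℂ (Spin N r)) (quotTrig hk hmk hcm i)
        (TensorProduct.map (1 : Module.End ℂ (Spin N r)) (quotPoly hk hmk hcm i ^ n) ξ) =
      TensorProduct.map (1 : Module.End ℂ (Spin N r)) (quotPoly hk hmk hcm i ^ (n + 1)) ξ -
        c • ∑ j ∈ Finset.univ.filter (· < i), TensorProduct.map (permU r (Equiv.swap i j)) 1
          (TensorProduct.map (1 : Module.End ℂ (Spin N r)) (quotPoly hk hmk hcm j ^ n) ξ) := by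
  have hcomp : ∀ (S T : Module.End ℂ (Spin N r)) (S' T' : Module.End ℂ (QuotM N m k))
      (ζ : SpinM N r m k), TensorProduct.map S S' (TensorProduct.map T T' ζ) =
        TensorProduct.map (S * T) (S' * T') ζ := by
    intro S T S' T' ζ
    rw [← LinearMap.comp_apply, ← TensorProduct.map_comp]
    rfl
  have hswap : ∀ j, TensorProduct.map (1 : Module.End ℂ (Spin N r)) (permM m k (Equiv.swap i j))
      (TensorProduct.map (1 : Module.End ℂ (Spin N r)) (quotPoly hk hmk hcm i ^ n) ξ) =
      TensorProduct.map (permU r (Equiv.swap i j)) 1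
          (TensorProduct.map (1 : Module.End ℂ (Spin N r)) (quotPoly hk hmk hcm j ^ n) ξ) := by
    intro j
    have h := map_perm_map_matUnit_pow hk hmk hcm (Equiv.swap i j) hξ
      (S := 1) (T := 1) (by rw [mul_one, one_mul]) i n
    rw [Equiv.swap_apply_left] at h
    rw [← h, hcomp (permU r (Equiv.swap i j)) (permU r (Equiv.swap i j)), ← permU_mul,
      Equiv.swap_mul_self, permU_one, one_mul]
  rw [quotTrig_eq, map_one_sub_smul_sum, hcomp, one_mul, ← pow_succ']
  simp only [hswap]

/-- The action of the Yangian on the invariants is given by the operators `D_i`. -/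
lemma spinAction_siteMono (hr : 0 < r) (hk : 0 < k) (hmk : m * k ≤ N)
    (hcm : m ≠ 0 → c = 1 / (k : ℂ)) {φ : MvPolynomial (Fin N) ℂ →ₐ[ℂ] Module.End ℂ (QuotM N m k)}
    (hφ : ∀ i, φ (MvPolynomial.X i) = quotTrig hk hmk hcm i)
    {ξ : SpinM N r m k} (hξ : ξ ∈ invariants N r m k) (a b : Fin r) (n : ℕ) :
    spinAction φ (siteHom (isUnitFamily_matUnit hr) c (tcoef c a b (n + 1))) ξ =
      ∑ i, c • TensorProduct.map (matUnit i a b) (quotPoly hk hmk hcm i ^ n) ξ := by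
  refine spinAction_siteHom_apply (isUnitFamily_matUnit hr)
    (p := fun i j => permU r (Equiv.swap i j)) ?_ φ ?_ a b n
  · intro i j hij a b
    have h := sum_matUnit_mul_matUnit hij.symm a b
    rwa [permU_mul_matUnit, Equiv.swap_apply_left, Equiv.swap_comm] at h
  · intro i n
    rw [hφ]
    exact map_quotTrig_pow hk hmk hcm hξ i n

lemma nontrivial_end_spin (hr : 0 < r) : Nontrivial (Module.End ℂ (Spin N r)) :=
  ⟨⟨_, _, unitTensor_ne_zero (fun _ => ⟨0, hr⟩) (fun _ => ⟨0, hr⟩)⟩⟩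

lemma exists_adjoin_qdet (hr : 0 < r) (hc : c ≠ 0) {f : MvPolynomial (Fin N) ℂ}
    (hf : f ∈ MvPolynomial.symmetricSubalgebra (Fin N) ℂ) :
    ∃ z ∈ Algebra.adjoin ℂ (Set.range fun n => PowerSeries.coeff n (qdet r c)),
      siteHom (isUnitFamily_matUnit hr) c z =
        algebraMap _ (SpinAlg N (Module.End ℂ (Spin N r))) f := by
  -- The last index, whose row carries the unshifted factor of the quantum determinant.
  let o : Fin r := ⟨r - 1, by lia⟩
  have := nontrivial_end_spin (N := N) hr
  refine exists_adjoin_qdet_of_siteCoeff (isUnitFamily_matUnit hr) hc (siteHom_coeff_qdet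
    (isUnitFamily_matUnit hr) hc (o := o) (by simp [o]; lia)
    (e := unitTensor (fun _ : Fin N => o) (fun _ => o)) ?_ ?_ (unitTensor_ne_zero _ _)) hf
  · intro i a b hb
    rw [matUnit_mul_unitTensor, if_neg hb]
  · intro i
    rw [matUnit_mul_unitTensor, if_pos rfl]
    congr 1
    exact Function.update_eq_self i _

lemma spinAction_siteHom_mem (hr : 0 < r) (hk : 0 < k) (hmk : m * k ≤ N)
    (hcm : m ≠ 0 → c = 1 / (k : ℂ)) {φ : MvPolynomial (Fin N) ℂ →ₐ[ℂ] Module.End ℂ (QuotM N m k)}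
    (hφ : ∀ i, φ (MvPolynomial.X i) = quotTrig hk hmk hcm i) (z : Yangian r c)
    {ξ : SpinM N r m k} (hξ : ξ ∈ invariants N r m k) :
    spinAction φ (siteHom (isUnitFamily_matUnit hr) c z) ξ ∈ invariants N r m k := by
  have hz : z ∈ Algebra.adjoin ℂ (Set.range fun x : Fin r × Fin r × ℕ =>
      tcoef c x.1 x.2.1 (x.2.2 + 1)) := by
    rw [adjoin_tcoef]
    exact Algebra.mem_top
  induction hz using Algebra.adjoin_induction generalizing ξ with
  | mem x hx =>
    obtain ⟨x, rfl⟩ := hx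
    rw [spinAction_siteMono hr hk hmk hcm hφ hξ, ← Finset.smul_sum]
    exact Submodule.smul_mem _ _ (sum_matUnit_mem_invariants hk hmk hcm hξ _ _ _)
  | algebraMap s =>
    rw [AlgHom.commutes, AlgHom.commutes, Module.algebraMap_end_apply]
    exact Submodule.smul_mem _ _ hξ
  | add x y _ _ hx hy =>
    rw [map_add, map_add, LinearMap.add_apply]
    exact Submodule.add_mem _ (hx hξ) (hy hξ)
  | mul x y _ _ hx hy =>
    rw [map_mul, map_mul, Module.End.mul_apply]
    exact hx (hy hξ)

end InvariantVectors


/-! ### Restriction to an invariant subspace. -/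

section CentreOfImage

/-- The image of the centre in the restriction of a representation to an invariant subspace. -/
lemma exists_restriction_of_center {Y W P : Type*} [Semiring Y] [Algebra ℂ Y] [AddCommMonoid W]
    [Module ℂ W] (φ : Y →ₐ[ℂ] Module.End ℂ W) (I : Submodule ℂ W) (hI : ∀ a, ∀ ξ ∈ I, φ a ξ ∈ I)
    {q : ℕ → Y} (hq : ∀ n, q n ∈ Subalgebra.center ℂ Y) {F : P → Module.End ℂ W}
    (hF : ∀ p, ∃ z ∈ Algebra.adjoin ℂ (Set.range q), φ z = F p)
    (hcenter : ∀ z ∈ Subalgebra.center ℂ Y, ∃ p, φ z = F p) :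
    ∃ (H : P → Module.End ℂ I) (ρ : Y →ₐ[ℂ] Module.End ℂ I),
      (∀ p ξ, (H p ξ : W) = F p ξ) ∧ (∀ y ξ, (ρ y ξ : W) = φ y ξ) ∧
      (Subalgebra.center ℂ Y).map ρ = Algebra.adjoin ℂ (Set.range H) ∧
      Algebra.adjoin ℂ (Set.range fun n => ρ (q n)) = Algebra.adjoin ℂ (Set.range H) ∧
      (∀ B : Subalgebra ℂ Y, Subalgebra.center ℂ Y ≤ B → ∀ p, H p ∈ B.map ρ) ∧
      ∀ y p, Commute (ρ y) (H p) := by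
  choose z hz hzF using hF
  let ρ := restrictHom φ I hI
  -- Taking H p as the image of a central preimage of F p makes it an operator on I at once: F p
  -- preserves I because φ does.
  let H : P → Module.End ℂ I := fun p => ρ (z p)
  have hcen : Algebra.adjoin ℂ (Set.range q) ≤ Subalgebra.center ℂ Y := Algebra.adjoin_le (by
    rintro _ ⟨n, rfl⟩
    exact hq n)
  have hH : ∀ w ∈ Subalgebra.center ℂ Y, ∃ p, ρ w = H p := by
    intro w hw
    obtain ⟨p, hp⟩ := hcenter w hw
    refine ⟨p, LinearMap.ext fun ξ => Subtype.ext ?_⟩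
    rw [coe_restrictHom_apply, coe_restrictHom_apply, hp, hzF]
  have hHc : ∀ p, H p ∈ (Subalgebra.center ℂ Y).map ρ := fun p => ⟨z p, hcen (hz p), rfl⟩
  have h1 : (Subalgebra.center ℂ Y).map ρ = Algebra.adjoin ℂ (Set.range H) := by
    refine le_antisymm ?_ (Algebra.adjoin_le ?_)
    · rintro _ ⟨w, hw, rfl⟩
      obtain ⟨p, hp⟩ := hH w hw
      change ρ w ∈ _
      rw [hp]
      exact Algebra.subset_adjoin ⟨p, rfl⟩
    · rintro _ ⟨p, rfl⟩
      exact hHc p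
  refine ⟨H, ρ, fun p ξ => ?_, fun y ξ => rfl, h1, le_antisymm (Algebra.adjoin_le ?_)
    (Algebra.adjoin_le ?_), fun B hB p => Subalgebra.map_mono hB (hHc p), fun y p => ?_⟩
  · rw [← hzF]
    rfl
  · rintro _ ⟨n, rfl⟩
    rw [← h1]
    exact ⟨_, hq n, rfl⟩
  · rintro _ ⟨p, rfl⟩
    have h2 : H p ∈ (Algebra.adjoin ℂ (Set.range q)).map ρ := ⟨z p, hz p, rfl⟩
    rw [AlgHom.map_adjoin, ← Set.range_comp] at h2
    exact h2
  · exact Commute.map (Subalgebra.mem_center_iff.1 (hcen (hz p)) y) ρ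

end CentreOfImage

/-! ### The representation on the spin module. -/

section SpinRepresentation

variable {N r m k : ℕ} {c : ℂ}

/-- φ is the spin chain with the parameters ∇_i, a representation on all of U ⊗ M; its expression
through the D_i is valid on invariant vectors. F p is the action of the symmetric polynomial p in
the parameters. -/
lemma exists_yangian_action (hr : 0 < r) (hk : 0 < k) (hmk : m * k ≤ N) (hc : c ≠ 0)
    (hcm : m ≠ 0 → c = 1 / (k : ℂ)) :
    ∃ (φ : Yangian r c →ₐ[ℂ] Module.End ℂ (SpinM N r m k))
      (F : MvPolynomial.symmetricSubalgebra (Fin N) ℂ → Module.End ℂ (SpinM N r m k)),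
      (∀ y, ∀ ξ ∈ invariants N r m k, φ y ξ ∈ invariants N r m k) ∧
      (∀ p, ∃ z ∈ Algebra.adjoin ℂ (Set.range fun n => PowerSeries.coeff n (qdet r c)),
        φ z = F p) ∧
      (∀ z ∈ Subalgebra.center ℂ (Yangian r c), ∃ p, φ z = F p) ∧
      (∀ p ξ, F p ξ = TensorProduct.map LinearMap.id
        (polyAt (p : MvPolynomial (Fin N) ℂ) (quotTrig hk hmk hcm)) ξ) ∧
      (∀ (a b : Fin r) (n : ℕ), ∀ ξ ∈ invariants N r m k, φ (tcoef c a b (n + 1)) ξ =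
        ∑ i, c • TensorProduct.map (matUnit i a b) (quotPoly hk hmk hcm i ^ n) ξ) := by
  obtain ⟨φ, hφ, hφp⟩ := exists_algHom_polyAt (quotTrig_commute hk hmk hcm)
  have hu := isUnitFamily_matUnit (N := N) hr
  have := nontrivial_end_spin (N := N) hr
  refine ⟨(spinAction φ).comp (siteHom hu c), fun p => spinAction φ
    (algebraMap _ (SpinAlg N (Module.End ℂ (Spin N r))) (p : MvPolynomial (Fin N) ℂ)),
    fun y ξ hξ => spinAction_siteHom_mem hr hk hmk hcm hφ y hξ, ?_, ?_, ?_,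
    fun a b n ξ hξ => spinAction_siteMono hr hk hmk hcm hφ hξ a b n⟩
  · intro p
    obtain ⟨z, hz, hzp⟩ := exists_adjoin_qdet hr hc p.2
    exact ⟨z, hz, congrArg (spinAction φ) hzp⟩
  · intro z hz
    obtain ⟨f, hf, hzf⟩ := siteHom_mem_center_symmetric hu
      (fun i j hij => ⟨_, hasSwap_permU hij⟩) hc hz
    exact ⟨⟨f, hf⟩, congrArg (spinAction φ) hzf⟩
  · intro p ξ
    exact LinearMap.congr_fun ((spinAction_tmul φ (p : MvPolynomial (Fin N) ℂ) 1).trans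
      (by rw [hφp]; rfl)) ξ

end SpinRepresentation

end SpinCM
end

theorem mainTheorem7 (N r m k : ℕ) (hr : 0 < r) (hk : 2 ≤ k) (hmk : m * k ≤ N)
    (c : ℂ) (hc : c ≠ 0) (hcm : m ≠ 0 → c = 1 / (k : ℂ)) :
    ∃ (nabla D : Fin N → Module.End ℂ (SpinCM.QuotM N m k))
      (H : MvPolynomial.symmetricSubalgebra (Fin N) ℂ →
        Module.End ℂ (SpinCM.invariants N r m k))
      (ρ : SpinCM.Yangian r c →ₐ[ℂ] Module.End ℂ (SpinCM.invariants N r m k)),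
      -- the Dunkl operators act on the quotient module, and the first ones commute
      (∀ i, SpinCM.IsInduced (SpinCM.trigDunkl c i) (nabla i)) ∧
      (∀ i, SpinCM.IsInduced (SpinCM.polyDunkl c i) (D i)) ∧
      (∀ i j, Commute (nabla i) (nabla j)) ∧
      -- `H p` is the restriction of `p(∇)` to the invariants
      (∀ p ξ, (H p ξ : SpinCM.SpinM N r m k) =
        TensorProduct.map LinearMap.id (SpinCM.polyAt (p : MvPolynomial (Fin N) ℂ) nabla)
          (ξ : SpinCM.SpinM N r m k)) ∧
      -- `ρ` is the representation `t^{ab}(u) ↦ δ_{ab} + ∑_i c E_i^{ab} (u - D_i)⁻¹`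
      (∀ (a b : Fin r) (n : ℕ) ξ, (ρ (SpinCM.tcoef c a b (n + 1)) ξ : SpinCM.SpinM N r m k) =
        ∑ i, c • TensorProduct.map (SpinCM.matUnit i a b) (D i ^ n)
          (ξ : SpinCM.SpinM N r m k)) ∧
      -- the image of the centre, and of the quantum determinant
      (Subalgebra.center ℂ (SpinCM.Yangian r c)).map ρ = Algebra.adjoin ℂ (Set.range H) ∧
      Algebra.adjoin ℂ (Set.range fun n => ρ (PowerSeries.coeff n (SpinCM.qdet r c))) =
        Algebra.adjoin ℂ (Set.range H) ∧
      -- the image of the Gelfand–Tsetlin subalgebra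
      SpinCM.IsCommSub ((SpinCM.gelfandTsetlin r c).map ρ) ∧
      (∀ p, H p ∈ (SpinCM.gelfandTsetlin r c).map ρ) ∧
      -- the image of an arbitrary maximal commutative subalgebra
      (∀ B : Subalgebra ℂ (SpinCM.Yangian r c), Maximal SpinCM.IsCommSub B →
        SpinCM.IsCommSub (B.map ρ) ∧ ∀ p, H p ∈ B.map ρ) ∧
      -- the image of the whole Yangian commutes with the integrals
      (∀ y p, Commute (ρ y) (H p)) := by
  have hk0 : 0 < k := by lia
  obtain ⟨φ, F, hI, hF, hcenter, hFp, hφ⟩ :=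
    SpinCM.exists_yangian_action (N := N) (m := m) hr hk0 hmk hc hcm
  obtain ⟨H, ρ, hH, hρ, h1, h2, h3, h4⟩ := SpinCM.exists_restriction_of_center φ
    (SpinCM.invariants N r m k) hI (SpinCM.coeff_qdet_mem_center (r := r) hc) hF hcenter
  exact ⟨SpinCM.quotTrig hk0 hmk hcm, SpinCM.quotPoly hk0 hmk hcm, H, ρ,
    SpinCM.isInduced_quotTrig hk0 hmk hcm, SpinCM.isInduced_quotPoly hk0 hmk hcm,
    SpinCM.quotTrig_commute hk0 hmk hcm, fun p ξ => (hH p ξ).trans (hFp p ξ),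
    fun a b n ξ => (hρ _ ξ).trans (hφ a b n ξ ξ.2), h1, h2,
    SpinCM.isCommSub_gelfandTsetlin.map ρ, h3 _ (SpinCM.center_le_gelfandTsetlin hr),
    fun B hB => ⟨SpinCM.IsCommSub.map hB.prop ρ, h3 B (SpinCM.center_le_of_maximal hB)⟩, h4⟩
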